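/- **Language.** Formulas of $\mu\mathsf{PA}$ are built from $s<t$, $s\nless t$, $s=t$, $s\neq t$ ($s,t$ terms over $0,\mathsf S,+,\times$) and $t\in S$ by $\wedge,\vee,\forall x,\exists x$, where a set term $S$ is a set variable $X$ or a fixed point $\mu Xx\,\varphi$ or $\nu Xx\,\varphi$ in which $X$ occurs positively; every set variable is bound. Negation $\neg$ is defined by De Morgan duality, with $\neg(t\in\mu Xx\,\varphi(X)):=t\in\nu Xx\,\neg\varphi(\neg X)$ and dually. Sequents are finite lists of formulas. In annotated formulas the binders $\mu,\nu$ may carry ordinal variables $\kappa\in\{\xi_0,\xi_1,\dots\}$, written $\mu^\kappa,\nu^\kappa$; $\Gamma^-$ is $\Gamma$ with all ordinal variables deleted. **Cyclic progressing proofs.** A coderivation is a possibly infinite tree of rule instances; it is *cyclic* if it has only finitely many distinct sub-coderivations. $\mu\mathsf{PA}$-coderivations use the one-sided rules of first-order logic with equality (identity $\Gamma,\neg\varphi,\varphi$; weakening; exchange; substitution of terms for number variables; cut; $\wedge,\vee,\forall,\exists$; axiom $t=t$; from $\Gamma(s)$ infer $\Gamma(t),s\neq t$), the axioms $\mathsf{PA}_1$–$\mathsf{PA}_7$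 for $0,\mathsf S,+,\times,<$, the axiom $t\in\mathbf N$ with $\mathbf N=\mu Xx(x=0\vee\exists y(y\in X\wedge x=\mathsf Sy))$, and, for $\sigma\in\{\mu,\nu\}$, the rule: from $\Gamma,\varphi[\sigma Xx\,\varphi/X,t/x]$ infer $\Gamma,t\in\sigma Xx\,\varphi$. A *trace* along an infinite branch follows, from some point on, formula occurrences from the conclusion of each rule to a premise (principal to active formula, side formula to the same side formula); a set term $\sigma Xx\,\varphi$ *progresses* where the formula $t\in\sigma Xx\,\varphi$ of the trace is principal for the rule $\sigma$. The trace is *progressing* if some $\nu$-term progresses infinitely often and has the least number of symbols among all set terms that progress infinitely often, where every number term counts as a single symbol. A *progressing proof* is a $\mu\mathsf{PA}$-coderivation each of whose infinite branches has a progressing trace. $\circlearrowright\!\mu\mathsf{PA}\vdash\varphi$ means that there is a cyclic progressing proof of $\varphi$. **Cyclic reset proofs.** A constraint $\mathcal O$ is a finite set $V_{\mathcal O}$ of ordinal variables with a strict partial order in which the elements above any given element are linearly ordered. An extended sequent $\mathcal O:\Gamma$ is a constraint with an annotated sequent all of whose ordinal variables lie in $V_{\mathcal O}$. Annotated coderivations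 have the rules above except $\nu$, with an unchanged constraint $\mathcal O$ added to premises and conclusion (the identity rule having no side formulas, the rule $\mu$ being for un-annotated $\mu$), and moreover: - $(\nu)$: from $\mathcal O+\lambda:\Gamma,t\in\nu^\lambda Xx\,\varphi$ infer $\mathcal O:\Gamma,t\in\nu Xx\,\varphi$, with $\lambda$ fresh, where $\mathcal O+\lambda$ adds $\lambda$ unrelated to all others; - $(\nu^\kappa)$: from $\mathcal O+_\kappa\lambda:\Gamma,\varphi[\nu^\lambda Xx\,\varphi/X,t/x]$ infer $\mathcal O:\Gamma,t\in\nu^\kappa Xx\,\varphi$, with $\lambda$ fresh, where $\mathcal O+_\kappa\lambda$ adds $\lambda$ as a child of $\kappa$; - constraint weakening: from $\mathcal O\setminus L:\Gamma$ infer $\mathcal O:\Gamma$, for $L\subseteq V_{\mathcal O}$. The *reset rule* $RS(\kappa)$ is the case of constraint weakening where $\kappa$ does not occur in $\Gamma$ and $L\neq\emptyset$ is the set of children (immediate predecessors) of $\kappa$; the *pruning rule* is the case where $L\neq\emptyset$ is the set of those $\kappa\in V_{\mathcal O}$ such that no $\lambda\le_{\mathcal O}\kappa$ occurs in $\Gamma$.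 A *reset proof* is an annotated coderivation such that each infinite branch has an ordinal variable that belongs to all constraints of the branch from some point on and is reset infinitely often. $\circlearrowright\!\mu\mathsf{PA}_{\mathrm{ann}}\vdash\emptyset:\varphi$ means that there is a cyclic reset proof of $\emptyset:\varphi$. **Translation.** Call an annotated coderivation $\mathcal E$ a *translation* of a $\mu\mathsf{PA}$-coderivation $\mathcal D$ if it follows $\mathcal D$ rule by rule from the root as follows. For each rule of $\mathcal D$ that has premises, $\mathcal E$ first performs (bottom-up) reset and pruning steps until none can be applied, and then the same rule on annotated formulas; the rule $\nu$ of $\mathcal D$ is simulated by $\nu^\kappa$ if the principal formula carries an ordinal variable $\kappa$ at its outermost $\nu$, and otherwise by $\nu$ followed by $\nu^\kappa$. Fresh ordinal variables are always the $\xi_i$ of least index not in the constraint, and cut formulas are not annotated. **Theorem.** Let $\varphi$ be a formula of $\mu\mathsf{PA}$. 1. If $\circlearrowright\!\mu\mathsf{PA}\vdash\varphi$, then $\circlearrowright\!\mu\mathsf{PA}_{\mathrm{ann}}\vdash\emptyset:\varphi$. 2. If $\mathcal D$ is a cyclic progressing proof of $\varphi$ all of whose identity steps have the form $\neg\psi,\psi$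 with $\psi$ one of $s<t$, $s\nless t$, $s=t$, $s\neq t$, then $\mathcal D$ has a translation with conclusion $\emptyset:\varphi$ that contains only finitely many extended sequents, is a reset proof, and is cyclic. -/

import Mathlib

namespace MuPA

/-! ## Syntax

Formulas are taken up to renaming of bound variables: free number variables are named by natural
numbers, bound number variables and bound set variables are de Bruijn indices. -/

/-- Number terms: `fv x` is a (free) number variable, `bv i` a bound one. -/
inductive Tm : Type
  | fv (x : ℕ)
  | bv (i : ℕ)
  | zero
  | succ (t : Tm)
  | add (s t : Tm)
  | mul (s t : Tm)

/-- The two fixed point binders. -/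
inductive FixKind : Type
  | mu
  | nu

def FixKind.dual : FixKind → FixKind
  | mu => nu
  | nu => mu

/-- Formulas whose fixed point binders may carry an annotation from `P`.
`fix b a φ t` is `t ∈ b^a X x φ`, where `X` is the set variable with index `0` in `φ` and `x` the
number variable with index `0` in `φ`; the annotation `none` means that there is none, i.e.
`t ∈ μ X x φ` or `t ∈ ν X x φ`.
All set variables are bound by fixed point binders (see `Scoped`) and these bind positive
occurrences only, so an atom `t ∉ X` never occurs in such a formula and is left out;
`t ∉ S` for a fixed point `S` is the negation (defined below) of `t ∈ S`. -/
inductive Fm (P : Type) : Type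
  | lt (s t : Tm)
  | nlt (s t : Tm)
  | eq (s t : Tm)
  | neq (s t : Tm)
  | mem (t : Tm) (X : ℕ)
  | fix (b : FixKind) (a : Option P) (φ : Fm P) (t : Tm)
  | and (φ ψ : Fm P)
  | or (φ ψ : Fm P)
  | all (φ : Fm P)
  | ex (φ : Fm P)

/-- The countable set `ξ₀, ξ₁, …` of ordinal variables. -/
abbrev OrdVar : Type := ℕ

/-- Formulas of the language of `μPA`. -/
abbrev Formula : Type := Fm Empty

/-- Formulas of the annotated language. -/
abbrev AFormula : Type := Fm OrdVar

namespace Tm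

/-- All bound variables of the term have an index below `n`. -/
def Scoped (n : ℕ) : Tm → Prop
  | fv _ => True
  | bv i => i < n
  | zero => True
  | succ t => t.Scoped n
  | add s t => s.Scoped n ∧ t.Scoped n
  | mul s t => s.Scoped n ∧ t.Scoped n

/-- The variable `x` occurs in the term. -/
def HasFV (x : ℕ) : Tm → Prop
  | fv y => x = y
  | bv _ => False
  | zero => False
  | succ t => t.HasFV x
  | add s t => s.HasFV x ∨ t.HasFV x
  | mul s t => s.HasFV x ∨ t.HasFV x

/-- Simultaneous substitution of terms for the free variables. -/
def subst (θ : ℕ → Tm) : Tm → Tm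
  | fv x => θ x
  | bv i => bv i
  | zero => zero
  | succ t => succ (t.subst θ)
  | add s t => add (s.subst θ) (t.subst θ)
  | mul s t => mul (s.subst θ) (t.subst θ)

/-- Replace the bound variable with index `k` by `u`. -/
def inst : Tm → ℕ → Tm → Tm
  | fv x, _, _ => fv x
  | bv i, k, u => if i = k then u else bv i
  | zero, _, _ => zero
  | succ t, k, u => succ (t.inst k u)
  | add s t, k, u => add (s.inst k u) (t.inst k u)
  | mul s t, k, u => mul (s.inst k u) (t.inst k u)

end Tm

namespace Fm

variable {P Q : Type}

/-- The free set variables have indices below `m`, the unbound de Bruijn number variables have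
indices below `n`. `Scoped 0 0` singles out the formulas in which every set variable is bound. -/
def Scoped : ℕ → ℕ → Fm P → Prop
  | _, n, lt s t => s.Scoped n ∧ t.Scoped n
  | _, n, nlt s t => s.Scoped n ∧ t.Scoped n
  | _, n, eq s t => s.Scoped n ∧ t.Scoped n
  | _, n, neq s t => s.Scoped n ∧ t.Scoped n
  | m, n, mem t X => t.Scoped n ∧ X < m
  | m, n, fix _ _ φ t => φ.Scoped (m + 1) (n + 1) ∧ t.Scoped n
  | m, n, and φ ψ => φ.Scoped m n ∧ ψ.Scoped m n
  | m, n, or φ ψ => φ.Scoped m n ∧ ψ.Scoped m n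
  | m, n, all φ => φ.Scoped m (n + 1)
  | m, n, ex φ => φ.Scoped m (n + 1)

/-- The number variable `x` occurs free in the formula. -/
def HasFV (x : ℕ) : Fm P → Prop
  | lt s t => s.HasFV x ∨ t.HasFV x
  | nlt s t => s.HasFV x ∨ t.HasFV x
  | eq s t => s.HasFV x ∨ t.HasFV x
  | neq s t => s.HasFV x ∨ t.HasFV x
  | mem t _ => t.HasFV x
  | fix _ _ φ t => φ.HasFV x ∨ t.HasFV x
  | and φ ψ => φ.HasFV x ∨ ψ.HasFV x
  | or φ ψ => φ.HasFV x ∨ ψ.HasFV x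
  | all φ => φ.HasFV x
  | ex φ => φ.HasFV x

/-- The annotation `κ` occurs in the formula. -/
def HasAnn (κ : P) : Fm P → Prop
  | lt _ _ => False
  | nlt _ _ => False
  | eq _ _ => False
  | neq _ _ => False
  | mem _ _ => False
  | fix _ a φ _ => a = some κ ∨ φ.HasAnn κ
  | and φ ψ => φ.HasAnn κ ∨ ψ.HasAnn κ
  | or φ ψ => φ.HasAnn κ ∨ ψ.HasAnn κ
  | all φ => φ.HasAnn κ
  | ex φ => φ.HasAnn κ

/-- Simultaneous substitution of terms for the free number variables. It avoids capture as long as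
`θ` takes values in `Tm.Scoped 0`. -/
def subst (θ : ℕ → Tm) : Fm P → Fm P
  | lt s t => lt (s.subst θ) (t.subst θ)
  | nlt s t => nlt (s.subst θ) (t.subst θ)
  | eq s t => eq (s.subst θ) (t.subst θ)
  | neq s t => neq (s.subst θ) (t.subst θ)
  | mem t X => mem (t.subst θ) X
  | fix b a φ t => fix b a (φ.subst θ) (t.subst θ)
  | and φ ψ => and (φ.subst θ) (ψ.subst θ)
  | or φ ψ => or (φ.subst θ) (ψ.subst θ)
  | all φ => all (φ.subst θ)
  | ex φ => ex (φ.subst θ)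

/-- Replace the bound number variable with index `k` by `u`. -/
def inst : ℕ → Tm → Fm P → Fm P
  | k, u, lt s t => lt (s.inst k u) (t.inst k u)
  | k, u, nlt s t => nlt (s.inst k u) (t.inst k u)
  | k, u, eq s t => eq (s.inst k u) (t.inst k u)
  | k, u, neq s t => neq (s.inst k u) (t.inst k u)
  | k, u, mem t X => mem (t.inst k u) X
  | k, u, fix b a φ t => fix b a (φ.inst (k + 1) u) (t.inst k u)
  | k, u, and φ ψ => and (φ.inst k u) (ψ.inst k u)
  | k, u, or φ ψ => or (φ.inst k u) (ψ.inst k u)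
  | k, u, all φ => all (φ.inst (k + 1) u)
  | k, u, ex φ => ex (φ.inst (k + 1) u)

/-- Replace the set variable with index `k` by the set term `b^a X x χ`. -/
def instSet (b : FixKind) (a : Option P) (χ : Fm P) : ℕ → Fm P → Fm P
  | _, lt s t => lt s t
  | _, nlt s t => nlt s t
  | _, eq s t => eq s t
  | _, neq s t => neq s t
  | k, mem t X => if X = k then fix b a χ t else mem t X
  | k, fix b' a' φ t => fix b' a' (instSet b a χ (k + 1) φ) t
  | k, and φ ψ => and (instSet b a χ k φ) (instSet b a χ k ψ)
  | k, or φ ψ => or (instSet b a χ k φ) (instSet b a χ k ψ)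
  | k, all φ => all (instSet b a χ k φ)
  | k, ex φ => ex (instSet b a χ k φ)

/-- `φ[b^a X x φ / X, t / x]`. -/
def unfold (b : FixKind) (a : Option P) (φ : Fm P) (t : Tm) : Fm P :=
  (instSet b a φ 0 φ).inst 0 t

/-- Negation, by De Morgan duality; a bound set variable `X` is replaced by `¬X` and negated, which
leaves `t ∈ X` as it is. -/
def neg : Fm P → Fm P
  | lt s t => nlt s t
  | nlt s t => lt s t
  | eq s t => neq s t
  | neq s t => eq s t
  | mem t X => mem t X
  | fix b a φ t => fix b.dual a φ.neg t
  | and φ ψ => or φ.neg ψ.neg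
  | or φ ψ => and φ.neg ψ.neg
  | all φ => ex φ.neg
  | ex φ => all φ.neg

theorem neg_neg (φ : Fm P) : φ.neg.neg = φ := by
  induction φ with
  | fix b a φ t ih => cases b <;> simp [neg, FixKind.dual, ih]
  | _ => simp_all [neg]

def imp (φ ψ : Fm P) : Fm P := or φ.neg ψ

def iff (φ ψ : Fm P) : Fm P := and (imp φ ψ) (imp ψ φ)

/-- Delete all annotations. From annotated to plain formulas this is `φ ↦ φ⁻`; from plain to
annotated formulas it is the identity annotation, i.e. the inclusion of the plain language. -/
def strip : Fm P → Fm Q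
  | lt s t => lt s t
  | nlt s t => nlt s t
  | eq s t => eq s t
  | neq s t => neq s t
  | mem t X => mem t X
  | fix b _ φ t => fix b none φ.strip t
  | and φ ψ => and φ.strip ψ.strip
  | or φ ψ => or φ.strip ψ.strip
  | all φ => all φ.strip
  | ex φ => ex φ.strip

/-- Number of symbols, where each number term counts as one symbol. -/
def size : Fm P → ℕ
  | lt _ _ => 3
  | nlt _ _ => 3
  | eq _ _ => 3
  | neq _ _ => 3
  | mem _ _ => 3
  | fix _ _ φ _ => φ.size + 5
  | and φ ψ => φ.size + ψ.size + 1
  | or φ ψ => φ.size + ψ.size + 1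
  | all φ => φ.size + 2
  | ex φ => φ.size + 2

/-- The atoms `s < t`, `s ≮ t`, `s = t`, `s ≠ t`. -/
def IsNumAtom : Fm P → Prop
  | lt _ _ => True
  | nlt _ _ => True
  | eq _ _ => True
  | neq _ _ => True
  | _ => False

/-- `t ∈ 𝐍`, where `𝐍 = μ X x (x = 0 ∨ ∃ y (y ∈ X ∧ x = S y))`. -/
def isNat (t : Tm) : Fm P :=
  fix .mu none
    (or (eq (.bv 0) .zero) (ex (and (mem (.bv 0) 0) (eq (.bv 1) (.succ (.bv 0)))))) t

/-- The axioms `PA₁, …, PA₇`, written with the number variables `x` and `y`. -/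
def paAxiom (x y : ℕ) : Fin 7 → Fm P
  | 0 => neq .zero (.succ (.fv x))
  | 1 => imp (eq (.succ (.fv x)) (.succ (.fv y))) (eq (.fv x) (.fv y))
  | 2 => eq (.add (.fv x) .zero) (.fv x)
  | 3 => eq (.add (.fv x) (.succ (.fv y))) (.succ (.add (.fv x) (.fv y)))
  | 4 => eq (.mul (.fv x) .zero) .zero
  | 5 => eq (.mul (.fv x) (.succ (.fv y))) (.add (.mul (.fv x) (.fv y)) (.fv x))
  | 6 => iff (lt (.fv x) (.fv y)) (ex (eq (.add (.fv x) (.succ (.bv 0))) (.fv y)))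

end Fm

/-! ## Coderivations over a set of rules -/

/-- A set of rules. A rule is an instance, with all its data; the actual rules are those which
satisfy `Valid`. -/
structure System where
  Seq : Type
  Rule : Type
  concl : Rule → Seq
  prems : Rule → List Seq
  Valid : Rule → Prop

/-- A coderivation over a set of rules: a binary tree (the set of addresses at which `label` is
defined) labelled with rules. The first premise of a rule sits at the child `false`, the second one
at the child `true`. -/
structure Coderivation (S : System) where
  label : List Bool → Option S.Rule
  root : (label []).isSome
  valid : ∀ u r, label u = some r → S.Valid r
  coherent : ∀ u b, (label (u ++ [b])).map S.concl =
    (label u).bind fun r => (S.prems r)[b.toNat]?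

namespace Coderivation

variable {S : System}

/-- The conclusion of the coderivation is `s`. -/
def Concludes (D : Coderivation S) (s : S.Seq) : Prop :=
  (D.label []).map S.concl = some s

/-- The sub-coderivation rooted at the node `u`. -/
def sub (D : Coderivation S) (u : List Bool) (hu : (D.label u).isSome) : Coderivation S where
  label v := D.label (u ++ v)
  root := by simpa using hu
  valid v r h := D.valid _ r h
  coherent v b := by rw [← List.append_assoc]; exact D.coherent (u ++ v) b

/-- Cyclic (regular) coderivations: there are only finitely many sub-coderivations. -/
def Cyclic (D : Coderivation S) : Prop :=
  {E : Coderivation S | ∃ u hu, E = D.sub u hu}.Finite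

/-- The set of sequents that occur in the coderivation. -/
def sequents (D : Coderivation S) : Set S.Seq :=
  {s | ∃ u r, D.label u = some r ∧ S.concl r = s}

/-- The `n`-th node of the branch with the directions `β`. -/
def node (β : ℕ → Bool) (n : ℕ) : List Bool := (List.range n).map β

/-- `β` gives the directions of an infinite branch. -/
def IsBranch (D : Coderivation S) (β : ℕ → Bool) : Prop :=
  ∀ n, (D.label (node β n)).isSome

end Coderivation

/-! ## The rules that the plain and the annotated system share -/

/-- Instances of the structural, logical and arithmetical rules and of the rule `μ`. -/
inductive LRule (P : Type) : Type
  | ident (Γ : List (Fm P)) (φ : Fm P)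
  | wk (Γ Δ : List (Fm P))
  | exch (Γ : List (Fm P)) (φ ψ : Fm P) (Δ : List (Fm P))
  | sub (θ : ℕ → Tm) (Γ : List (Fm P))
  | cut (Γ : List (Fm P)) (φ : Fm P)
  | and (Γ : List (Fm P)) (φ ψ : Fm P)
  | or (Γ : List (Fm P)) (φ ψ : Fm P)
  | all (Γ : List (Fm P)) (φ : Fm P) (y : ℕ)
  | ex (Γ : List (Fm P)) (φ : Fm P) (t : Tm)
  | eqSub (Γ : List (Fm P)) (x : ℕ) (s t : Tm)
  | eqRefl (t : Tm)
  | pa (i : Fin 7) (x y : ℕ)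
  | nat (t : Tm)
  | mu (Γ : List (Fm P)) (φ : Fm P) (t : Tm)

namespace LRule

variable {P Q : Type}

/-- The substitution of `t` for the single variable `x`. -/
def single (x : ℕ) (t : Tm) : ℕ → Tm := Function.update Tm.fv x t

def concl : LRule P → List (Fm P)
  | ident Γ φ => Γ ++ [φ.neg, φ]
  | wk Γ Δ => Γ ++ Δ
  | exch Γ φ ψ Δ => Γ ++ φ :: ψ :: Δ
  | sub θ Γ => Γ.map (Fm.subst θ)
  | cut Γ _ => Γ
  | and Γ φ ψ => Γ ++ [.and φ ψ]
  | or Γ φ ψ => Γ ++ [.or φ ψ]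
  | all Γ φ _ => Γ ++ [.all φ]
  | ex Γ φ _ => Γ ++ [.ex φ]
  | eqSub Γ x s t => Γ.map (Fm.subst (single x t)) ++ [.neq s t]
  | eqRefl t => [.eq t t]
  | pa i x y => [Fm.paAxiom x y i]
  | nat t => [Fm.isNat t]
  | mu Γ φ t => Γ ++ [.fix .mu none φ t]

def prems : LRule P → List (List (Fm P))
  | ident _ _ => []
  | wk Γ _ => [Γ]
  | exch Γ φ ψ Δ => [Γ ++ ψ :: φ :: Δ]
  | sub _ Γ => [Γ]
  | cut Γ φ => [Γ ++ [φ], Γ ++ [φ.neg]]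
  | and Γ φ ψ => [Γ ++ [φ], Γ ++ [ψ]]
  | or Γ φ ψ => [Γ ++ [φ, ψ]]
  | all Γ φ y => [Γ ++ [φ.inst 0 (.fv y)]]
  | ex Γ φ t => [Γ ++ [φ.inst 0 t]]
  | eqSub Γ x s _ => [Γ.map (Fm.subst (single x s))]
  | eqRefl _ => []
  | pa _ _ _ => []
  | nat _ => []
  | mu Γ φ t => [Γ ++ [Fm.unfold .mu none φ t]]

/-- Side conditions: freshness of eigenvariables, and substituted terms are terms proper. -/
def Side : LRule P → Prop
  | sub θ _ => ∀ x, (θ x).Scoped 0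
  | all Γ φ y => (∀ ψ ∈ Γ, ¬ ψ.HasFV y) ∧ ¬ φ.HasFV y
  | ex _ _ t => t.Scoped 0
  | pa _ x y => x ≠ y
  | _ => True

/-- `Anc r p q`: the `q`-th formula of a premise of `r` is an immediate ancestor of the `p`-th
formula of its conclusion (positions are counted from `0`, and `q` has to be a position of the
premise). -/
def Anc : LRule P → ℕ → ℕ → Prop
  | ident _ _, _, _ => False
  | wk Γ _, p, q => p = q ∧ p < Γ.length
  | exch Γ _ _ Δ, p, q =>
      (p = Γ.length ∧ q = Γ.length + 1) ∨ (p = Γ.length + 1 ∧ q = Γ.length) ∨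
      (p = q ∧ (p < Γ.length ∨ (Γ.length + 1 < p ∧ p < Γ.length + 2 + Δ.length)))
  | sub _ Γ, p, q => p = q ∧ p < Γ.length
  | cut Γ _, p, q => p = q ∧ p < Γ.length
  | and Γ _ _, p, q => p = q ∧ p ≤ Γ.length
  | or Γ _ _, p, q => (p = q ∧ p ≤ Γ.length) ∨ (p = Γ.length ∧ q = Γ.length + 1)
  | all Γ _ _, p, q => p = q ∧ p ≤ Γ.length
  | ex Γ _ _, p, q => p = q ∧ p ≤ Γ.length
  | eqSub Γ _ _ _, p, q => p = q ∧ p < Γ.length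
  | eqRefl _, _, _ => False
  | pa _ _ _, _, _ => False
  | nat _, _, _ => False
  | mu Γ _ _, p, q => p = q ∧ p ≤ Γ.length

/-- Delete all annotations in a rule instance. -/
def strip : LRule P → LRule Q
  | ident Γ φ => ident (Γ.map Fm.strip) φ.strip
  | wk Γ Δ => wk (Γ.map Fm.strip) (Δ.map Fm.strip)
  | exch Γ φ ψ Δ => exch (Γ.map Fm.strip) φ.strip ψ.strip (Δ.map Fm.strip)
  | sub θ Γ => sub θ (Γ.map Fm.strip)
  | cut Γ φ => cut (Γ.map Fm.strip) φ.strip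
  | and Γ φ ψ => and (Γ.map Fm.strip) φ.strip ψ.strip
  | or Γ φ ψ => or (Γ.map Fm.strip) φ.strip ψ.strip
  | all Γ φ y => all (Γ.map Fm.strip) φ.strip y
  | ex Γ φ t => ex (Γ.map Fm.strip) φ.strip t
  | eqSub Γ x s t => eqSub (Γ.map Fm.strip) x s t
  | eqRefl t => eqRefl t
  | pa i x y => pa i x y
  | nat t => nat t
  | mu Γ φ t => mu (Γ.map Fm.strip) φ.strip t

end LRule

/-! ## Cyclic progressing proofs -/

/-- Rule instances for `μPA`-coderivations: the shared rules and the rule `ν`. -/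
inductive PRule : Type
  | logic (r : LRule Empty)
  | nu (Γ : List Formula) (φ : Formula) (t : Tm)

namespace PRule

def concl : PRule → List Formula
  | logic r => r.concl
  | nu Γ φ t => Γ ++ [.fix .nu none φ t]

def prems : PRule → List (List Formula)
  | logic r => r.prems
  | nu Γ φ t => [Γ ++ [Fm.unfold .nu none φ t]]

/-- A sequent is a list of formulas in which all set variables are bound. -/
def IsSequent (Γ : List Formula) : Prop := ∀ φ ∈ Γ, φ.Scoped 0 0

def Side : PRule → Prop
  | logic r => r.Side
  | nu _ _ _ => True

def Valid (r : PRule) : Prop :=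
  IsSequent r.concl ∧ (∀ Γ ∈ r.prems, IsSequent Γ) ∧ r.Side

def Anc : PRule → ℕ → ℕ → Prop
  | logic r, p, q => r.Anc p q
  | nu Γ _ _, p, q => p = q ∧ p ≤ Γ.length

/-- `r` is the rule `μ` or `ν`, its principal formula is the `p`-th formula of its conclusion, and
the set term of that formula is `b X x φ`. -/
def Unfolds (r : PRule) (p : ℕ) (b : FixKind) (φ : Formula) : Prop :=
  ∃ Γ t, p = Γ.length ∧
    ((b = .mu ∧ r = logic (.mu Γ φ t)) ∨ (b = .nu ∧ r = nu Γ φ t))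

end PRule

/-- The set of rules of `μPA`-coderivations. -/
abbrev plainSystem : System where
  Seq := List Formula
  Rule := PRule
  concl := PRule.concl
  prems := PRule.prems
  Valid := PRule.Valid

/-- `μPA`-coderivations. -/
abbrev PlainCoderivation : Type := Coderivation plainSystem

namespace PlainCoderivation

open Coderivation

/-- `τ` is a trace along the branch `β` from `k` on: `τ i` is the position of a formula occurrence
in the `i`-th sequent of the branch. (`Anc` only relates positions in the conclusion to positions
in the premises; all premises of a two-premise rule have the same positions.) -/
def IsTrace (D : PlainCoderivation) (β : ℕ → Bool) (k : ℕ) (τ : ℕ → ℕ) : Prop :=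
  ∀ i, k ≤ i → ∃ r, D.label (node β i) = some r ∧ r.Anc (τ i) (τ (i + 1))

/-- The set term `b X x φ` progresses at `i`. -/
def ProgressesAt (D : PlainCoderivation) (β : ℕ → Bool) (τ : ℕ → ℕ) (b : FixKind) (φ : Formula)
    (i : ℕ) : Prop :=
  ∃ r, D.label (node β i) = some r ∧ r.Unfolds (τ i) b φ

/-- The set term `b X x φ` progresses infinitely often. -/
def ProgressesInfOften (D : PlainCoderivation) (β : ℕ → Bool) (τ : ℕ → ℕ) (b : FixKind)
    (φ : Formula) : Prop :=
  ∃ᶠ i in Filter.atTop, D.ProgressesAt β τ b φ i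

/-- The trace is progressing: some `ν`-term progresses infinitely often and is of minimal size
among the set terms that do. (The size of `b X x φ` exceeds that of `φ` by a constant.) -/
def IsProgressingTrace (D : PlainCoderivation) (β : ℕ → Bool) (k : ℕ) (τ : ℕ → ℕ) : Prop :=
  D.IsTrace β k τ ∧ ∃ φ, D.ProgressesInfOften β τ .nu φ ∧
    ∀ b ψ, D.ProgressesInfOften β τ b ψ → φ.size ≤ ψ.size

/-- Progressing proofs: every infinite branch has a progressing trace. -/
def Progressing (D : PlainCoderivation) : Prop :=
  ∀ β, D.IsBranch β → ∃ k τ, D.IsProgressingTrace β k τ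

/-- All identity steps are of the form `¬φ, φ` with `φ` an equation, an inequality or the negation
of one. -/
def AtomicIdent (D : PlainCoderivation) : Prop :=
  ∀ u Γ φ, D.label u = some (.logic (.ident Γ φ)) → Γ = [] ∧ φ.IsNumAtom

end PlainCoderivation

/-- There is a cyclic progressing proof of `φ`. -/
def CyclicProves (φ : Formula) : Prop :=
  ∃ D : PlainCoderivation, D.Concludes [φ] ∧ D.Cyclic ∧ D.Progressing

/-! ## Constraints and extended sequents -/

/-- The data of a constraint: a finite set of ordinal variables and a relation. -/
@[ext] structure Constraint : Type where
  V : Finset OrdVar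
  lt : OrdVar → OrdVar → Prop

namespace Constraint

/-- `<` is a strict partial order on `V` in which the elements above a given one are linearly
ordered. -/
structure IsConstraint (O : Constraint) : Prop where
  mem : ∀ {κ l}, O.lt κ l → κ ∈ O.V ∧ l ∈ O.V
  irrefl : ∀ κ, ¬ O.lt κ κ
  trans : ∀ {κ l ξ}, O.lt κ l → O.lt l ξ → O.lt κ ξ
  linear : ∀ {κ l ξ}, O.lt κ l → O.lt κ ξ → O.lt l ξ ∨ l = ξ ∨ O.lt ξ l

def le (O : Constraint) (κ l : OrdVar) : Prop := O.lt κ l ∨ κ = l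

/-- The constraint without variables. -/
def empty : Constraint := ⟨∅, fun _ _ => False⟩

/-- `O + l`. -/
def add (O : Constraint) (l : OrdVar) : Constraint := ⟨insert l O.V, O.lt⟩

/-- `O +_κ l`. -/
def addBelow (O : Constraint) (κ l : OrdVar) : Constraint :=
  ⟨insert l O.V, fun a b => O.lt a b ∨ (a = l ∧ O.le κ b)⟩

/-- `O \ L`. -/
def remove (O : Constraint) (L : Finset OrdVar) : Constraint :=
  ⟨O.V \ L, fun a b => O.lt a b ∧ a ∈ O.V \ L ∧ b ∈ O.V \ L⟩

open Classical in
/-- `C(κ)`, the children of `κ`. -/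
noncomputable def children (O : Constraint) (κ : OrdVar) : Finset OrdVar :=
  O.V.filter fun l => O.lt l κ ∧ ¬ ∃ ξ ∈ O.V, O.lt l ξ ∧ O.lt ξ κ

/-- The ordinal variable `κ` occurs in the annotated sequent `Γ`. -/
def OccursIn (κ : OrdVar) (Γ : List AFormula) : Prop := ∃ φ ∈ Γ, φ.HasAnn κ

open Classical in
/-- `P(Γ)`, the variables none of whose descendants (themselves included) occurs in `Γ`. -/
noncomputable def prunable (O : Constraint) (Γ : List AFormula) : Finset OrdVar :=
  O.V.filter fun κ => ∀ l ∈ O.V, O.le l κ → ¬ OccursIn l Γ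

/-- `O : Γ` is an extended sequent. -/
def IsExtSequent (O : Constraint) (Γ : List AFormula) : Prop :=
  O.IsConstraint ∧ (∀ φ ∈ Γ, φ.Scoped 0 0) ∧ ∀ κ, OccursIn κ Γ → κ ∈ O.V

/-- The reset rule for `κ` can be applied to `O : Γ`. -/
def CanReset (O : Constraint) (Γ : List AFormula) (κ : OrdVar) : Prop :=
  (O.children κ).Nonempty ∧ ¬ OccursIn κ Γ ∧ ∀ l ∈ O.children κ, ¬ OccursIn l Γ

/-- The pruning rule can be applied to `O : Γ`. -/
def CanPrune (O : Constraint) (Γ : List AFormula) : Prop := (O.prunable Γ).Nonempty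

/-- Neither a reset rule nor the pruning rule can be applied to `O : Γ`. -/
def Reduced (O : Constraint) (Γ : List AFormula) : Prop :=
  (∀ κ, ¬ O.CanReset Γ κ) ∧ ¬ O.CanPrune Γ

/-- `l` is the ordinal variable of least index that does not appear in `O`. -/
def LeastFresh (O : Constraint) (l : OrdVar) : Prop := l ∉ O.V ∧ ∀ k < l, k ∈ O.V

end Constraint

/-! ## Annotated coderivations and reset proofs -/

/-- Rule instances for annotated coderivations: the shared rules (which do not change the
constraint), the rules `ν`, `ν^κ` and constraint weakening. -/
inductive ARule : Type
  | logic (O : Constraint) (r : LRule OrdVar)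
  | nu (O : Constraint) (Γ : List AFormula) (φ : AFormula) (t : Tm) (l : OrdVar)
  | nuAnn (O : Constraint) (Γ : List AFormula) (φ : AFormula) (t : Tm) (κ l : OrdVar)
  | cw (O : Constraint) (Γ : List AFormula) (L : Finset OrdVar)

namespace ARule

def concl : ARule → Constraint × List AFormula
  | logic O r => (O, r.concl)
  | nu O Γ φ t _ => (O, Γ ++ [.fix .nu none φ t])
  | nuAnn O Γ φ t κ _ => (O, Γ ++ [.fix .nu (some κ) φ t])
  | cw O Γ _ => (O, Γ)

def prems : ARule → List (Constraint × List AFormula)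
  | logic O r => r.prems.map fun Γ => (O, Γ)
  | nu O Γ φ t l => [(O.add l, Γ ++ [.fix .nu (some l) φ t])]
  | nuAnn O Γ φ t κ l =>
      [(O.addBelow κ l, Γ ++ [(Fm.instSet .nu (some l) φ 0 φ).inst 0 t])]
  | cw O Γ L => [(O.remove L, Γ)]

/-- Side conditions. In the annotated system the identity rule has no side formulas. -/
def Side : ARule → Prop
  | logic _ (.ident Γ _) => Γ = []
  | logic _ r => r.Side
  | nu O _ _ _ l => l ∉ O.V
  | nuAnn O _ _ _ _ l => l ∉ O.V
  | cw O _ L => L ⊆ O.V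

def Valid (r : ARule) : Prop :=
  r.concl.1.IsExtSequent r.concl.2 ∧ (∀ s ∈ r.prems, s.1.IsExtSequent s.2) ∧ r.Side

/-- `r` is an instance of the reset rule `RS(κ)`. -/
def IsReset (κ : OrdVar) (r : ARule) : Prop :=
  ∃ O Γ, r = cw O Γ (O.children κ) ∧ O.CanReset Γ κ

/-- `r` is an instance of the pruning rule. -/
def IsPrune (r : ARule) : Prop :=
  ∃ O Γ, r = cw O Γ (O.prunable Γ) ∧ O.CanPrune Γ

end ARule

/-- The set of rules of annotated coderivations. -/
abbrev annSystem : System where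
  Seq := Constraint × List AFormula
  Rule := ARule
  concl := ARule.concl
  prems := ARule.prems
  Valid := ARule.Valid

abbrev AnnCoderivation : Type := Coderivation annSystem

namespace AnnCoderivation

open Coderivation

/-- `κ` is a stable variable of the branch `β`. -/
def Stable (E : AnnCoderivation) (β : ℕ → Bool) (κ : OrdVar) : Prop :=
  ∃ i₀, ∀ i, i₀ ≤ i → ∃ r, E.label (node β i) = some r ∧ κ ∈ r.concl.1.V

/-- `κ` is a reset variable of the branch `β`. -/
def ResetInfOften (E : AnnCoderivation) (β : ℕ → Bool) (κ : OrdVar) : Prop :=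
  ∃ᶠ i in Filter.atTop, ∃ r, E.label (node β i) = some r ∧ r.IsReset κ

/-- Reset proofs: every infinite branch has a stable reset variable. -/
def IsResetProof (E : AnnCoderivation) : Prop :=
  ∀ β, E.IsBranch β → ∃ κ, E.Stable β κ ∧ E.ResetInfOften β κ

end AnnCoderivation

/-- There is a cyclic reset proof of `O : Γ`. -/
def CyclicResetProves (O : Constraint) (Γ : List AFormula) : Prop :=
  ∃ E : AnnCoderivation, E.Concludes (O, Γ) ∧ E.Cyclic ∧ E.IsResetProof

/-! ## The translation -/

/-- The steps by which a translation advances past a rule `r` of the plain coderivation: the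
annotated rule `ρ` is `r` with ordinal variables put on some of the `ν`. The rule `ν` becomes
`ν^κ`, which picks the first fresh ordinal variable, and cut formulas are not annotated. -/
def Advances (r : PRule) : ARule → Prop
  | .logic _ ρ => r = .logic ρ.strip ∧
      ∀ Γ φ, ρ = .cut Γ φ → φ = (φ.strip : Formula).strip
  | .nuAnn O Γ φ t _ l => r = .nu (Γ.map Fm.strip) φ.strip t ∧ O.LeastFresh l
  | .nu _ _ _ _ _ => False
  | .cw _ _ _ => False

/-- The steps of a translation that prepare a rule `ν` of the plain coderivation: the annotated
rule `ν`, which picks the first fresh ordinal variable. -/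
def Prepares (r : PRule) : ARule → Prop
  | .nu O Γ φ t l => r = .nu (Γ.map Fm.strip) φ.strip t ∧ O.LeastFresh l
  | _ => False

/-- `E` is a translation of `D`. The map `f` sends each node of `E` to the node of `D` that it
simulates. Below each rule of `D` that has premises, `E` performs reset and pruning steps until
none is possible; then it performs the annotated version of the rule, where the rule `ν` with a
principal formula that carries no ordinal variable is simulated by `ν` followed by `ν^κ`. -/
def IsTranslation (D : PlainCoderivation) (E : AnnCoderivation) : Prop :=
  ∃ f : List Bool → List Bool, f [] = [] ∧
    ∀ v ρ, E.label v = some ρ → ∃ r, D.label (f v) = some r ∧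
      ((r.prems ≠ [] ∧ ((∃ κ, ρ.IsReset κ) ∨ ρ.IsPrune) ∧ f (v ++ [false]) = f v) ∨
       ((r.prems ≠ [] → ρ.concl.1.Reduced ρ.concl.2) ∧
        ((Prepares r ρ ∧ f (v ++ [false]) = f v) ∨
         (Advances r ρ ∧ ∀ b, f (v ++ [b]) = f v ++ [b]))))

end MuPA

/-! The translation is built from the root upwards and never gets stuck: every rule of the plain
proof has an annotated version with any prescribed annotation of its conclusion
(`exists_transStep`). Identity steps are the exception, since the two formulas may carry unrelated
annotations; atoms carry none, which is why the second claim asks for atomic identities.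

The translation is finite. If neither a reset nor the pruning applies, then every variable of the
constraint that does not occur in the sequent has a child that does, and different variables have
different children. So there are at most twice as many variables as occurring ones
(`card_le_of_reduced`). The sequents of a cyclic proof have bounded size, hence the least fresh
indices are bounded and only finitely many extended sequents arise (`exists_finite_states`). The
next step is chosen as a function of the pair of remaining plain coderivation and present extended
sequent, so finitely many pairs give a cyclic coderivation.

The translation is a reset proof. A branch of it simulates a branch of the plain proof; let `n` be
the size of the body of the least `ν`-term that progresses infinitely often on a progressing trace,
from a point on where no smaller body is unfolded. Unfolding a `ν`-term with a body of size `n`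
marks it by a new variable `l`, and from then on every closed subformula of the trace contains `l`
or is too small ever to be unfolded (`Guarded`). So the mark cannot get lost, and the next unfolding
of a `ν`-term of size `n` hits the marked term and passes the mark to a new child of `l`. This gives
a chain of variables that descends infinitely often and whose current member always occurs in the
sequent. Among the variables that eventually stay above the chain take a lowest one, `κ`. Were it
reset finitely often only, the child of `κ` above the chain could not be removed any more and would
be lower (`exists_stable_reset`).

For the first claim, identity steps are replaced by cyclic proofs with atomic identities
(`of_ident`). Expanding `¬φ, φ` along connectives, and along fixed points by unfolding both sides,
leads up to substitution of terms to finitely many identities only (`exists_finite_reducesTo`). On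
an infinite branch one takes a smallest fixed point formula whose identity recurs infinitely often
and follows the one of its two sides that starts with `ν` (`IdentityDerivs.progressing`). -/

namespace MuPA

/-! ### Root rules, immediate sub-coderivations and nodes of branches. -/

namespace Coderivation

variable {S : System}

theorem ext_label {D E : Coderivation S} (h : ∀ u, D.label u = E.label u) : D = E := by
  cases D; cases E
  congr
  exact funext h

/-- The last rule of the coderivation. -/
noncomputable def rootRule (D : Coderivation S) : S.Rule := (D.label []).get D.root

theorem label_nil (D : Coderivation S) : D.label [] = some D.rootRule := by
  simp [rootRule]

theorem rootRule_valid (D : Coderivation S) : S.Valid D.rootRule :=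
  D.valid [] _ D.label_nil

theorem concludes_iff (D : Coderivation S) (s : S.Seq) :
    D.Concludes s ↔ S.concl D.rootRule = s := by
  simp [Concludes, label_nil]

open Classical in
/-- The immediate sub-coderivation in the direction `b` (and `D` itself if there is none). -/
noncomputable def child (D : Coderivation S) (b : Bool) : Coderivation S :=
  if h : (D.label [b]).isSome then D.sub [b] h else D

theorem label_singleton (D : Coderivation S) (b : Bool) :
    (D.label [b]).map S.concl = (S.prems D.rootRule)[b.toNat]? := by
  have := D.coherent [] b
  simpa [label_nil] using this

theorem isSome_child (D : Coderivation S) {b : Bool}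
    (h : b.toNat < (S.prems D.rootRule).length) : (D.label [b]).isSome := by
  have := D.label_singleton b
  rw [List.getElem?_eq_getElem h] at this
  cases h' : D.label [b] <;> simp_all

theorem child_label (D : Coderivation S) {b : Bool}
    (h : b.toNat < (S.prems D.rootRule).length) (u : List Bool) :
    (D.child b).label u = D.label (b :: u) := by
  have h' := D.isSome_child h
  simp [child, h', sub]

theorem child_concl (D : Coderivation S) {b : Bool} {p : S.Seq}
    (h : (S.prems D.rootRule)[b.toNat]? = some p) : S.concl (D.child b).rootRule = p := by
  have hl : b.toNat < (S.prems D.rootRule).length := by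
    by_contra hc
    rw [List.getElem?_eq_none (not_lt.1 hc)] at h
    cases h
  have := D.label_singleton b
  rw [h, ← D.child_label hl, label_nil] at this
  simpa using this

theorem node_succ (β : ℕ → Bool) (n : ℕ) : node β (n + 1) = node β n ++ [β n] := by
  simp [node, List.range_succ]

theorem node_add (β : ℕ → Bool) (m n : ℕ) :
    node β (m + n) = node β m ++ node (fun i => β (m + i)) n := by
  induction n with
  | zero => simp [node]
  | succ n ih => rw [← Nat.add_assoc, node_succ, ih, node_succ, List.append_assoc]

end Coderivation

/-! ### Coderivations generated by states. -/

/-- Presentation of coderivations by states: in each state a rule is applied, and its premises are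
taken care of by further states. -/
structure Coalg (S : System) where
  St : Type
  rule : St → S.Rule
  next : St → Bool → St
  valid : ∀ s, S.Valid (rule s)
  coh : ∀ s b p, (S.prems (rule s))[b.toNat]? = some p → S.concl (rule (next s b)) = p

namespace Coalg

open Coderivation

variable {S : System} (C : Coalg S)

/-- The state reached from `s` along an address. -/
def run (s : C.St) : List Bool → Option C.St
  | [] => some s
  | b :: u => if b.toNat < (S.prems (C.rule s)).length then run (C.next s b) u else none

theorem run_append (s : C.St) (u v : List Bool) :
    C.run s (u ++ v) = (C.run s u).bind fun s' => C.run s' v := by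
  induction u generalizing s with
  | nil => simp [run]
  | cons b u ih =>
    simp only [List.cons_append, run]
    split
    · exact ih _
    · rfl

/-- The coderivation obtained by starting in the state `s`. -/
def unfold (s : C.St) : Coderivation S where
  label u := (C.run s u).map C.rule
  root := by simp [run]
  valid u r h := by
    simp only [Option.map_eq_some_iff] at h
    obtain ⟨s', -, rfl⟩ := h
    exact C.valid s'
  coherent u b := by
    rw [run_append]
    cases h : C.run s u with
    | none => simp
    | some s' =>
      simp only [Option.bind_some, run, Option.map_some]
      split
      · rename_i hl
        rw [List.getElem?_eq_getElem hl]
        simp only [Option.map_some, Option.some.injEq]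
        exact C.coh s' b _ (List.getElem?_eq_getElem hl)
      · rename_i hl
        rw [List.getElem?_eq_none (not_lt.1 hl)]
        rfl

theorem unfold_label (s : C.St) (u : List Bool) :
    (C.unfold s).label u = (C.run s u).map C.rule := rfl

theorem unfold_rootRule (s : C.St) : (C.unfold s).rootRule = C.rule s := by
  have := (C.unfold s).label_nil
  simpa [unfold_label, run] using this.symm

theorem unfold_concludes (s : C.St) : (C.unfold s).Concludes (S.concl (C.rule s)) := by
  rw [concludes_iff, unfold_rootRule]

theorem unfold_sub {s s' : C.St} {u : List Bool} (h : C.run s u = some s') (hu) :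
    (C.unfold s).sub u hu = C.unfold s' := by
  apply ext_label
  intro v
  simp [sub, unfold_label, run_append, h]

theorem run_mem {T : Set C.St}
    (hT : ∀ s ∈ T, ∀ b : Bool, b.toNat < (S.prems (C.rule s)).length → C.next s b ∈ T)
    {s s' : C.St} (hs : s ∈ T) {u : List Bool} (h : C.run s u = some s') : s' ∈ T := by
  induction u generalizing s with
  | nil => simp [run] at h; rwa [← h]
  | cons b u ih =>
    simp only [run] at h
    split at h
    · exact ih (hT s hs b ‹_›) h
    · cases h

/-- Every sub-coderivation is the unfolding of a reachable state, and reachable states stay in the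
closed set `T`. -/
theorem unfold_cyclic {T : Set C.St} {F : Set (Coderivation S)} (hF : F.Finite)
    (hTF : ∀ s ∈ T, C.unfold s ∈ F)
    (hT : ∀ s ∈ T, ∀ b : Bool, b.toNat < (S.prems (C.rule s)).length → C.next s b ∈ T)
    {s : C.St} (hs : s ∈ T) : (C.unfold s).Cyclic := by
  refine hF.subset ?_
  rintro E ⟨u, hu, rfl⟩
  have hu' := hu
  rw [unfold_label] at hu
  simp only [Option.isSome_map] at hu
  obtain ⟨s', h⟩ := Option.isSome_iff_exists.1 hu
  rw [C.unfold_sub h hu']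
  exact hTF _ (C.run_mem hT hs h)

theorem unfold_cyclic_of_finite {T : Set C.St} (hF : T.Finite)
    (hT : ∀ s ∈ T, ∀ b : Bool, b.toNat < (S.prems (C.rule s)).length → C.next s b ∈ T)
    {s : C.St} (hs : s ∈ T) : (C.unfold s).Cyclic :=
  C.unfold_cyclic (hF.image C.unfold) (fun _ hs => Set.mem_image_of_mem _ hs) hT hs

/-- The states visited along the branch `β`. -/
def states (s : C.St) (β : ℕ → Bool) : ℕ → C.St
  | 0 => s
  | n + 1 => C.next (states s β n) (β n)

theorem run_node {s : C.St} {β : ℕ → Bool} (h : (C.unfold s).IsBranch β) (n : ℕ) :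
    C.run s (node β n) = some (C.states s β n) := by
  induction n with
  | zero => rfl
  | succ n ih =>
    have := h (n + 1)
    rw [unfold_label, node_succ, run_append, ih] at this
    rw [node_succ, run_append, ih]
    simp only [Option.bind_some, run, states] at this ⊢
    split at this
    · rename_i hl
      rw [if_pos hl]
    · simp at this

theorem label_node {s : C.St} {β : ℕ → Bool} (h : (C.unfold s).IsBranch β) (n : ℕ) :
    (C.unfold s).label (node β n) = some (C.rule (C.states s β n)) := by
  rw [unfold_label, C.run_node h]; rfl

theorem branch_lt {s : C.St} {β : ℕ → Bool} (h : (C.unfold s).IsBranch β) (n : ℕ) :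
    (β n).toNat < (S.prems (C.rule (C.states s β n))).length := by
  have := C.run_node h (n + 1)
  rw [node_succ, run_append, C.run_node h n] at this
  simp only [Option.bind_some, run] at this
  by_contra hc
  rw [if_neg hc] at this
  cases this

end Coalg

/-! ### Erasing annotations, and lifting them along syntactic operations. -/

namespace Fm

variable {P Q R : Type}

theorem strip_subst (θ : ℕ → Tm) (φ : Fm P) :
    (φ.subst θ).strip = (φ.strip : Fm Q).subst θ := by
  induction φ <;> simp_all [strip, subst]

theorem strip_inst (k : ℕ) (u : Tm) (φ : Fm P) :
    (φ.inst k u).strip = (φ.strip : Fm Q).inst k u := by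
  induction φ generalizing k <;> simp_all [strip, inst]

theorem strip_instSet (b : FixKind) (a : Option P) (χ : Fm P) (k : ℕ) (φ : Fm P) :
    (instSet b a χ k φ).strip = instSet b none (χ.strip : Fm Q) k φ.strip := by
  induction φ generalizing k with
  | mem t X => by_cases h : X = k <;> simp [strip, instSet, h]
  | _ => simp_all [strip, instSet]

theorem strip_neg (φ : Fm P) : φ.neg.strip = (φ.strip : Fm Q).neg := by
  induction φ <;> simp_all [strip, neg]

theorem strip_unfold (b : FixKind) (a : Option P) (φ : Fm P) (t : Tm) :
    (unfold b a φ t).strip = unfold b none (φ.strip : Fm Q) t := by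
  simp [unfold, strip_inst, strip_instSet]

theorem strip_strip (φ : Fm P) : ((φ.strip : Fm Q).strip : Fm R) = φ.strip := by
  induction φ <;> simp_all [strip]

theorem strip_empty (φ : Fm Empty) : (φ.strip : Fm Empty) = φ := by
  induction φ with
  | fix b a φ t ih =>
    rcases a with _ | a
    · simp [strip, ih]
    · exact a.elim
  | _ => simp_all [strip]

theorem size_strip (φ : Fm P) : (φ.strip : Fm Q).size = φ.size := by
  induction φ <;> simp_all [strip, size]

theorem hasFV_strip (x : ℕ) (φ : Fm P) : (φ.strip : Fm Q).HasFV x ↔ φ.HasFV x := by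
  induction φ <;> simp_all [strip, HasFV]

theorem scoped_strip (m n : ℕ) (φ : Fm P) : (φ.strip : Fm Q).Scoped m n ↔ φ.Scoped m n := by
  induction φ generalizing m n <;> simp_all [strip, Scoped]

theorem not_hasAnn_strip (κ : Q) (φ : Fm P) : ¬ (φ.strip : Fm Q).HasAnn κ := by
  induction φ <;> simp_all [strip, HasAnn]

theorem hasAnn_subst (κ : P) (θ : ℕ → Tm) (φ : Fm P) : (φ.subst θ).HasAnn κ ↔ φ.HasAnn κ := by
  induction φ <;> simp_all [subst, HasAnn]

theorem hasAnn_inst (κ : P) (k : ℕ) (u : Tm) (φ : Fm P) :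
    (φ.inst k u).HasAnn κ ↔ φ.HasAnn κ := by
  induction φ generalizing k <;> simp_all [inst, HasAnn]

theorem hasAnn_of_instSet {κ : P} {b : FixKind} {a : Option P} {χ : Fm P} {k : ℕ} {φ : Fm P}
    (h : (instSet b a χ k φ).HasAnn κ) : φ.HasAnn κ ∨ a = some κ ∨ χ.HasAnn κ := by
  induction φ generalizing k with
  | mem t X =>
    by_cases hX : X = k
    · simpa [instSet, hX, HasAnn] using h
    · simp [instSet, hX, HasAnn] at h
  | fix b a φ t ih =>
    rcases h with h | h
    · exact .inl (.inl h)
    · rcases ih h with h | h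
      · exact .inl (.inr h)
      · exact .inr h
  | and φ ψ ih₁ ih₂ | or φ ψ ih₁ ih₂ =>
    rcases h with h | h
    · rcases ih₁ h with h | h
      · exact .inl (.inl h)
      · exact .inr h
    · rcases ih₂ h with h | h
      · exact .inl (.inr h)
      · exact .inr h
  | all φ ih | ex φ ih =>
    exact ih h
  | _ => exact h.elim

/-- Only the binder `ν` is annotated. -/
def NuOnly : Fm P → Prop
  | fix b a φ _ => (b = .mu → a = none) ∧ φ.NuOnly
  | and φ ψ => φ.NuOnly ∧ ψ.NuOnly
  | or φ ψ => φ.NuOnly ∧ ψ.NuOnly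
  | all φ => φ.NuOnly
  | ex φ => φ.NuOnly
  | _ => True

theorem nuOnly_strip (φ : Fm P) : (φ.strip : Fm Q).NuOnly := by
  induction φ <;> simp_all [strip, NuOnly]

theorem nuOnly_subst (θ : ℕ → Tm) (φ : Fm P) : (φ.subst θ).NuOnly ↔ φ.NuOnly := by
  induction φ <;> simp_all [subst, NuOnly]

theorem nuOnly_inst (k : ℕ) (u : Tm) (φ : Fm P) : (φ.inst k u).NuOnly ↔ φ.NuOnly := by
  induction φ generalizing k <;> simp_all [inst, NuOnly]

theorem nuOnly_instSet {b : FixKind} {a : Option P} {χ : Fm P} (k : ℕ) {φ : Fm P}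
    (ha : b = .mu → a = none) (hχ : χ.NuOnly) (hφ : φ.NuOnly) :
    (instSet b a χ k φ).NuOnly := by
  induction φ generalizing k with
  | mem t X => by_cases h : X = k <;> simp_all [instSet, NuOnly]
  | _ => simp_all [instSet, NuOnly]

/-- Annotations carry over along substitutions. -/
theorem exists_subst_lift (θ : ℕ → Tm) (φ : Fm P) (ψ : Fm Q) (h : ψ.strip = φ.subst θ)
    (hφ : (φ.strip : Fm P) = φ) : ∃ χ : Fm Q, χ.strip = φ ∧ χ.subst θ = ψ := by
  induction φ generalizing ψ with
  | fix b a φ t ih =>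
    cases ψ <;> simp only [strip, subst, reduceCtorEq, fix.injEq] at h hφ ⊢
    rename_i b' a' φ' t'
    obtain ⟨rfl, rfl, h, rfl⟩ := h
    obtain ⟨χ, h1, h2⟩ := ih _ h (by simpa using hφ)
    exact ⟨fix b' a' χ t, by simp [strip, h1], by simp [subst, h2]⟩
  | and φ₁ φ₂ ih₁ ih₂ =>
    cases ψ <;> simp only [strip, subst, reduceCtorEq, and.injEq] at h hφ ⊢
    obtain ⟨χ₁, h1, h2⟩ := ih₁ _ h.1 hφ.1
    obtain ⟨χ₂, h3, h4⟩ := ih₂ _ h.2 hφ.2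
    exact ⟨and χ₁ χ₂, by simp [strip, h1, h3], by simp [subst, h2, h4]⟩
  | or φ₁ φ₂ ih₁ ih₂ =>
    cases ψ <;> simp only [strip, subst, reduceCtorEq, or.injEq] at h hφ ⊢
    obtain ⟨χ₁, h1, h2⟩ := ih₁ _ h.1 hφ.1
    obtain ⟨χ₂, h3, h4⟩ := ih₂ _ h.2 hφ.2
    exact ⟨or χ₁ χ₂, by simp [strip, h1, h3], by simp [subst, h2, h4]⟩
  | all φ ih =>
    cases ψ <;> simp only [strip, subst, reduceCtorEq, all.injEq] at h hφ ⊢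
    obtain ⟨χ, h1, h2⟩ := ih _ h hφ
    exact ⟨all χ, by simp [strip, h1], by simp [subst, h2]⟩
  | ex φ ih =>
    cases ψ <;> simp only [strip, subst, reduceCtorEq, ex.injEq] at h hφ ⊢
    obtain ⟨χ, h1, h2⟩ := ih _ h hφ
    exact ⟨ex χ, by simp [strip, h1], by simp [subst, h2]⟩
  | lt s t => exact ⟨lt s t, rfl, by cases ψ <;> simp_all [strip, subst]⟩
  | nlt s t => exact ⟨nlt s t, rfl, by cases ψ <;> simp_all [strip, subst]⟩
  | eq s t => exact ⟨eq s t, rfl, by cases ψ <;> simp_all [strip, subst]⟩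
  | neq s t => exact ⟨neq s t, rfl, by cases ψ <;> simp_all [strip, subst]⟩
  | mem t X => exact ⟨mem t X, rfl, by cases ψ <;> simp_all [strip, subst]⟩

theorem exists_map_subst_lift (θ : ℕ → Tm) (Γ : List (Fm Empty)) (Δ : List (Fm Q))
    (h : Δ.map strip = Γ.map (subst θ)) :
    ∃ Ξ : List (Fm Q), Ξ.map strip = Γ ∧ Ξ.map (subst θ) = Δ := by
  induction Γ generalizing Δ with
  | nil => exact ⟨[], rfl, by simpa using h.symm⟩
  | cons φ Γ ih =>
    obtain ⟨ψ, Δ, rfl, h1, h2⟩ := List.map_eq_cons_iff.1 h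
    obtain ⟨χ, h3, h4⟩ := exists_subst_lift θ φ ψ h1 (strip_empty φ)
    obtain ⟨Ξ, h5, h6⟩ := ih Δ h2
    exact ⟨χ :: Ξ, by simp [h3, h5], by simp [h4, h6]⟩

section Inversion

variable {φ : Fm P}

theorem strip_eq_lt {s t : Tm} : (φ.strip : Fm Q) = lt s t ↔ φ = lt s t := by
  cases φ <;> simp [strip]

theorem strip_eq_nlt {s t : Tm} : (φ.strip : Fm Q) = nlt s t ↔ φ = nlt s t := by
  cases φ <;> simp [strip]

theorem strip_eq_eq {s t : Tm} : (φ.strip : Fm Q) = eq s t ↔ φ = eq s t := by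
  cases φ <;> simp [strip]

theorem strip_eq_neq {s t : Tm} : (φ.strip : Fm Q) = neq s t ↔ φ = neq s t := by
  cases φ <;> simp [strip]

theorem strip_eq_mem {t : Tm} {X : ℕ} : (φ.strip : Fm Q) = mem t X ↔ φ = mem t X := by
  cases φ <;> simp [strip]

theorem strip_eq_and {ψ₁ ψ₂ : Fm Q} :
    φ.strip = and ψ₁ ψ₂ ↔ ∃ φ₁ φ₂, φ = and φ₁ φ₂ ∧ φ₁.strip = ψ₁ ∧ φ₂.strip = ψ₂ := by
  cases φ <;> simp [strip]

theorem strip_eq_or {ψ₁ ψ₂ : Fm Q} :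
    φ.strip = or ψ₁ ψ₂ ↔ ∃ φ₁ φ₂, φ = or φ₁ φ₂ ∧ φ₁.strip = ψ₁ ∧ φ₂.strip = ψ₂ := by
  cases φ <;> simp [strip]

theorem strip_eq_all {ψ : Fm Q} : φ.strip = all ψ ↔ ∃ χ, φ = all χ ∧ χ.strip = ψ := by
  cases φ <;> simp [strip]

theorem strip_eq_ex {ψ : Fm Q} : φ.strip = ex ψ ↔ ∃ χ, φ = ex χ ∧ χ.strip = ψ := by
  cases φ <;> simp [strip]

theorem strip_eq_fix {b : FixKind} {ψ : Fm Q} {t : Tm} :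
    φ.strip = fix b none ψ t ↔ ∃ a χ, φ = fix b a χ t ∧ χ.strip = ψ := by
  cases φ <;> simp [strip]
  grind

theorem strip_eq_paAxiom {x y : ℕ} {i : Fin 7} :
    (φ.strip : Fm Q) = paAxiom x y i ↔ φ = paAxiom x y i := by
  constructor
  · intro h
    fin_cases i <;>
    simp only [paAxiom, imp, iff, neg, strip_eq_and, strip_eq_or, strip_eq_all, strip_eq_ex,
      strip_eq_eq, strip_eq_neq, strip_eq_lt, strip_eq_nlt] at h ⊢ <;> grind
  · rintro rfl
    fin_cases i <;> rfl

/-- The only binder is a `μ`. If it could carry an annotation, the annotated formula would no longer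
be an axiom. -/
theorem strip_eq_isNat {t : Tm} (h : (φ.strip : Fm Q) = isNat t) (hφ : φ.NuOnly) :
    φ = isNat t := by
  simp only [isNat, strip_eq_fix, strip_eq_or, strip_eq_ex, strip_eq_and, strip_eq_eq,
    strip_eq_mem] at h ⊢
  obtain ⟨a, χ, rfl, φ₁, φ₂, rfl, rfl, φ₃, rfl, φ₄, φ₅, rfl, rfl, rfl⟩ := h
  simp [NuOnly] at hφ
  simp [hφ]

end Inversion

end Fm

/-! ### Constraints, and the number of variables of reduced extended sequents. -/

namespace Constraint

theorem isConstraint_empty : Constraint.empty.IsConstraint where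
  mem h := h.elim
  irrefl _ h := h
  trans h _ := h.elim
  linear h _ := h.elim

theorem IsConstraint.add {O : Constraint} (h : O.IsConstraint) (l : OrdVar) :
    (O.add l).IsConstraint where
  mem h' := ⟨Finset.mem_insert_of_mem (h.mem h').1, Finset.mem_insert_of_mem (h.mem h').2⟩
  irrefl := h.irrefl
  trans := h.trans
  linear := h.linear

theorem IsConstraint.addBelow {O : Constraint} (h : O.IsConstraint) {κ l : OrdVar}
    (hκ : κ ∈ O.V) (hl : l ∉ O.V) : (O.addBelow κ l).IsConstraint where
  mem := by
    rintro a b (h' | ⟨rfl, h' | rfl⟩)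
    · exact ⟨Finset.mem_insert_of_mem (h.mem h').1, Finset.mem_insert_of_mem (h.mem h').2⟩
    · exact ⟨Finset.mem_insert_self _ _, Finset.mem_insert_of_mem (h.mem h').2⟩
    · exact ⟨Finset.mem_insert_self _ _, Finset.mem_insert_of_mem hκ⟩
  irrefl := by
    rintro a (h' | ⟨rfl, h' | rfl⟩)
    · exact h.irrefl _ h'
    · exact hl (h.mem h').2
    · exact hl hκ
  trans := by
    rintro a b c (h1 | ⟨rfl, h1⟩) (h2 | ⟨rfl, h2⟩)
    · exact .inl (h.trans h1 h2)
    · exact absurd (h.mem h1).2 hl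
    · refine .inr ⟨rfl, ?_⟩
      rcases h1 with h1 | rfl
      · exact .inl (h.trans h1 h2)
      · exact .inl h2
    · rcases h1 with h1 | rfl
      · exact absurd (h.mem h1).2 hl
      · exact absurd hκ hl
  linear := by
    rintro a b c (h1 | ⟨rfl, h1⟩) (h2 | ⟨h3, h2⟩)
    · rcases h.linear h1 h2 with h' | h' | h'
      · exact .inl (.inl h')
      · exact .inr (.inl h')
      · exact .inr (.inr (.inl h'))
    · subst h3
      exact absurd (h.mem h1).1 hl
    · exact absurd (h.mem h2).1 hl
    · rcases h1 with h1 | rfl <;> rcases h2 with h2 | rfl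
      · rcases h.linear h1 h2 with h' | h' | h'
        · exact .inl (.inl h')
        · exact .inr (.inl h')
        · exact .inr (.inr (.inl h'))
      · exact .inr (.inr (.inl h1))
      · exact .inl (.inl h2)
      · exact .inr (.inl rfl)

theorem IsConstraint.remove {O : Constraint} (h : O.IsConstraint) (L : Finset OrdVar) :
    (O.remove L).IsConstraint where
  mem h' := ⟨h'.2.1, h'.2.2⟩
  irrefl κ h' := h.irrefl κ h'.1
  trans h1 h2 := ⟨h.trans h1.1 h2.1, h1.2.1, h2.2.2⟩
  linear h1 h2 := by
    rcases h.linear h1.1 h2.1 with h' | h' | h'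
    · exact .inl ⟨h', h1.2.2, h2.2.2⟩
    · exact .inr (.inl h')
    · exact .inr (.inr ⟨h', h2.2.2, h1.2.2⟩)

theorem exists_leastFresh (O : Constraint) : ∃ l, O.LeastFresh l := by
  classical
  have h : ∃ l, l ∉ O.V := Infinite.exists_notMem_finset O.V
  exact ⟨Nat.find h, Nat.find_spec h, fun k hk => not_not.1 (Nat.find_min h hk)⟩

/-- All indices below `l` are in use. This turns a bound for the number of variables into one for
their indices. -/
theorem LeastFresh.le_card {O : Constraint} {l : OrdVar} (h : O.LeastFresh l) :
    l ≤ O.V.card := by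
  have : Finset.range l ⊆ O.V := fun k hk => h.2 k (Finset.mem_range.1 hk)
  simpa using Finset.card_le_card this

theorem mem_children {O : Constraint} {κ l : OrdVar} :
    l ∈ O.children κ ↔ l ∈ O.V ∧ O.lt l κ ∧ ¬ ∃ ξ ∈ O.V, O.lt l ξ ∧ O.lt ξ κ := by
  simp [children]

theorem mem_prunable {O : Constraint} {Γ : List AFormula} {κ : OrdVar} :
    κ ∈ O.prunable Γ ↔ κ ∈ O.V ∧ ∀ l ∈ O.V, O.le l κ → ¬ OccursIn l Γ := by
  simp [prunable]

theorem children_subset (O : Constraint) (κ : OrdVar) : O.children κ ⊆ O.V :=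
  fun _ h => (mem_children.1 h).1

theorem prunable_subset (O : Constraint) (Γ : List AFormula) : O.prunable Γ ⊆ O.V :=
  fun _ h => (mem_prunable.1 h).1

theorem IsExtSequent.remove {O : Constraint} {Γ : List AFormula} (h : O.IsExtSequent Γ)
    {L : Finset OrdVar} (hL : ∀ l ∈ L, ¬ OccursIn l Γ) : (O.remove L).IsExtSequent Γ :=
  ⟨h.1.remove L, h.2.1, fun κ hκ => Finset.mem_sdiff.2 ⟨h.2.2 κ hκ, fun h' => hL κ h' hκ⟩⟩

/-- An element with the largest number of predecessors works: a successor would, by transitivity,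
have the same predecessors and that element as well. -/
theorem _root_.Finset.exists_not_rel {α : Type*} (r : α → α → Prop) (hi : ∀ a, ¬ r a a)
    (ht : ∀ {a b c}, r a b → r b c → r a c) {T : Finset α} (hT : T.Nonempty) :
    ∃ m ∈ T, ∀ x ∈ T, ¬ r m x := by
  classical
  obtain ⟨m, hm, h⟩ := T.exists_max_image (fun m => (T.filter fun x => r x m).card) hT
  refine ⟨m, hm, fun x hx hr => ?_⟩
  refine absurd (h x hx) (not_le.2 (Finset.card_lt_card ?_))
  refine ⟨fun y hy => ?_, fun h' => ?_⟩
  · rw [Finset.mem_filter] at hy ⊢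
    exact ⟨hy.1, ht hy.2 hr⟩
  · exact hi m (Finset.mem_filter.1 (h' (Finset.mem_filter.2 ⟨hm, hr⟩))).2

/-- Below every variable that is not minimal there is a child. -/
theorem IsConstraint.exists_child {O : Constraint} (h : O.IsConstraint) {κ l : OrdVar}
    (hl : O.lt l κ) : ∃ ξ ∈ O.children κ, O.le l ξ := by
  classical
  obtain ⟨ξ, hξ, hmax⟩ := Finset.exists_not_rel O.lt h.irrefl h.trans
    (T := O.V.filter fun ξ => O.le l ξ ∧ O.lt ξ κ)
    ⟨l, by rw [Finset.mem_filter]; exact ⟨(h.mem hl).1, .inr rfl, hl⟩⟩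
  rw [Finset.mem_filter] at hξ
  refine ⟨ξ, mem_children.2 ⟨hξ.1, hξ.2.2, ?_⟩, hξ.2.1⟩
  rintro ⟨ζ, hζ, h1, h2⟩
  refine hmax ζ (Finset.mem_filter.2 ⟨hζ, .inl ?_, h2⟩) h1
  rcases hξ.2.1 with h3 | rfl
  · exact h.trans h3 h1
  · exact h1

/-- Two parents would be comparable, both being above `l`, and then the lower one would lie strictly
between `l` and the other. -/
theorem IsConstraint.parent_unique {O : Constraint} (h : O.IsConstraint) {κ κ' l : OrdVar}
    (h1 : l ∈ O.children κ) (h2 : l ∈ O.children κ') : κ = κ' := by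
  rw [mem_children] at h1 h2
  rcases h.linear h1.2.1 h2.2.1 with h' | h' | h'
  · exact absurd ⟨κ, (h.mem h1.2.1).2, h1.2.1, h'⟩ h2.2.2
  · exact h'
  · exact absurd ⟨κ', (h.mem h2.2.1).2, h2.2.1, h'⟩ h1.2.2

open Classical in
/-- In a reduced extended sequent every variable that does not occur has a child that does. -/
theorem IsExtSequent.card_le_of_reduced {O : Constraint} {Γ : List AFormula}
    (h : O.IsExtSequent Γ) (hr : O.Reduced Γ) :
    O.V.card ≤ 2 * (O.V.filter fun κ => OccursIn κ Γ).card := by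
  have key : ∀ κ ∈ O.V.filter fun κ => ¬ OccursIn κ Γ,
      ∃ l ∈ O.V.filter fun κ => OccursIn κ Γ, l ∈ O.children κ := by
    intro κ hκ
    rw [Finset.mem_filter] at hκ
    have h1 : κ ∉ O.prunable Γ := fun h' => hr.2 ⟨κ, h'⟩
    have h2 : ∃ l ∈ O.V, O.le l κ ∧ OccursIn l Γ := by
      by_contra hc
      push Not at hc
      exact h1 (mem_prunable.2 ⟨hκ.1, hc⟩)
    obtain ⟨l, -, h3 | rfl, h4⟩ := h2
    · obtain ⟨ξ, hξ, -⟩ := h.1.exists_child h3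
      -- There are children and `κ` does not occur, so an occurring child is the only possible
      -- obstacle to a reset of `κ`.
      have h5 := hr.1 κ
      by_contra hc
      refine h5 ⟨⟨ξ, hξ⟩, hκ.2, fun l hl hl' => hc ⟨l, ?_, hl⟩⟩
      exact Finset.mem_filter.2 ⟨O.children_subset κ hl, hl'⟩
    · exact absurd h4 hκ.2
  choose! f hf hf' using key
  -- Parents are unique, so different variables are assigned different occurring children; at least
  -- half of the variables occur.
  have := Finset.card_le_card_of_injOn (s := O.V.filter fun κ => ¬ OccursIn κ Γ) f hf
    fun a ha b hb hab => h.1.parent_unique (hf' a ha) (hab ▸ hf' b hb)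
  have h2 := O.V.card_filter_add_card_filter_not (fun κ => OccursIn κ Γ)
  omega

end Constraint

namespace Fm

variable {P Q : Type}

/-- The annotations of a formula. -/
def anns : Fm P → List P
  | fix _ a φ _ => a.toList ++ φ.anns
  | and φ ψ => φ.anns ++ ψ.anns
  | or φ ψ => φ.anns ++ ψ.anns
  | all φ => φ.anns
  | ex φ => φ.anns
  | _ => []

theorem mem_anns {κ : P} {φ : Fm P} : κ ∈ φ.anns ↔ φ.HasAnn κ := by
  induction φ <;> simp_all [anns, HasAnn]

theorem length_anns_le (φ : Fm P) : φ.anns.length ≤ φ.size := by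
  induction φ with
  | fix b a φ t ih => cases a <;> simp [anns, size] <;> omega
  | _ => simp [anns, size] <;> omega

end Fm

open Classical in
theorem Constraint.card_occurs_le (O : Constraint) (Γ : List AFormula) :
    (O.V.filter fun κ => OccursIn κ Γ).card ≤ (Γ.map Fm.size).sum := by
  have h1 : (O.V.filter fun κ => OccursIn κ Γ) ⊆ (Γ.flatMap Fm.anns).toFinset := by
    intro κ hκ
    obtain ⟨φ, hφ, h⟩ := (Finset.mem_filter.1 hκ).2
    simp only [List.mem_toFinset, List.mem_flatMap]
    exact ⟨φ, hφ, Fm.mem_anns.2 h⟩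
  refine (Finset.card_le_card h1).trans ((List.toFinset_card_le _).trans ?_)
  rw [List.length_flatMap]
  exact List.sum_le_sum fun φ _ => φ.length_anns_le

/-! ### Annotated versions of the shared rules. -/

namespace LRule

variable {P Q : Type}

theorem strip_prems (r : LRule P) :
    (r.strip : LRule Q).prems = r.prems.map (List.map Fm.strip) := by
  cases r <;>
    simp [strip, prems, Fm.strip_neg, Fm.strip_subst, Fm.strip_inst, Fm.strip_unfold]

theorem strip_side (r : LRule P) : (r.strip : LRule Q).Side ↔ r.Side := by
  cases r <;> simp [strip, Side, Fm.hasFV_strip]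

theorem strip_anc (r : LRule P) (p q : ℕ) : (r.strip : LRule Q).Anc p q ↔ r.Anc p q := by
  cases r <;> simp [strip, Anc]

theorem map_eq_concat_iff {α β : Type*} {f : α → β} {l : List α} {m : List β} {b : β} :
    l.map f = m ++ [b] ↔ ∃ l' a, l = l' ++ [a] ∧ l'.map f = m ∧ f a = b := by
  rw [List.map_eq_append_iff]
  constructor
  · rintro ⟨l₁, l₂, rfl, h1, h2⟩
    obtain ⟨a, rfl, h3⟩ := List.map_eq_singleton_iff.1 h2
    exact ⟨l₁, a, rfl, h1, h3⟩
  · rintro ⟨l', a, rfl, h1, h2⟩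
    exact ⟨l', [a], rfl, h1, by simp [h2]⟩

/-- The annotated version of a rule, for a given annotated conclusion. -/
theorem exists_annotated {r : LRule Empty} (hid : ∀ Γ φ, r = ident Γ φ → Γ = [] ∧ φ.IsNumAtom)
    {Γ : List AFormula} (h : Γ.map Fm.strip = r.concl) (hn : ∀ φ ∈ Γ, φ.NuOnly) :
    ∃ ρ : LRule OrdVar, ρ.strip = r ∧ ρ.concl = Γ ∧
      (∀ Δ φ, ρ = cut Δ φ → φ = (φ.strip : Formula).strip) ∧ (∀ Δ φ, ρ = ident Δ φ → Δ = []) ∧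
      ∀ Δ ∈ ρ.prems, ∀ φ ∈ Δ,
        φ.NuOnly ∧ ∀ κ, φ.HasAnn κ → Constraint.OccursIn κ Γ := by
  have side : ∀ {Δ : List AFormula} {φ}, φ ∈ Δ → (∀ ψ ∈ Δ, ψ ∈ Γ) →
      φ.NuOnly ∧ ∀ κ, φ.HasAnn κ → Constraint.OccursIn κ Γ :=
    fun hφ hΔ => ⟨hn _ (hΔ _ hφ), fun κ hκ => ⟨_, hΔ _ hφ, hκ⟩⟩
  cases r with
  -- An atom has only one annotated version, so the given conclusion is again an identity.
  | ident Δ φ =>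
    obtain ⟨rfl, hφ⟩ := hid _ _ rfl
    refine ⟨ident [] φ.strip, ?_, ?_, by simp, by simp, by simp [prems]⟩
    · simp [strip, Fm.strip_strip, Fm.strip_empty]
    · obtain ⟨ψ, Γ, rfl, h1, h2⟩ := List.map_eq_cons_iff.1 h
      obtain ⟨χ, rfl, h2⟩ := List.map_eq_singleton_iff.1 h2
      cases φ <;> simp only [Fm.IsNumAtom] at hφ <;>
        simp_all [Fm.neg, Fm.strip_eq_lt, Fm.strip_eq_nlt, Fm.strip_eq_eq, Fm.strip_eq_neq, concl,
          Fm.strip]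
  | wk Δ Ξ =>
    obtain ⟨Δ', Ξ', rfl, h1, h2⟩ := List.map_eq_append_iff.1 h
    refine ⟨wk Δ' Ξ', by simp [strip, h1, h2], rfl, by simp, by simp, ?_⟩
    simp only [prems, List.mem_singleton, forall_eq]
    exact fun φ hφ => side hφ (by simp +contextual)
  | exch Δ φ ψ Ξ =>
    obtain ⟨Δ', Ξ', rfl, h1, h2⟩ := List.map_eq_append_iff.1 h
    obtain ⟨φ', Ξ', rfl, h3, h4⟩ := List.map_eq_cons_iff.1 h2
    obtain ⟨ψ', Ξ', rfl, h5, h6⟩ := List.map_eq_cons_iff.1 h4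
    refine ⟨exch Δ' φ' ψ' Ξ', by simp [strip, h1, h3, h5, h6], rfl, by simp, by simp, ?_⟩
    simp only [prems, List.mem_singleton, forall_eq]
    exact fun φ hφ => side hφ (by simp; grind)
  | sub θ Δ =>
    obtain ⟨Ξ, h1, rfl⟩ := Fm.exists_map_subst_lift θ Δ Γ h
    refine ⟨sub θ Ξ, by simp [strip, h1], rfl, by simp, by simp, ?_⟩
    simp only [prems, List.mem_singleton, forall_eq]
    intro φ hφ
    exact ⟨(Fm.nuOnly_subst θ φ).1 (hn _ (List.mem_map_of_mem hφ)),
      fun κ hκ => ⟨_, List.mem_map_of_mem hφ, (Fm.hasAnn_subst κ θ φ).2 hκ⟩⟩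
  | cut Δ φ =>
    refine ⟨cut Γ φ.strip, ?_, rfl, ?_, by simp, ?_⟩
    · simp only [strip, Fm.strip_strip, Fm.strip_empty, h, concl]
    · rintro Δ φ' ⟨⟩
      simp only [Fm.strip_strip]
    · simp only [prems, List.mem_cons, List.not_mem_nil, or_false, forall_eq_or_imp, forall_eq,
        List.mem_append]
      rw [← Fm.strip_neg]
      constructor
      all_goals
        rintro φ (hφ | rfl)
        · exact side hφ (by simp)
        · exact ⟨Fm.nuOnly_strip _, fun κ hκ => absurd hκ (Fm.not_hasAnn_strip _ _)⟩
  | and Δ φ ψ =>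
    obtain ⟨Δ', χ, rfl, h1, h2⟩ := map_eq_concat_iff.1 h
    obtain ⟨φ', ψ', rfl, h3, h4⟩ := Fm.strip_eq_and.1 h2
    refine ⟨and Δ' φ' ψ', by simp [strip, h1, h3, h4], rfl, by simp, by simp, ?_⟩
    have := hn (.and φ' ψ') (by simp)
    simp only [prems, List.mem_cons, List.not_mem_nil, or_false, forall_eq_or_imp, forall_eq,
      List.mem_append]
    constructor
    · rintro φ (hφ | rfl)
      · exact side hφ (by simp +contextual)
      · exact ⟨this.1, fun κ hκ => ⟨.and φ ψ', by simp, .inl hκ⟩⟩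
    · rintro φ (hφ | rfl)
      · exact side hφ (by simp +contextual)
      · exact ⟨this.2, fun κ hκ => ⟨.and φ' φ, by simp, .inr hκ⟩⟩
  | or Δ φ ψ =>
    obtain ⟨Δ', χ, rfl, h1, h2⟩ := map_eq_concat_iff.1 h
    obtain ⟨φ', ψ', rfl, h3, h4⟩ := Fm.strip_eq_or.1 h2
    refine ⟨or Δ' φ' ψ', by simp [strip, h1, h3, h4], rfl, by simp, by simp, ?_⟩
    have := hn (.or φ' ψ') (by simp)
    simp only [prems, List.mem_cons, List.not_mem_nil, or_false, forall_eq,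
      List.mem_append]
    rintro φ (hφ | rfl | rfl)
    · exact side hφ (by simp +contextual)
    · exact ⟨this.1, fun κ hκ => ⟨.or φ ψ', by simp, .inl hκ⟩⟩
    · exact ⟨this.2, fun κ hκ => ⟨.or φ' φ, by simp, .inr hκ⟩⟩
  | all Δ φ y =>
    obtain ⟨Δ', χ, rfl, h1, h2⟩ := map_eq_concat_iff.1 h
    obtain ⟨φ', rfl, h3⟩ := Fm.strip_eq_all.1 h2
    refine ⟨all Δ' φ' y, by simp [strip, h1, h3], rfl, by simp, by simp, ?_⟩
    have := hn (.all φ') (by simp)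
    simp only [prems, List.mem_singleton, forall_eq, List.mem_append]
    rintro φ (hφ | rfl)
    · exact side hφ (by simp +contextual)
    · exact ⟨(Fm.nuOnly_inst _ _ _).2 this,
        fun κ hκ => ⟨.all φ', by simp, show φ'.HasAnn κ from (Fm.hasAnn_inst _ _ _ _).1 hκ⟩⟩
  | ex Δ φ t =>
    obtain ⟨Δ', χ, rfl, h1, h2⟩ := map_eq_concat_iff.1 h
    obtain ⟨φ', rfl, h3⟩ := Fm.strip_eq_ex.1 h2
    refine ⟨ex Δ' φ' t, by simp [strip, h1, h3], rfl, by simp, by simp, ?_⟩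
    have := hn (.ex φ') (by simp)
    simp only [prems, List.mem_singleton, forall_eq, List.mem_append]
    rintro φ (hφ | rfl)
    · exact side hφ (by simp +contextual)
    · exact ⟨(Fm.nuOnly_inst _ _ _).2 this,
        fun κ hκ => ⟨.ex φ', by simp, show φ'.HasAnn κ from (Fm.hasAnn_inst _ _ _ _).1 hκ⟩⟩
  | eqSub Δ x s t =>
    obtain ⟨Δ', χ, rfl, h1, h2⟩ := map_eq_concat_iff.1 h
    obtain ⟨Ξ, h3, rfl⟩ := Fm.exists_map_subst_lift _ Δ Δ' h1
    obtain rfl := Fm.strip_eq_neq.1 h2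
    refine ⟨eqSub Ξ x s t, by simp [strip, h3], rfl, by simp, by simp, ?_⟩
    simp only [prems, List.mem_singleton, forall_eq, List.mem_map]
    rintro _ ⟨φ, hφ, rfl⟩
    have hφ' : φ.subst (single x t) ∈ Ξ.map (Fm.subst (single x t)) ++ [.neq s t] := by
      simp only [List.mem_append]
      exact .inl (List.mem_map_of_mem hφ)
    refine ⟨(Fm.nuOnly_subst _ φ).2 ((Fm.nuOnly_subst _ φ).1 (hn _ hφ')),
      fun κ hκ => ⟨_, hφ', (Fm.hasAnn_subst κ _ φ).2 ((Fm.hasAnn_subst κ _ φ).1 hκ)⟩⟩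
  | eqRefl t =>
    obtain ⟨φ, rfl, h1⟩ := List.map_eq_singleton_iff.1 h
    obtain rfl := Fm.strip_eq_eq.1 h1
    exact ⟨eqRefl t, rfl, rfl, by simp, by simp, by simp [prems]⟩
  | pa i x y =>
    obtain ⟨φ, rfl, h1⟩ := List.map_eq_singleton_iff.1 h
    obtain rfl := Fm.strip_eq_paAxiom.1 h1
    exact ⟨pa i x y, rfl, rfl, by simp, by simp, by simp [prems]⟩
  | nat t =>
    obtain ⟨φ, rfl, h1⟩ := List.map_eq_singleton_iff.1 h
    obtain rfl := Fm.strip_eq_isNat h1 (hn _ (by simp))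
    exact ⟨nat t, rfl, rfl, by simp, by simp, by simp [prems]⟩
  | mu Δ φ t =>
    obtain ⟨Δ', χ, rfl, h1, h2⟩ := map_eq_concat_iff.1 h
    obtain ⟨a, φ', rfl, h3⟩ := Fm.strip_eq_fix.1 h2
    have := hn (.fix .mu a φ' t) (by simp)
    -- The annotated system has a rule for un-annotated `μ` only, and `NuOnly` ensures that no other
    -- `μ` is met.
    obtain rfl := this.1 rfl
    refine ⟨mu Δ' φ' t, by simp [strip, h1, h3], rfl, by simp, by simp, ?_⟩
    simp only [prems, List.mem_singleton, forall_eq, List.mem_append]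
    rintro φ (hφ | rfl)
    · exact side hφ (by simp +contextual)
    · refine ⟨(Fm.nuOnly_inst _ _ _).2 (Fm.nuOnly_instSet _ (by simp) this.2 this.2),
        fun κ hκ => ⟨.fix .mu none φ' t, by simp, ?_⟩⟩
      rcases Fm.hasAnn_of_instSet ((Fm.hasAnn_inst _ _ _ _).1 hκ) with h | h | h
      · exact .inr h
      · cases h
      · exact .inr h

end LRule

/-! ### Single steps of the translation. -/

/-- A step of a translation at a rule `r` of the plain coderivation. -/
def TransStep (r : PRule) (ρ : ARule) : Prop :=
  (r.prems ≠ [] ∧ ((∃ κ, ρ.IsReset κ) ∨ ρ.IsPrune)) ∨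
    ((r.prems ≠ [] → ρ.concl.1.Reduced ρ.concl.2) ∧ (Prepares r ρ ∨ Advances r ρ))

/-- In annotated form, `s` is a sequent that may appear in a translation at a rule `r`. -/
structure Annotates (s : Constraint × List AFormula) (Γ : List Formula) : Prop where
  strip : s.2.map Fm.strip = Γ
  ext : s.1.IsExtSequent s.2
  nuOnly : ∀ φ ∈ s.2, φ.NuOnly

/-- A translation can always be continued. Resets and the pruning have priority at rules with
premises; otherwise the plain rule is annotated, where the annotation of a principal `ν` decides
between `ν` and `ν^κ`. That only `ν` is annotated is preserved, as later steps rely on it. -/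
theorem exists_transStep {r : PRule} (hr : r.Valid)
    (hid : ∀ Γ φ, r = .logic (.ident Γ φ) → Γ = [] ∧ φ.IsNumAtom)
    {s : Constraint × List AFormula} (hs : Annotates s r.concl) :
    ∃ ρ : ARule, ρ.concl = s ∧ ρ.Valid ∧ TransStep r ρ ∧
      ∀ p ∈ ρ.prems, (∀ φ ∈ p.2, φ.NuOnly) := by
  obtain ⟨O, Γ⟩ := s
  obtain ⟨hs, hext, hn⟩ := hs
  dsimp only at hs hext hn
  by_cases hred : r.prems ≠ [] ∧ ¬ O.Reduced Γ
  · obtain ⟨hp, hred⟩ := hred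
    rw [Constraint.Reduced, not_and_or] at hred
    push Not at hred
    rcases hred with ⟨κ, hκ⟩ | hpr
    · refine ⟨.cw O Γ (O.children κ), rfl, ⟨hext, ?_, O.children_subset κ⟩,
        .inl ⟨hp, .inl ⟨κ, O, Γ, rfl, hκ⟩⟩, by simpa [ARule.prems] using hn⟩
      simp only [ARule.prems, List.mem_singleton, forall_eq]
      exact hext.remove hκ.2.2
    · refine ⟨.cw O Γ (O.prunable Γ), rfl, ⟨hext, ?_, O.prunable_subset Γ⟩,
        .inl ⟨hp, .inr ⟨O, Γ, rfl, hpr⟩⟩, by simpa [ARule.prems] using hn⟩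
      simp only [ARule.prems, List.mem_singleton, forall_eq]
      exact hext.remove fun l hl => (Constraint.mem_prunable.1 hl).2 l
        (Constraint.mem_prunable.1 hl).1 (.inr rfl)
  · have hred' : r.prems ≠ [] → O.Reduced Γ := by tauto
    cases r with
    | logic r =>
      obtain ⟨ρ, rfl, rfl, h1, h2, h3⟩ := LRule.exists_annotated
        (fun Γ φ h => hid Γ φ (by rw [h])) hs hn
      refine ⟨.logic O ρ, rfl, ⟨hext, ?_, ?_⟩, .inr ⟨hred', .inr ⟨rfl, h1⟩⟩, ?_⟩
      · simp only [ARule.prems, List.mem_map, forall_exists_index, and_imp]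
        rintro _ Δ hΔ rfl
        refine ⟨hext.1, fun φ hφ => ?_, ?_⟩
        · have := hr.2.1 (Δ.map Fm.strip)
            (by simp only [PRule.prems, LRule.strip_prems]; exact List.mem_map_of_mem hΔ)
            _ (List.mem_map_of_mem hφ)
          exact (Fm.scoped_strip _ _ _).1 this
        · rintro κ ⟨φ, hφ, hκ⟩
          exact hext.2.2 κ ((h3 Δ hΔ φ hφ).2 κ hκ)
      · have := (LRule.strip_side ρ).1 hr.2.2
        cases ρ with
        | ident Δ φ => exact h2 _ _ rfl
        | _ => exact this
      · simp only [ARule.prems, List.mem_map, forall_exists_index, and_imp]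
        rintro _ Δ hΔ rfl φ hφ
        exact (h3 Δ hΔ φ hφ).1
    | nu Δ φ t =>
      obtain ⟨Δ', χ, rfl, rfl, h2⟩ := LRule.map_eq_concat_iff.1 hs
      obtain ⟨a, φ', rfl, rfl⟩ := Fm.strip_eq_fix.1 h2
      obtain ⟨l, hl⟩ := O.exists_leastFresh
      have hn' := hn (.fix .nu a φ' t) (by simp)
      have hsc := hext.2.1 (.fix .nu a φ' t) (by simp)
      cases a with
      | none =>
        refine ⟨.nu O Δ' φ' t l, rfl, ⟨hext, ?_, hl.1⟩, .inr ⟨hred', .inl ⟨rfl, hl⟩⟩, ?_⟩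
        · simp only [ARule.prems, List.mem_singleton, forall_eq]
          refine ⟨hext.1.add l, ?_, ?_⟩
          · simp only [List.mem_append, List.mem_singleton]
            rintro ψ (hψ | rfl)
            · exact hext.2.1 ψ (by simp [hψ])
            · exact hsc
          · rintro κ ⟨ψ, hψ, hκ⟩
            simp only [List.mem_append, List.mem_singleton] at hψ
            rcases hψ with hψ | rfl
            · exact Finset.mem_insert_of_mem (hext.2.2 κ ⟨ψ, by simp [hψ], hκ⟩)
            · rcases hκ with hκ | hκ
              · cases hκ
                exact Finset.mem_insert_self _ _
              · exact Finset.mem_insert_of_mem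
                  (hext.2.2 κ ⟨.fix .nu none φ' t, by simp, .inr hκ⟩)
        · simp only [ARule.prems, List.mem_singleton, forall_eq, List.mem_append]
          rintro ψ (hψ | rfl)
          · exact hn ψ (by simp [hψ])
          · exact ⟨by simp, hn'.2⟩
      | some κ =>
        have hκ : κ ∈ O.V := hext.2.2 κ ⟨.fix .nu (some κ) φ' t, by simp, .inl rfl⟩
        refine ⟨.nuAnn O Δ' φ' t κ l, rfl, ⟨hext, ?_, hl.1⟩, .inr ⟨hred', .inr ⟨rfl, hl⟩⟩, ?_⟩
        · simp only [ARule.prems, List.mem_singleton, forall_eq]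
          refine ⟨hext.1.addBelow hκ hl.1, ?_, ?_⟩
          · simp only [List.mem_append, List.mem_singleton]
            rintro ψ (hψ | rfl)
            · exact hext.2.1 ψ (by simp [hψ])
            · have := hr.2.1 _ (List.mem_singleton_self _) (Fm.unfold .nu none φ'.strip t)
                (by simp)
              rw [← Fm.strip_unfold _ (some l)] at this
              exact (Fm.scoped_strip _ _ _).1 this
          · rintro ξ ⟨ψ, hψ, hξ⟩
            simp only [List.mem_append, List.mem_singleton] at hψ
            rcases hψ with hψ | rfl
            · exact Finset.mem_insert_of_mem (hext.2.2 ξ ⟨ψ, by simp [hψ], hξ⟩)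
            · have h' : φ'.HasAnn ξ → ξ ∈ O.V := fun h =>
                hext.2.2 ξ ⟨.fix .nu (some κ) φ' t, by simp, .inr h⟩
              rcases Fm.hasAnn_of_instSet ((Fm.hasAnn_inst _ _ _ _).1 hξ) with h | h | h
              · exact Finset.mem_insert_of_mem (h' h)
              · cases h
                exact Finset.mem_insert_self _ _
              · exact Finset.mem_insert_of_mem (h' h)
        · simp only [ARule.prems, List.mem_singleton, forall_eq, List.mem_append]
          rintro ψ (hψ | rfl)
          · exact hn ψ (by simp [hψ])
          · exact (Fm.nuOnly_inst _ _ _).2 (Fm.nuOnly_instSet _ (by simp) hn'.2 hn'.2)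

namespace Coderivation

variable {S : System}

/-- The sub-coderivations of `D`. -/
def subs (D : Coderivation S) : Set (Coderivation S) := {E | ∃ u hu, E = D.sub u hu}

theorem self_mem_subs (D : Coderivation S) : D ∈ D.subs :=
  ⟨[], D.root, ext_label fun _ => rfl⟩

theorem child_mem_subs {D E : Coderivation S} (h : E ∈ D.subs) (b : Bool) :
    E.child b ∈ D.subs := by
  obtain ⟨u, hu, rfl⟩ := h
  unfold child
  split
  · rename_i hb
    exact ⟨u ++ [b], hb, ext_label fun v => by simp [sub]⟩
  · exact ⟨u, hu, rfl⟩

end Coderivation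

theorem PlainCoderivation.AtomicIdent.child {D : PlainCoderivation} (h : D.AtomicIdent)
    (b : Bool) : PlainCoderivation.AtomicIdent (Coderivation.child D b) := by
  unfold Coderivation.child
  split
  · exact fun u Γ φ hu => h _ _ _ hu
  · exact h

theorem PlainCoderivation.AtomicIdent.of_mem_subs {D E : PlainCoderivation}
    (h : D.AtomicIdent) (hE : E ∈ Coderivation.subs D) : E.AtomicIdent := by
  obtain ⟨u, hu, rfl⟩ := hE
  exact fun v Γ φ hv => h _ _ _ hv

/-! ### Finiteness of the annotated sequents with bounded variables. -/

namespace Fm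

theorem finite_annotated (ψ : Formula) (B : ℕ) :
    {φ : AFormula | φ.strip = ψ ∧ ∀ κ, φ.HasAnn κ → κ < B}.Finite := by
  induction ψ with
  | lt s t => exact (Set.finite_singleton (lt s t)).subset fun φ h => strip_eq_lt.1 h.1
  | nlt s t => exact (Set.finite_singleton (nlt s t)).subset fun φ h => strip_eq_nlt.1 h.1
  | eq s t => exact (Set.finite_singleton (eq s t)).subset fun φ h => strip_eq_eq.1 h.1
  | neq s t => exact (Set.finite_singleton (neq s t)).subset fun φ h => strip_eq_neq.1 h.1
  | mem t X => exact (Set.finite_singleton (mem t X)).subset fun φ h => strip_eq_mem.1 h.1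
  | and ψ₁ ψ₂ ih₁ ih₂ =>
    refine (ih₁.image2 and ih₂).subset ?_
    rintro φ ⟨h, hB⟩
    obtain ⟨φ₁, φ₂, rfl, h1, h2⟩ := strip_eq_and.1 h
    exact ⟨φ₁, ⟨h1, fun κ hκ => hB κ (.inl hκ)⟩, φ₂, ⟨h2, fun κ hκ => hB κ (.inr hκ)⟩, rfl⟩
  | or ψ₁ ψ₂ ih₁ ih₂ =>
    refine (ih₁.image2 or ih₂).subset ?_
    rintro φ ⟨h, hB⟩
    obtain ⟨φ₁, φ₂, rfl, h1, h2⟩ := strip_eq_or.1 h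
    exact ⟨φ₁, ⟨h1, fun κ hκ => hB κ (.inl hκ)⟩, φ₂, ⟨h2, fun κ hκ => hB κ (.inr hκ)⟩, rfl⟩
  | all ψ ih =>
    refine (ih.image all).subset ?_
    rintro φ ⟨h, hB⟩
    obtain ⟨φ', rfl, h1⟩ := strip_eq_all.1 h
    exact ⟨φ', ⟨h1, hB⟩, rfl⟩
  | ex ψ ih =>
    refine (ih.image ex).subset ?_
    rintro φ ⟨h, hB⟩
    obtain ⟨φ', rfl, h1⟩ := strip_eq_ex.1 h
    exact ⟨φ', ⟨h1, hB⟩, rfl⟩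
  | fix b a ψ t ih =>
    have hf : (insert none (some '' Set.Iio B) : Set (Option OrdVar)).Finite :=
      ((Set.finite_Iio B).image some).insert none
    refine (hf.image2 (fun a φ => fix b a φ t) ih).subset ?_
    rintro φ ⟨h, hB⟩
    rcases a with _ | a
    · obtain ⟨a, χ, rfl, h1⟩ := strip_eq_fix.1 h
      refine ⟨a, ?_, χ, ⟨h1, fun κ hκ => hB κ (.inr hκ)⟩, rfl⟩
      cases a with
      | none => exact .inl rfl
      | some κ => exact .inr ⟨κ, hB κ (.inl rfl), rfl⟩
    · exact a.elim

end Fm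

theorem finite_annotated_seq (Γ : List Formula) (B : ℕ) :
    {Δ : List AFormula | Δ.map Fm.strip = Γ ∧ ∀ φ ∈ Δ, ∀ κ, φ.HasAnn κ → κ < B}.Finite := by
  induction Γ with
  | nil => exact (Set.finite_singleton []).subset fun Δ h => by simpa using h.1
  | cons ψ Γ ih =>
    refine ((ψ.finite_annotated B).image2 List.cons ih).subset ?_
    rintro Δ ⟨h, hB⟩
    obtain ⟨φ, Δ, rfl, h1, h2⟩ := List.map_eq_cons_iff.1 h
    exact ⟨φ, ⟨h1, hB φ (by simp)⟩, Δ, ⟨h2, fun φ hφ => hB φ (by simp [hφ])⟩, rfl⟩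

theorem Constraint.finite_bounded (B : ℕ) :
    {O : Constraint | O.IsConstraint ∧ O.V ⊆ Finset.range B}.Finite := by
  have hV : {V : Finset OrdVar | V ⊆ Finset.range B}.Finite := by
    refine (Finset.finite_toSet (Finset.range B).powerset).subset fun V hV => ?_
    exact Finset.mem_coe.2 (Finset.mem_powerset.2 hV)
  have hR : {R : Set (OrdVar × OrdVar) | R ⊆ Set.Iio B ×ˢ Set.Iio B}.Finite :=
    ((Set.finite_Iio B).prod (Set.finite_Iio B)).finite_subsets
  refine (hV.image2 (fun V R => ⟨V, fun a b => (a, b) ∈ R⟩) hR).subset ?_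
  rintro O ⟨hO, hB⟩
  refine ⟨O.V, hB, {p | O.lt p.1 p.2}, ?_, rfl⟩
  rintro ⟨a, b⟩ h
  have := hO.mem h
  exact ⟨Finset.mem_range.1 (hB this.1), Finset.mem_range.1 (hB this.2)⟩

theorem finite_annotates {G : Set (List Formula)} (hG : G.Finite) (B : ℕ) :
    {s | ∃ Γ ∈ G, Annotates s Γ ∧ s.1.V ⊆ Finset.range B}.Finite := by
  refine ((Constraint.finite_bounded B).prod
    (hG.biUnion fun Γ _ => finite_annotated_seq Γ B)).subset ?_
  rintro ⟨O, Δ⟩ ⟨Γ, hΓ, h, hB⟩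
  refine ⟨⟨h.ext.1, hB⟩, Set.mem_biUnion hΓ ⟨h.strip, fun φ hφ κ hκ => ?_⟩⟩
  exact Finset.mem_range.1 (hB (h.ext.2.2 κ ⟨φ, hφ, hκ⟩))

namespace TransStep

variable {r : PRule} {ρ : ARule}

/-- This keeps the translation in step with the plain coderivation: advancing steps reach annotated
versions of the premises of `r`, the other steps do not change the underlying plain sequent
(`prems_of_not_advances`). -/
theorem prems_of_advances (h : Advances r ρ) :
    ρ.prems.map (fun p => p.2.map Fm.strip) = r.prems := by
  cases ρ with
  | logic O ρ =>
    obtain ⟨rfl, -⟩ := h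
    simp [ARule.prems, PRule.prems, LRule.strip_prems, Function.comp_def]
  | nuAnn O Γ φ t κ l =>
    obtain ⟨rfl, -⟩ := h
    have := Fm.strip_unfold (Q := Empty) .nu (some l) φ t
    simp only [Fm.unfold] at this
    simp [ARule.prems, PRule.prems, this, Fm.unfold]
  | nu => exact h.elim
  | cw => exact h.elim

theorem prems_of_not_advances (h : TransStep r ρ) (hA : ¬ Advances r ρ) :
    ∀ p ∈ ρ.prems, p.2.map Fm.strip = ρ.concl.2.map (Fm.strip : AFormula → Formula) := by
  rcases h with ⟨-, ⟨κ, O, Γ, rfl, -⟩ | ⟨O, Γ, rfl, -⟩⟩ | ⟨-, h | h⟩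
  · simp [ARule.prems, ARule.concl]
  · simp [ARule.prems, ARule.concl]
  · cases ρ with
    | nu O Γ φ t l => simp [ARule.prems, ARule.concl, Fm.strip]
    | _ => exact h.elim
  · exact absurd h hA

/-- New variables are bounded by the size of the sequent. -/
theorem subset_range (h : TransStep r ρ) (hv : ρ.Valid) {M : ℕ}
    (hM : (ρ.concl.2.map Fm.size).sum ≤ M) (hB : ρ.concl.1.V ⊆ Finset.range (2 * M + 1)) :
    ∀ p ∈ ρ.prems, p.1.V ⊆ Finset.range (2 * M + 1) := by
  -- At most `M` variables occur, hence a reduced constraint has at most `2 * M` of them, and the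
  -- least fresh index is at most `2 * M`.
  have key : ∀ l, ρ.concl.1.Reduced ρ.concl.2 → ρ.concl.1.LeastFresh l →
      insert l ρ.concl.1.V ⊆ Finset.range (2 * M + 1) := by
    intro l hr hl
    refine Finset.insert_subset (Finset.mem_range.2 ?_) hB
    have h1 := hl.le_card
    have h2 := hv.1.card_le_of_reduced hr
    have h3 := Constraint.card_occurs_le ρ.concl.1 ρ.concl.2
    change l < 2 * M + 1
    calc l ≤ _ := h1
      _ ≤ 2 * M := h2.trans (Nat.mul_le_mul_left 2 (h3.trans hM))
      _ < _ := Nat.lt_succ_self _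
  rcases h with ⟨-, ⟨κ, O, Γ, rfl, -⟩ | ⟨O, Γ, rfl, -⟩⟩ | ⟨hr, h | h⟩
  · simp only [ARule.prems, List.mem_singleton, forall_eq]
    exact Finset.sdiff_subset.trans hB
  · simp only [ARule.prems, List.mem_singleton, forall_eq]
    exact Finset.sdiff_subset.trans hB
  · cases ρ with
    | nu O Γ φ t l =>
      obtain ⟨rfl, hl⟩ := h
      simp only [ARule.prems, List.mem_singleton, forall_eq]
      exact key l (hr (by simp [PRule.prems])) hl
    | _ => exact h.elim
  · cases ρ with
    | logic O ρ =>
      simp only [ARule.prems, List.mem_map, forall_exists_index, and_imp]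
      rintro _ Δ - rfl
      exact hB
    | nuAnn O Γ φ t κ l =>
      obtain ⟨rfl, hl⟩ := h
      simp only [ARule.prems, List.mem_singleton, forall_eq]
      exact key l (hr (by simp [PRule.prems])) hl
    | _ => exact h.elim

end TransStep

/-! ### The translation as a whole: construction and finiteness. -/

/-- States of the translation: the part of the plain coderivation that is left to simulate, and
the present extended sequent. -/
abbrev TransState : Type :=
  {x : PlainCoderivation × (Constraint × List AFormula) //
    Annotates x.2 x.1.rootRule.concl ∧ x.1.AtomicIdent}

namespace TransState

theorem exists_rule (x : TransState) : ∃ ρ : ARule, ρ.concl = x.1.2 ∧ ρ.Valid ∧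
    TransStep x.1.1.rootRule ρ ∧ ∀ p ∈ ρ.prems, (∀ φ ∈ p.2, φ.NuOnly) := by
  refine exists_transStep x.1.1.rootRule_valid (fun Γ φ h => ?_) x.2.1
  refine x.2.2 [] Γ φ ?_
  rw [Coderivation.label_nil, h]

noncomputable def rule (x : TransState) : ARule := x.exists_rule.choose

theorem rule_concl (x : TransState) : x.rule.concl = x.1.2 := x.exists_rule.choose_spec.1

theorem rule_valid (x : TransState) : x.rule.Valid := x.exists_rule.choose_spec.2.1

theorem rule_step (x : TransState) : TransStep x.1.1.rootRule x.rule :=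
  x.exists_rule.choose_spec.2.2.1

theorem rule_nuOnly (x : TransState) : ∀ p ∈ x.rule.prems, (∀ φ ∈ p.2, φ.NuOnly) :=
  x.exists_rule.choose_spec.2.2.2

/-- The translation advances in the plain coderivation. -/
def Adv (x : TransState) : Prop := Advances x.1.1.rootRule x.rule

open Classical in
/-- The plain coderivation simulated after the step in the direction `b`. -/
noncomputable def nextPlain (x : TransState) (b : Bool) : PlainCoderivation :=
  if x.Adv then x.1.1.child b else x.1.1

theorem lt_of_adv {x : TransState} (h : x.Adv) {b : Bool}
    (hb : b.toNat < x.rule.prems.length) : b.toNat < x.1.1.rootRule.prems.length := by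
  rwa [← TransStep.prems_of_advances h, List.length_map]

theorem annotates_next {x : TransState} {b : Bool} {p : Constraint × List AFormula}
    (h : x.rule.prems[b.toNat]? = some p) :
    Annotates p (x.nextPlain b).rootRule.concl ∧ (x.nextPlain b).AtomicIdent := by
  have hp := List.mem_of_getElem? h
  refine ⟨⟨?_, x.rule_valid.2.1 p hp, x.rule_nuOnly p hp⟩, ?_⟩
  · unfold nextPlain
    split
    · rename_i hA
      refine (Coderivation.child_concl x.1.1 (p := p.2.map Fm.strip) ?_).symm
      change x.1.1.rootRule.prems[b.toNat]? = _
      rw [← TransStep.prems_of_advances hA, List.getElem?_map, h]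
      rfl
    · rename_i hA
      rw [x.rule_step.prems_of_not_advances hA p hp, x.rule_concl]
      exact x.2.1.strip
  · unfold nextPlain
    split
    · exact x.2.2.child b
    · exact x.2.2

open Classical in
noncomputable def next (x : TransState) (b : Bool) : TransState :=
  if h : b.toNat < x.rule.prems.length then
    ⟨(x.nextPlain b, x.rule.prems[b.toNat]), annotates_next (List.getElem?_eq_getElem h)⟩
  else x

theorem next_snd {x : TransState} {b : Bool} {p : Constraint × List AFormula}
    (h : x.rule.prems[b.toNat]? = some p) : (x.next b).1.2 = p := by
  obtain ⟨hb, rfl⟩ := List.getElem?_eq_some_iff.1 h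
  simp [next, hb]

theorem next_fst {x : TransState} {b : Bool} (h : b.toNat < x.rule.prems.length) :
    (x.next b).1.1 = x.nextPlain b := by
  simp [next, h]

end TransState

/-- The translation, presented by states. -/
noncomputable abbrev transCoalg : Coalg annSystem where
  St := TransState
  rule := TransState.rule
  next := TransState.next
  valid := TransState.rule_valid
  coh x b p h := by
    change (x.next b).rule.concl = p
    rw [TransState.rule_concl, TransState.next_snd h]

open Classical in
/-- The node of the plain coderivation that is simulated at an address. -/
noncomputable def simNode (x : TransState) : List Bool → List Bool
  | [] => []
  | b :: v => if x.Adv then b :: simNode (x.next b) v else simNode (x.next b) v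

open Classical in
theorem simNode_append {x y : TransState} {v : List Bool} (h : transCoalg.run x v = some y)
    (b : Bool) : simNode x (v ++ [b]) = simNode x v ++ if y.Adv then [b] else [] := by
  induction v generalizing x with
  | nil =>
    obtain rfl : x = y := Option.some.inj h
    simp [simNode]
  | cons c v ih =>
    simp only [Coalg.run] at h
    split at h
    · simp only [List.cons_append, simNode, ih h]
      split <;> simp
    · cases h

/-- The plain component of the state reached at `v` is the sub-coderivation at the simulated node;
with `w` empty this gives the simulated rule. -/
theorem simNode_label {x y : TransState} {v : List Bool} (h : transCoalg.run x v = some y)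
    (w : List Bool) : x.1.1.label (simNode x v ++ w) = y.1.1.label w := by
  induction v generalizing x with
  | nil =>
    obtain rfl : x = y := Option.some.inj h
    simp [simNode]
  | cons b v ih =>
    simp only [Coalg.run] at h
    split at h
    · rename_i hb
      have hb' : b.toNat < x.rule.prems.length := hb
      rw [← ih h]
      change _ = (x.next b).1.1.label _
      rw [TransState.next_fst hb']
      simp only [simNode, TransState.nextPlain]
      split
      · rename_i hA
        rw [Coderivation.child_label _ (TransState.lt_of_adv hA hb'), List.cons_append]
      · rfl
    · cases h

theorem transCoalg_isTranslation (x : TransState) :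
    IsTranslation x.1.1 (transCoalg.unfold x) := by
  classical
  refine ⟨simNode x, rfl, fun v ρ h => ?_⟩
  rw [Coalg.unfold_label, Option.map_eq_some_iff] at h
  obtain ⟨y, hy, rfl⟩ := h
  refine ⟨y.1.1.rootRule, ?_, ?_⟩
  · have := simNode_label hy []
    rw [List.append_nil] at this
    rw [this, Coderivation.label_nil]
  · have key := simNode_append hy
    by_cases hA : y.Adv
    · rcases y.rule_step with h1 | h1
      -- Resets and prunings are constraint weakenings, and these never advance.
      · rcases h1.2 with ⟨κ, O, Γ, h2, -⟩ | ⟨O, Γ, h2, -⟩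
        all_goals
          unfold TransState.Adv at hA
          rw [h2] at hA
          exact hA.elim
      · exact .inr ⟨h1.1, .inr ⟨hA, fun b => by rw [key, if_pos hA]⟩⟩
    · have h3 : simNode x (v ++ [false]) = simNode x v := by
        rw [key, if_neg hA, List.append_nil]
      rcases y.rule_step with h1 | ⟨h1, h2 | h2⟩
      · exact .inl ⟨h1.1, h1.2, h3⟩
      · exact .inr ⟨h1, .inl ⟨h2, h3⟩⟩
      · exact absurd h2 hA

/-- A cyclic `D` has finitely many sequents, so their sizes have a bound `M`. By `subset_range` all
variables stay below `2 * M + 1`, which leaves finitely many extended sequents for each of the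
finitely many sub-coderivations. -/
theorem exists_finite_states {D : PlainCoderivation} (hD : D.Cyclic) (x : TransState)
    (hx : x.1.1 = D) (hV : x.1.2.1.V = ∅) :
    ∃ T : Set TransState, T.Finite ∧ x ∈ T ∧
      ∀ y ∈ T, ∀ b : Bool, b.toNat < y.rule.prems.length → y.next b ∈ T := by
  have hS : (Coderivation.subs D).Finite := hD
  set G : Set (List Formula) := (fun E => E.rootRule.concl) '' Coderivation.subs D with hG
  have hGf : G.Finite := hS.image _
  obtain ⟨M, hM⟩ : ∃ M, ∀ Γ ∈ G, (Γ.map Fm.size).sum ≤ M := by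
    obtain ⟨M, hM⟩ := (hGf.image fun Γ => (Γ.map Fm.size).sum).bddAbove
    exact ⟨M, fun Γ hΓ => hM (Set.mem_image_of_mem _ hΓ)⟩
  refine ⟨{y | y.1.1 ∈ Coderivation.subs D ∧ y.1.2.1.V ⊆ Finset.range (2 * M + 1)}, ?_, ?_, ?_⟩
  · refine Set.Finite.of_finite_image
      ((hS.prod (finite_annotates hGf (2 * M + 1))).subset ?_) Subtype.val_injective.injOn
    rintro _ ⟨y, ⟨hy1, hy2⟩, rfl⟩
    exact ⟨hy1, _, Set.mem_image_of_mem _ hy1, y.2.1, hy2⟩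
  · refine ⟨hx ▸ Coderivation.self_mem_subs _, ?_⟩
    rw [hV]
    exact Finset.empty_subset _
  · rintro y ⟨hy1, hy2⟩ b hb
    refine ⟨?_, ?_⟩
    · rw [TransState.next_fst hb]
      unfold TransState.nextPlain
      split
      · exact Coderivation.child_mem_subs hy1 b
      · exact hy1
    · rw [TransState.next_snd (List.getElem?_eq_getElem hb)]
      refine y.rule_step.subset_range y.rule_valid ?_ ?_ _ (List.getElem_mem hb)
      · rw [y.rule_concl]
        have := hM _ (Set.mem_image_of_mem _ hy1)
        rw [← y.2.1.strip, List.map_map] at this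
        simpa [Function.comp_def, Fm.size_strip] using this
      · rw [y.rule_concl]
        exact hy2

theorem sequents_finite {T : Set TransState} (hT : T.Finite) {x : TransState} (hx : x ∈ T)
    (hcl : ∀ y ∈ T, ∀ b : Bool, b.toNat < y.rule.prems.length → y.next b ∈ T) :
    (transCoalg.unfold x).sequents.Finite := by
  refine (hT.image fun y => y.rule.concl).subset ?_
  rintro s ⟨u, ρ, h, rfl⟩
  rw [Coalg.unfold_label, Option.map_eq_some_iff] at h
  obtain ⟨y, hy, rfl⟩ := h
  exact ⟨y, transCoalg.run_mem hcl hx hy, rfl⟩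

/-! ### Descending chains of ordinal variables -/

/-- What happens in a step of a translation, as seen from a formula occurrence. -/
inductive Event : Type
  | silent
  | reset (κ : OrdVar)
  | unfold (b : FixKind) (n : ℕ)

instance : Inhabited Event := ⟨.silent⟩

/-- A step of constraints, with a distinguished variable that is kept or replaced by a new child. -/
inductive ChainStep (O : Constraint) (l : OrdVar) : Constraint → OrdVar → Event → Prop
  | same (e) : ChainStep O l O l e
  | add (k) (e) : k ∉ O.V → ChainStep O l (O.add k) l e
  | side (κ k) (e) : k ∉ O.V → ChainStep O l (O.addBelow κ k) l e
  | main (k) (e) : k ∉ O.V → ChainStep O l (O.addBelow l k) k e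
  | reset (κ) : l ∉ O.children κ → ChainStep O l (O.remove (O.children κ)) l (.reset κ)
  | prune (L) (e) : (∀ c, O.le l c → c ∉ L) → ChainStep O l (O.remove L) l e

namespace ChainStep

variable {O O' : Constraint} {l l' : OrdVar} {e : Event}

/-- A step relates fresh variables only upwards, and removal restricts the order; so nothing new
comes to lie above an old variable. -/
theorem lt_iff (h : ChainStep O l O' l' e) {a b : OrdVar} (ha : a ∈ O.V)
    (ha' : a ∈ O'.V) (hb' : b ∈ O'.V) : O'.lt a b ↔ O.lt a b := by
  cases h with
  | same => exact Iff.rfl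
  | add => exact Iff.rfl
  | side κ k _ hk =>
    exact ⟨fun h => h.resolve_right fun h' => hk (h'.1 ▸ ha), .inl⟩
  | main k _ hk =>
    exact ⟨fun h => h.resolve_right fun h' => hk (h'.1 ▸ ha), .inl⟩
  | reset κ => exact ⟨fun h => h.1, fun h => ⟨h, ha', hb'⟩⟩
  | prune L => exact ⟨fun h => h.1, fun h => ⟨h, ha', hb'⟩⟩

theorem mem_new (h : ChainStep O l O' l' e) (hl : l ∈ O.V) : l' ∈ O'.V := by
  cases h with
  | same => exact hl
  | add => exact Finset.mem_insert_of_mem hl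
  | side => exact Finset.mem_insert_of_mem hl
  | main => exact Finset.mem_insert_self _ _
  | reset κ h => exact Finset.mem_sdiff.2 ⟨hl, h⟩
  | prune L _ h => exact Finset.mem_sdiff.2 ⟨hl, h _ (.inr rfl)⟩

theorem le_new (h : ChainStep O l O' l' e) (hl : l ∈ O.V) {c : OrdVar} (hc : O.le l c)
    (hc' : c ∈ O'.V) : O'.le l' c := by
  have hl' := h.mem_new hl
  cases h with
  | same => exact hc
  | add => exact hc
  | side => exact hc.imp .inl id
  | main k _ hk => exact .inl (.inr ⟨rfl, hc⟩)
  | reset κ h => exact hc.imp (fun h => ⟨h, hl', hc'⟩) id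
  | prune L _ h => exact hc.imp (fun h => ⟨h, hl', hc'⟩) id

/-- Pruning spares everything above the distinguished variable, so a reset is the only way to lose
such a variable. -/
theorem exists_reset (h : ChainStep O l O' l' e) (hO : O.IsConstraint) (hl : l ∈ O.V)
    {c : OrdVar} (hc : O.le l c) (hc' : c ∉ O'.V) : ∃ κ, e = .reset κ ∧ c ∈ O.children κ := by
  have hcV : c ∈ O.V := by
    rcases hc with h | rfl
    · exact (hO.mem h).2
    · exact hl
  cases h with
  | same => exact absurd hcV hc'
  | add => exact absurd (Finset.mem_insert_of_mem hcV) hc'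
  | side => exact absurd (Finset.mem_insert_of_mem hcV) hc'
  | main => exact absurd (Finset.mem_insert_of_mem hcV) hc'
  | reset κ h =>
    refine ⟨κ, rfl, ?_⟩
    by_contra h'
    exact hc' (Finset.mem_sdiff.2 ⟨hcV, h'⟩)
  | prune L _ h => exact absurd (Finset.mem_sdiff.2 ⟨hcV, h c hc⟩) hc'

/-- By `lt_iff`, nothing is ever inserted between two old variables. -/
theorem child_new (h : ChainStep O l O' l' e) (hO : O.IsConstraint) {c κ : OrdVar}
    (hc : c ∈ O.children κ) (hc' : c ∈ O'.V) (hκ' : κ ∈ O'.V) : c ∈ O'.children κ := by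
  rw [Constraint.mem_children] at hc ⊢
  obtain ⟨h1, h2, h3⟩ := hc
  refine ⟨hc', (h.lt_iff h1 hc' hκ').2 h2, ?_⟩
  rintro ⟨ξ, hξ, h4, h5⟩
  have h4' := (h.lt_iff h1 hc' hξ).1 h4
  have hξV := (hO.mem h4').2
  exact h3 ⟨ξ, hξV, h4', (h.lt_iff hξV hξ hκ').1 h5⟩

end ChainStep

theorem Constraint.IsConstraint.le_mem {O : Constraint} (h : O.IsConstraint) {a b : OrdVar}
    (hab : O.le a b) (ha : a ∈ O.V) : b ∈ O.V := by
  rcases hab with h' | rfl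
  · exact (h.mem h').2
  · exact ha

/-- The combinatorial core. The stable reset variable is a lowest one among those that eventually
stay above the chain `l`: if its resets stopped, a child of it would stay above the chain too. -/
theorem exists_stable_reset {O : ℕ → Constraint} {l : ℕ → OrdVar} {e : ℕ → Event} {B : ℕ}
    (hO : ∀ i, (O i).IsConstraint) (hB : ∀ i, (O i).V ⊆ Finset.range B)
    (h0 : l 0 ∈ (O 0).V) (hs : ∀ i, ChainStep (O i) (l i) (O (i + 1)) (l (i + 1)) (e i))
    (hnew : ∀ N, ∃ i ≥ N, l (i + 1) ∉ (O i).V) :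
    ∃ κ, (∃ N, ∀ i ≥ N, κ ∈ (O i).V) ∧ ∀ N, ∃ i ≥ N, e i = .reset κ := by
  classical
  have hl : ∀ i, l i ∈ (O i).V := fun i => by
    induction i with
    | zero => exact h0
    | succ i ih => exact (hs i).mem_new ih
  -- variables that stay above the distinguished one
  let P : OrdVar → Prop := fun κ => ∃ N, ∀ i ≥ N, (O i).le (l i) κ
  have hmem : ∀ {i κ}, (O i).le (l i) κ → κ ∈ (O i).V := fun {i κ} h => (hO i).le_mem h (hl i)
  obtain ⟨t, ht⟩ : ∃ t, P t := by
    obtain ⟨t, ht, hmax⟩ := Finset.exists_not_rel (O 0).lt (hO 0).irrefl (hO 0).trans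
      (T := (O 0).V.filter fun t => (O 0).le (l 0) t)
      ⟨l 0, by rw [Finset.mem_filter]; exact ⟨h0, .inr rfl⟩⟩
    rw [Finset.mem_filter] at ht
    -- A maximal variable above the chain is nobody's child, so no reset removes it, and it remains
    -- maximal.
    have htop : ∀ i, (O i).le (l i) t ∧ ∀ c, ¬ (O i).lt t c := by
      intro i
      induction i with
      | zero =>
        refine ⟨ht.2, fun c hc => hmax c (Finset.mem_filter.2 ⟨((hO 0).mem hc).2, ?_⟩) hc⟩
        rcases ht.2 with h | h
        · exact .inl ((hO 0).trans h hc)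
        · exact .inl (h ▸ hc)
      | succ i ih =>
        have ht' : t ∈ (O (i + 1)).V := by
          by_contra hc
          obtain ⟨κ, -, hκ⟩ := (hs i).exists_reset (hO i) (hl i) ih.1 hc
          exact ih.2 κ (Constraint.mem_children.1 hκ).2.1
        refine ⟨(hs i).le_new (hl i) ih.1 ht', fun c hc => ih.2 c ?_⟩
        exact ((hs i).lt_iff (hmem ih.1) ht' ((hO (i + 1)).mem hc).2).1 hc
    exact ⟨t, 0, fun i _ => (htop i).1⟩
  have hPB : ∀ κ, P κ → κ ∈ Finset.range B := fun κ ⟨N, h⟩ => hB N (hmem (h N le_rfl))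
  -- All variables lie below `B`, so finitely many satisfy `P` and one stage `N` serves them all.
  obtain ⟨N, hN⟩ : ∃ N, ∀ κ, P κ → ∀ i ≥ N, (O i).le (l i) κ := by
    choose! f hf using fun κ (h : P κ) => h
    refine ⟨(Finset.range B).sup f, fun κ hκ i hi => hf κ hκ i (le_trans ?_ hi)⟩
    exact Finset.le_sup (f := f) (hPB κ hκ)
  obtain ⟨κ, hκ, hmin⟩ := Finset.exists_not_rel (fun a b => (O N).lt b a) (hO N).irrefl
    (fun h1 h2 => (hO N).trans h2 h1) (T := (Finset.range B).filter P)
    ⟨t, Finset.mem_filter.2 ⟨hPB t ht, ht⟩⟩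
  rw [Finset.mem_filter] at hκ
  have hκ' := hN κ hκ.2
  refine ⟨κ, ⟨N, fun i hi => hmem (hκ' i hi)⟩, ?_⟩
  by_contra hc
  push Not at hc
  obtain ⟨N', hN'⟩ := hc
  obtain ⟨j, hj, hnj⟩ := hnew (max N N')
  have hjN : N ≤ j := (le_max_left _ _).trans hj
  -- At stage `j` the chain moves to a variable that is new, whereas `κ` is present at that stage;
  -- so the two differ.
  have hlt : (O (j + 1)).lt (l (j + 1)) κ := by
    rcases hκ' (j + 1) (by omega) with h | h
    · exact h
    · exact absurd (hmem (hκ' j hjN)) (h ▸ hnj)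
  obtain ⟨c, hc, hlc⟩ := (hO _).exists_child hlt
  -- Parents are unique, so only a reset of `κ` could remove its child `c`, and there are none after
  -- `N'`.
  have key : ∀ i ≥ j + 1, c ∈ (O i).children κ ∧ (O i).le (l i) c := by
    intro i hi
    induction i, hi using Nat.le_induction with
    | base => exact ⟨hc, hlc⟩
    | succ i hi ih =>
      have hcV : c ∈ (O (i + 1)).V := by
        by_contra h
        obtain ⟨κ', h1, h2⟩ := (hs i).exists_reset (hO i) (hl i) ih.2 h
        obtain rfl := (hO i).parent_unique ih.1 h2
        exact hN' i (by have := le_max_right N N'; omega) h1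
      exact ⟨(hs i).child_new (hO i) ih.1 hcV (hmem (hκ' _ (by omega))),
        (hs i).le_new (hl i) ih.2 hcV⟩
  have hPc : P c := ⟨j + 1, fun i hi => (key i hi).2⟩
  -- By the choice of `N`, both `c` and `κ` are present from stage `N` on, so the order between them
  -- does not change and can be compared with the minimality of `κ` at `N`.
  have hlast : ∀ i ≥ N, (O i).lt c κ ↔ (O N).lt c κ := by
    intro i hi
    induction i, hi using Nat.le_induction with
    | base => exact Iff.rfl
    | succ i hi ih =>
      rw [← ih]
      exact (hs i).lt_iff (hmem (hN c hPc i hi)) (hmem (hN c hPc _ (by omega)))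
        (hmem (hκ' _ (by omega)))
  refine hmin c (Finset.mem_filter.2 ⟨hPB c hPc, hPc⟩) ?_
  exact (hlast (j + 1) (by omega)).1 (Constraint.mem_children.1 hc).2.1

/-! ### Traces through annotated formulas -/

namespace Fm

variable {P : Type}

/-- All free set variables have an index below `k`. -/
def SetClosed : ℕ → Fm P → Prop
  | k, mem _ X => X < k
  | k, fix _ _ φ _ => φ.SetClosed (k + 1)
  | k, and φ ψ => φ.SetClosed k ∧ ψ.SetClosed k
  | k, or φ ψ => φ.SetClosed k ∧ ψ.SetClosed k
  | k, all φ => φ.SetClosed k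
  | k, ex φ => φ.SetClosed k
  | _, _ => True

theorem Scoped.setClosed {m n : ℕ} {φ : Fm P} (h : φ.Scoped m n) : φ.SetClosed m := by
  induction φ generalizing m n with
  | fix b a φ t ih => exact ih h.1
  | and φ ψ ih₁ ih₂ | or φ ψ ih₁ ih₂ => exact ⟨ih₁ h.1, ih₂ h.2⟩
  | all φ ih | ex φ ih => exact ih (n := n + 1) h
  | mem t X => exact h.2
  | _ => trivial

theorem SetClosed.mono {j k : ℕ} {φ : Fm P} (h : φ.SetClosed j) (hjk : j ≤ k) :
    φ.SetClosed k := by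
  induction φ generalizing j k with
  | fix b a φ t ih => exact ih h (Nat.succ_le_succ hjk)
  | and φ ψ ih₁ ih₂ | or φ ψ ih₁ ih₂ => exact ⟨ih₁ h.1 hjk, ih₂ h.2 hjk⟩
  | all φ ih | ex φ ih => exact ih h hjk
  | mem t X => exact lt_of_lt_of_le h hjk
  | _ => trivial

theorem instSet_of_setClosed {b : FixKind} {a : Option P} {χ : Fm P} {k : ℕ} {φ : Fm P}
    (h : φ.SetClosed k) : instSet b a χ k φ = φ := by
  induction φ generalizing k with
  | mem t X => simp [instSet, (show X < k from h).ne]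
  | _ => simp_all [instSet, SetClosed]

theorem setClosed_inst (m k : ℕ) (u : Tm) (φ : Fm P) :
    (φ.inst k u).SetClosed m ↔ φ.SetClosed m := by
  induction φ generalizing m k <;> simp_all [inst, SetClosed]

theorem setClosed_subst (m : ℕ) (θ : ℕ → Tm) (φ : Fm P) :
    (φ.subst θ).SetClosed m ↔ φ.SetClosed m := by
  induction φ generalizing m <;> simp_all [subst, SetClosed]

theorem size_inst (k : ℕ) (u : Tm) (φ : Fm P) : (φ.inst k u).size = φ.size := by
  induction φ generalizing k <;> simp_all [inst, size]

theorem size_subst (θ : ℕ → Tm) (φ : Fm P) : (φ.subst θ).size = φ.size := by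
  induction φ <;> simp_all [subst, size]

/-- Every subformula without free set variables contains `l` or has fewer than `n + 5` symbols,
and the annotation `l` only occurs in set terms `fix b (some l) φ` with `φ` of size `n` and without free set
variables. -/
def Guarded (l : P) (n : ℕ) : Fm P → Prop
  | fix b a φ t => ((fix b a φ t).SetClosed 0 → (fix b a φ t).HasAnn l ∨ φ.size < n) ∧
      (a = some l → φ.size = n ∧ φ.SetClosed 1) ∧ φ.Guarded l n
  | and φ ψ => ((and φ ψ).SetClosed 0 → (and φ ψ).HasAnn l ∨ (and φ ψ).size < n + 5) ∧
      φ.Guarded l n ∧ ψ.Guarded l n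
  | or φ ψ => ((or φ ψ).SetClosed 0 → (or φ ψ).HasAnn l ∨ (or φ ψ).size < n + 5) ∧
      φ.Guarded l n ∧ ψ.Guarded l n
  | all φ => ((all φ).SetClosed 0 → (all φ).HasAnn l ∨ (all φ).size < n + 5) ∧ φ.Guarded l n
  | ex φ => ((ex φ).SetClosed 0 → (ex φ).HasAnn l ∨ (ex φ).size < n + 5) ∧ φ.Guarded l n
  | _ => True

variable {l : P} {n : ℕ}

theorem Guarded.hasAnn_or {φ : Fm P} (h : φ.Guarded l n) (hc : φ.SetClosed 0) :
    φ.HasAnn l ∨ φ.size < n + 5 := by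
  cases φ with
  | fix b a φ t => exact (h.1 hc).imp_right fun h => by simp only [size]; omega
  | and | or | all | ex => exact h.1 hc
  | _ => right; simp only [size]; omega

/-- The variable `l` sits on a set term with a body of size `n`, and that term is part of `φ`. -/
theorem Guarded.le_size {φ : Fm P} (h : φ.Guarded l n) (hl : φ.HasAnn l) : n + 5 ≤ φ.size := by
  induction φ with
  | fix b a φ t ih =>
    rcases hl with hl | hl
    · simp [size, (h.2.1 hl).1]
    · have := ih h.2.2 hl
      simp only [size]
      omega
  | and φ ψ ih₁ ih₂ | or φ ψ ih₁ ih₂ =>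
    rcases hl with hl | hl
    · have := ih₁ h.2.1 hl
      simp only [size]
      omega
    · have := ih₂ h.2.2 hl
      simp only [size]
      omega
  | all φ ih | ex φ ih =>
    have := ih h.2 hl
    simp only [size]
    omega
  | _ => exact hl.elim

theorem guarded_inst (k : ℕ) (u : Tm) (φ : Fm P) :
    (φ.inst k u).Guarded l n ↔ φ.Guarded l n := by
  induction φ generalizing k <;>
    simp_all [inst, Guarded, SetClosed, HasAnn, size, setClosed_inst, hasAnn_inst, size_inst]

theorem guarded_subst (θ : ℕ → Tm) (φ : Fm P) : (φ.subst θ).Guarded l n ↔ φ.Guarded l n := by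
  induction φ <;>
    simp_all [subst, Guarded, SetClosed, HasAnn, size, setClosed_subst, hasAnn_subst, size_subst]

theorem guarded_of_size_le {φ : Fm P} (h : φ.size ≤ n) (hl : ¬ φ.HasAnn l) : φ.Guarded l n := by
  induction φ with
  | fix b a φ t ih =>
    simp only [size] at h
    exact ⟨fun _ => .inr (by omega), fun ha => absurd (.inl ha) hl,
      ih (by omega) fun h' => hl (.inr h')⟩
  | and φ ψ ih₁ ih₂ | or φ ψ ih₁ ih₂ =>
    refine ⟨fun _ => .inr (by omega), ?_⟩
    simp only [size] at h
    exact ⟨ih₁ (by omega) fun h' => hl (.inl h'), ih₂ (by omega) fun h' => hl (.inr h')⟩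
  | all φ ih | ex φ ih =>
    refine ⟨fun _ => .inr (by omega), ?_⟩
    simp only [size] at h
    exact ih (by omega) hl
  | _ => trivial

/-- If the set variable occurs in `φ`, then every copy of the inserted set term brings in `l`. -/
theorem instSet_eq_or_hasAnn {b : FixKind} {a : Option P} {χ : Fm P}
    (h : a = some l ∨ χ.HasAnn l) (k : ℕ) (φ : Fm P) :
    instSet b a χ k φ = φ ∨ (instSet b a χ k φ).HasAnn l := by
  induction φ generalizing k with
  | mem t X =>
    by_cases hX : X = k
    · simp [instSet, hX, HasAnn, h]
    · simp [instSet, hX]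
  | fix b' a' φ t ih =>
    rcases ih (k + 1) with h | h
    · simp [instSet, h]
    · exact .inr (.inr h)
  | and φ ψ ih₁ ih₂ | or φ ψ ih₁ ih₂ =>
    rcases ih₁ k with h₁ | h₁
    · rcases ih₂ k with h₂ | h₂
      · simp [instSet, h₁, h₂]
      · exact .inr (.inr h₂)
    · exact .inr (.inl h₁)
  | all φ ih | ex φ ih =>
    rcases ih k with h | h
    · simp [instSet, h]
    · exact .inr h
  | _ => exact .inl rfl

/-- Substitution leaves a subformula unchanged, or else puts `l` into it; in both cases it is
guarded. -/
theorem Guarded.instSet {b : FixKind} {a : Option P} {χ : Fm P}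
    (h : a = some l ∨ χ.HasAnn l) (ha : a = some l → χ.size = n ∧ χ.SetClosed 1) (hχ : χ.Guarded l n) (k : ℕ)
    {φ : Fm P} (hφ : φ.Guarded l n) : (instSet b a χ k φ).Guarded l n := by
  have key := fun (k : ℕ) (φ : Fm P) => instSet_eq_or_hasAnn (b := b) h k φ
  induction φ generalizing k with
  | mem t X =>
    by_cases hX : X = k
    · simp only [Fm.instSet, hX, if_true]
      exact ⟨fun _ => .inl h, ha, hχ⟩
    · simp [Fm.instSet, hX, Guarded]
  | fix b' a' φ t ih =>
    refine ⟨fun hc => ?_, fun ha' => ?_, ih (k + 1) hφ.2.2⟩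
    · rcases key k (fix b' a' φ t) with h' | h'
      · simp only [Fm.instSet, fix.injEq, true_and, and_true] at h'
        rw [h'] at hc ⊢
        exact hφ.1 hc
      · exact .inl h'
    -- The body of a term marked by `l` has only its own set variable free, so the substitution does
    -- not touch it and its size remains `n`.
    · rw [instSet_of_setClosed ((hφ.2.1 ha').2.mono (by omega))]
      exact hφ.2.1 ha'
  | and φ ψ ih₁ ih₂ | or φ ψ ih₁ ih₂ =>
    refine ⟨fun hc => ?_, ih₁ k hφ.2.1, ih₂ k hφ.2.2⟩
    rcases key k (and φ ψ) with h' | h'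
    · simp only [Fm.instSet, and.injEq] at h'
      rw [h'.1, h'.2] at hc ⊢
      exact hφ.1 hc
    · exact .inl h'
  | all φ ih | ex φ ih =>
    refine ⟨fun hc => ?_, ih k hφ.2⟩
    rcases key k φ with h' | h'
    · rw [h'] at hc ⊢
      exact hφ.1 hc
    · exact .inl h'
  | _ => trivial

/-- The mark sits inside the body, so every inserted copy of the set term still carries it. -/
theorem Guarded.unfold_same {b : FixKind} {a : Option P} {φ : Fm P} {t : Tm}
    (h : (fix b a φ t).Guarded l n) (hl : φ.HasAnn l) (a' : Option P)
    (ha' : a' ≠ some l) : (unfold b a' φ t).Guarded l n :=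
  (guarded_inst _ _ _).2
    (h.2.2.instSet (.inr hl) (fun h' => absurd h' ha') 0 h.2.2)

/-- This is how a mark is created, or replaced by a child: what the unfolding inserts is marked by
`l`, and the rest is no larger than the body, thus below `n + 5`. -/
theorem guarded_unfold_new {b : FixKind} {φ : Fm P} {t : Tm} (hn : φ.size = n)
    (hc : φ.SetClosed 1) (hl : ¬ φ.HasAnn l) : (unfold b (some l) φ t).Guarded l n :=
  (guarded_inst _ _ _).2
    ((guarded_of_size_le hn.le hl).instSet (.inl rfl) (fun _ => ⟨hn, hc⟩) 0
      (guarded_of_size_le hn.le hl))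

end Fm

/-- The steps from a formula to an immediate ancestor that do not unfold a fixed point. -/
inductive FormulaStep : AFormula → AFormula → Prop
  | refl (φ) : FormulaStep φ φ
  | subst (θ) (φ : AFormula) : FormulaStep (φ.subst θ) φ
  | subst_subst (θ θ') (φ : AFormula) : FormulaStep (φ.subst θ) (φ.subst θ')
  | and_left (φ ψ) : FormulaStep (.and φ ψ) φ
  | and_right (φ ψ) : FormulaStep (.and φ ψ) ψ
  | or_left (φ ψ) : FormulaStep (.or φ ψ) φ
  | or_right (φ ψ) : FormulaStep (.or φ ψ) ψ
  | all (φ : AFormula) (u) : FormulaStep (.all φ) (φ.inst 0 u)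
  | ex (φ : AFormula) (u) : FormulaStep (.ex φ) (φ.inst 0 u)

namespace FormulaStep

variable {φ ψ : AFormula}

theorem size_le (h : FormulaStep φ ψ) : ψ.size ≤ φ.size := by
  cases h <;> simp only [Fm.size_subst, Fm.size_inst, Fm.size, le_refl] <;> omega

theorem guarded (h : FormulaStep φ ψ) {l : OrdVar} {n : ℕ} (hφ : φ.Guarded l n) :
    ψ.Guarded l n := by
  cases h with
  | refl => exact hφ
  | subst θ => exact (Fm.guarded_subst θ _).1 hφ
  | subst_subst θ θ' => exact (Fm.guarded_subst θ' _).2 ((Fm.guarded_subst θ _).1 hφ)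
  | and_left => exact hφ.2.1
  | and_right => exact hφ.2.2
  | or_left => exact hφ.2.1
  | or_right => exact hφ.2.2
  | all => exact (Fm.guarded_inst _ _ _).2 hφ.2
  | ex => exact (Fm.guarded_inst _ _ _).2 hφ.2

end FormulaStep

/-- A step of a translation, as seen from a formula occurrence. -/
inductive TraceStep (O : Constraint) (Γ : List AFormula) :
    AFormula → Constraint → AFormula → Event → Prop
  | reset (κ ψ) : (∀ l ∈ O.children κ, ¬ Constraint.OccursIn l Γ) →
      TraceStep O Γ ψ (O.remove (O.children κ)) ψ (.reset κ)
  | prune (ψ) : TraceStep O Γ ψ (O.remove (O.prunable Γ)) ψ .silent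
  | nuSide (l ψ) : l ∉ O.V → TraceStep O Γ ψ (O.add l) ψ .silent
  | nuMain (l φ t) : l ∉ O.V →
      TraceStep O Γ (.fix .nu none φ t) (O.add l) (.fix .nu (some l) φ t) .silent
  | logic (ψ ψ') : FormulaStep ψ ψ' → TraceStep O Γ ψ O ψ' .silent
  | mu (φ t) : TraceStep O Γ (.fix .mu none φ t) O (Fm.unfold .mu none φ t) (.unfold .mu φ.size)
  | annSide (κ l ψ) : l ∉ O.V → TraceStep O Γ ψ (O.addBelow κ l) ψ .silent
  | annMain (κ l φ t) : l ∉ O.V → TraceStep O Γ (.fix .nu (some κ) φ t) (O.addBelow κ l)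
      (Fm.unfold .nu (some l) φ t) (.unfold .nu φ.size)

namespace TraceStep

variable {O O' : Constraint} {Γ : List AFormula} {ψ ψ' : AFormula} {e : Event} {n : ℕ}

/-- Unfolding a body of size at least `n` takes a formula of size at least `n + 5`, and the other
steps do not increase the size. So a trace that falls below `n + 5` never unfolds again. -/
theorem size_lt (h : TraceStep O Γ ψ O' ψ' e) (he : ∀ b k, e = .unfold b k → n ≤ k)
    (hψ : ψ.size < n + 5) : ψ'.size < n + 5 ∧ ∀ b k, e ≠ .unfold b k := by
  cases h with
  | logic _ _ h => exact ⟨h.size_le.trans_lt hψ, by simp⟩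
  | mu φ t =>
    have := he _ _ rfl
    simp only [Fm.size] at hψ
    omega
  | annMain κ l φ t =>
    have := he _ _ rfl
    simp only [Fm.size] at hψ
    omega
  | _ => exact ⟨hψ, by simp⟩

/-- The mark `l` occurs in the sequent, so resets and prunings do not remove it. It is handed on to
a child exactly when the term marked by `l` itself is unfolded, and no other `ν`-term with a body of
size `n` can be unfolded here. -/
theorem exists_chainStep (h : TraceStep O Γ ψ O' ψ' e) (hO : O.IsExtSequent Γ) (hΓ : ψ ∈ Γ)
    {l : OrdVar} (hg : ψ.Guarded l n) (hl : ψ.HasAnn l) :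
    ∃ l', ψ'.Guarded l' n ∧ ChainStep O l O' l' e ∧ (e = .unfold .nu n → l' ∉ O.V) := by
  have hocc : Constraint.OccursIn l Γ := ⟨ψ, hΓ, hl⟩
  have hlV : l ∈ O.V := hO.2.2 l hocc
  cases h with
  | reset κ _ h => exact ⟨l, hg, .reset κ fun h' => h l h' hocc, by simp⟩
  | prune =>
    refine ⟨l, hg, .prune _ _ fun c hc hc' => ?_, by simp⟩
    exact (Constraint.mem_prunable.1 hc').2 l hlV hc hocc
  | nuSide k _ hk => exact ⟨l, hg, .add k _ hk, by simp⟩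
  | nuMain k φ t hk =>
    have hkl : some k ≠ some l := fun h => hk (Option.some.inj h ▸ hlV)
    have hl' : φ.HasAnn l := by simpa [Fm.HasAnn] using hl
    exact ⟨l, ⟨fun _ => .inl (.inr hl'), fun h => absurd h hkl, hg.2.2⟩, .add k _ hk, by simp⟩
  | logic _ _ h => exact ⟨l, h.guarded hg, .same _, by simp⟩
  | mu φ t =>
    have hl' : φ.HasAnn l := by simpa [Fm.HasAnn] using hl
    exact ⟨l, hg.unfold_same hl' _ (by simp), .same _, by simp⟩
  | annSide κ k _ hk => exact ⟨l, hg, .side κ k _ hk, by simp⟩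
  | annMain κ k φ t hk =>
    by_cases hκ : κ = l
    · subst hκ
      refine ⟨k, Fm.guarded_unfold_new (hg.2.1 rfl).1 (hg.2.1 rfl).2 fun h => hk ?_,
        .main k _ hk, fun _ => hk⟩
      exact hO.2.2 k ⟨_, hΓ, .inr h⟩
    · have hl' : φ.HasAnn l := by simpa [Fm.HasAnn, hκ] using hl
      have hkl : some k ≠ some l := fun h => hk (Option.some.inj h ▸ hlV)
      refine ⟨l, hg.unfold_same hl' _ hkl, .side κ k _ hk, fun he => ?_⟩
      -- If another variable is unfolded, `l` lies inside the body; the body then has at least `n +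
      -- 5` symbols and the event is not one of size `n`.
      have := hg.2.2.le_size hl'
      simp only [Event.unfold.injEq, true_and] at he
      omega

end TraceStep

/-- A branch of a translation with a progressing trace has a stable reset variable. -/
theorem exists_stable_reset_of_trace {O : ℕ → Constraint} {Γ : ℕ → List AFormula}
    {ψ : ℕ → AFormula} {e : ℕ → Event} {B n : ℕ}
    (hB : ∀ i, (O i).V ⊆ Finset.range B) (hO : ∀ i, (O i).IsExtSequent (Γ i))
    (hψ : ∀ i, ψ i ∈ Γ i) (hs : ∀ i, TraceStep (O i) (Γ i) (ψ i) (O (i + 1)) (ψ (i + 1)) (e i))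
    (hmin : ∀ i b k, e i = .unfold b k → n ≤ k) (hinf : ∀ N, ∃ i ≥ N, e i = .unfold .nu n) :
    ∃ κ, (∃ N, ∀ i ≥ N, κ ∈ (O i).V) ∧ ∀ N, ∃ i ≥ N, e i = .reset κ := by
  -- A closed guarded formula without the mark is smaller than `n + 5`. By `size_lt` the trace would
  -- then unfold nothing any more, contrary to `hinf`.
  have hann : ∀ i l, (ψ i).Guarded l n → (ψ i).HasAnn l := by
    intro i l hg
    by_contra hl
    have h1 := (hg.hasAnn_or ((hO i).2.1 _ (hψ i)).setClosed).resolve_left hl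
    have h2 : ∀ j ≥ i, (ψ j).size < n + 5 := by
      intro j hj
      induction j, hj using Nat.le_induction with
      | base => exact h1
      | succ j hj ih => exact ((hs j).size_lt (hmin j) ih).1
    obtain ⟨j, hj, hj'⟩ := hinf i
    exact ((hs j).size_lt (hmin j) (h2 j hj)).2 _ _ hj'
  obtain ⟨i₀, -, hi₀⟩ := hinf 0
  -- The first unfolding of size `n` puts the first mark.
  obtain ⟨l₀, hl₀⟩ : ∃ l, (ψ (i₀ + 1)).Guarded l n := by
    have h := hs i₀
    have h' := hψ i₀
    generalize ψ i₀ = φ at h h'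
    generalize ψ (i₀ + 1) = φ' at h ⊢
    rw [hi₀] at h
    generalize O (i₀ + 1) = O' at h
    cases h with
    | annMain κ k φ t hk =>
      refine ⟨k, Fm.guarded_unfold_new rfl ?_ fun h => hk ?_⟩
      · exact ((hO i₀).2.1 _ h').setClosed
      · exact (hO i₀).2.2 k ⟨_, h', .inr h⟩
  have step : ∀ i l, (ψ i).Guarded l n → ∃ l', (ψ (i + 1)).Guarded l' n ∧
      ChainStep (O i) l (O (i + 1)) l' (e i) ∧ (e i = .unfold .nu n → l' ∉ (O i).V) :=
    fun i l hg => (hs i).exists_chainStep (hO i) (hψ i) hg (hann i l hg)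
  choose! f hf using step
  let l : ℕ → OrdVar := fun i => Nat.rec l₀ (fun i l => f (i₀ + 1 + i) l) i
  have hl : ∀ i, (ψ (i₀ + 1 + i)).Guarded (l i) n := by
    intro i
    induction i with
    | zero => exact hl₀
    | succ i ih => exact (hf _ _ ih).1
  obtain ⟨κ, ⟨N, hN⟩, hκ⟩ := exists_stable_reset (O := fun i => O (i₀ + 1 + i)) (l := l)
    (e := fun i => e (i₀ + 1 + i)) (fun i => (hO _).1) (fun i => hB _)
    ((hO _).2.2 _ ⟨_, hψ _, hann _ _ (hl 0)⟩) (fun i => (hf _ _ (hl i)).2.1) (fun N => by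
      obtain ⟨j, hj, hj'⟩ := hinf (i₀ + 1 + N)
      obtain ⟨i, rfl⟩ := Nat.exists_eq_add_of_le (show i₀ + 1 ≤ j by omega)
      exact ⟨i, by omega, (hf _ _ (hl i)).2.2 hj'⟩)
  refine ⟨κ, ⟨i₀ + 1 + N, fun i hi => ?_⟩, fun N => ?_⟩
  · obtain ⟨j, rfl⟩ := Nat.exists_eq_add_of_le (show i₀ + 1 ≤ i by omega)
    exact hN j (by omega)
  · obtain ⟨i, hi, hi'⟩ := hκ N
    exact ⟨i₀ + 1 + i, by omega, hi'⟩

/-! ### Transferring traces from the plain proof to its translation. -/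

theorem List.getElem?_concat_of_le {α : Type*} {l : List α} {a b : α} {p : ℕ}
    (h : (l ++ [a])[p]? = some b) : (p < l.length ∧ l[p]? = some b) ∨ (p = l.length ∧ a = b) := by
  grind

/-- The formula of the premise that the trace passes to. -/
theorem LRule.exists_ancestor {ρ : LRule OrdVar} {p q : ℕ} (h : ρ.Anc p q) {ψ : AFormula}
    (hψ : ρ.concl[p]? = some ψ) {Δ : List AFormula} (hΔ : Δ ∈ ρ.prems) :
    ∃ ψ', Δ[q]? = some ψ' ∧ (FormulaStep ψ ψ' ∨
      ∃ Γ φ t, ρ = .mu Γ φ t ∧ p = Γ.length ∧ ψ = .fix .mu none φ t ∧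
        ψ' = Fm.unfold .mu none φ t) := by
  cases ρ with
  | ident | eqRefl | pa | nat => exact h.elim
  | wk Γ Ξ =>
    obtain rfl := List.mem_singleton.1 hΔ
    obtain ⟨rfl, h⟩ := h
    exact ⟨ψ, by simp only [concl] at hψ; grind, .inl (.refl _)⟩
  | exch Γ φ φ' Ξ =>
    obtain rfl := List.mem_singleton.1 hΔ
    simp only [concl] at hψ
    refine ⟨ψ, ?_, .inl (.refl _)⟩
    rcases h with ⟨rfl, rfl⟩ | ⟨rfl, rfl⟩ | ⟨rfl, h | h⟩
    · grind
    · grind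
    · grind
    · rw [List.getElem?_append_right (by omega)] at hψ ⊢
      obtain ⟨k, rfl⟩ := Nat.exists_eq_add_of_le (show Γ.length + 2 ≤ p by omega)
      rw [show Γ.length + 2 + k - Γ.length = k + 2 by omega] at hψ ⊢
      simpa using hψ
  | sub θ Γ =>
    obtain rfl := List.mem_singleton.1 hΔ
    obtain ⟨rfl, h⟩ := h
    simp only [concl, List.getElem?_map, Option.map_eq_some_iff] at hψ
    obtain ⟨φ, hφ, rfl⟩ := hψ
    exact ⟨φ, hφ, .inl (.subst _ _)⟩
  | cut Γ φ =>
    obtain ⟨rfl, h⟩ := h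
    simp only [prems, concl, List.mem_cons, List.not_mem_nil, or_false] at hΔ hψ
    refine ⟨ψ, ?_, .inl (.refl _)⟩
    rcases hΔ with rfl | rfl <;> grind
  | and Γ φ φ' =>
    obtain ⟨rfl, h⟩ := h
    simp only [prems, concl, List.mem_cons, List.not_mem_nil, or_false] at hΔ hψ
    rcases List.getElem?_concat_of_le hψ with ⟨h1, h2⟩ | ⟨rfl, rfl⟩
    · exact ⟨ψ, by rcases hΔ with rfl | rfl <;> grind, .inl (.refl _)⟩
    · rcases hΔ with rfl | rfl
      · exact ⟨φ, by simp, .inl (.and_left _ _)⟩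
      · exact ⟨φ', by simp, .inl (.and_right _ _)⟩
  | or Γ φ φ' =>
    obtain rfl := List.mem_singleton.1 hΔ
    simp only [concl] at hψ
    rcases List.getElem?_concat_of_le hψ with ⟨h1, h2⟩ | ⟨rfl, rfl⟩
    · refine ⟨ψ, ?_, .inl (.refl _)⟩
      rcases h with ⟨rfl, h⟩ | ⟨rfl, h⟩ <;> grind
    · rcases h with ⟨rfl, h⟩ | ⟨-, rfl⟩
      · exact ⟨φ, by simp, .inl (.or_left _ _)⟩
      · exact ⟨φ', by simp, .inl (.or_right _ _)⟩
  | all Γ φ y =>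
    obtain rfl := List.mem_singleton.1 hΔ
    obtain ⟨rfl, h⟩ := h
    rcases List.getElem?_concat_of_le hψ with ⟨h1, h2⟩ | ⟨rfl, rfl⟩
    · exact ⟨ψ, by grind, .inl (.refl _)⟩
    · exact ⟨_, by simp; rfl, .inl (.all _ _)⟩
  | ex Γ φ t =>
    obtain rfl := List.mem_singleton.1 hΔ
    obtain ⟨rfl, h⟩ := h
    rcases List.getElem?_concat_of_le hψ with ⟨h1, h2⟩ | ⟨rfl, rfl⟩
    · exact ⟨ψ, by grind, .inl (.refl _)⟩
    · exact ⟨_, by simp; rfl, .inl (.ex _ _)⟩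
  | eqSub Γ x s t =>
    obtain rfl := List.mem_singleton.1 hΔ
    obtain ⟨rfl, h⟩ := h
    rcases List.getElem?_concat_of_le hψ with ⟨h1, h2⟩ | ⟨rfl, rfl⟩
    · simp only [List.getElem?_map, Option.map_eq_some_iff] at h2 ⊢
      obtain ⟨φ, hφ, rfl⟩ := h2
      exact ⟨_, ⟨φ, hφ, rfl⟩, .inl (.subst_subst _ _ _)⟩
    · simp at h
  | mu Γ φ t =>
    obtain rfl := List.mem_singleton.1 hΔ
    obtain ⟨rfl, h⟩ := h
    rcases List.getElem?_concat_of_le hψ with ⟨h1, h2⟩ | ⟨rfl, rfl⟩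
    · exact ⟨ψ, by grind, .inl (.refl _)⟩
    · exact ⟨_, by simp, .inr ⟨Γ, φ, t, rfl, rfl, rfl, rfl⟩⟩

/-- Positions in the annotated and the plain sequent coincide, so a step of the plain trace
determines a step between annotated formulas. The event records what the chain argument needs to
know about the rule: resets, and unfoldings along the trace with the size of the body. -/
theorem exists_traceStep {r : PRule} {ρ : ARule} (hρ : ρ.Valid) (h : TransStep r ρ) {p q : ℕ}
    (hadv : Advances r ρ → r.Anc p q) (hnadv : ¬ Advances r ρ → q = p) {ψ : AFormula}
    (hψ : ρ.concl.2[p]? = some ψ) {s : Constraint × List AFormula} (hs : s ∈ ρ.prems) :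
    ∃ ψ' e, s.2[q]? = some ψ' ∧ TraceStep ρ.concl.1 ρ.concl.2 ψ s.1 ψ' e ∧
      (∀ κ, e = .reset κ → ρ.IsReset κ) ∧
      (∀ b n, e = .unfold b n → Advances r ρ ∧ ∃ φ, r.Unfolds p b φ ∧ φ.size = n) ∧
      (Advances r ρ → ∀ φ, r.Unfolds p .nu φ → e = .unfold .nu φ.size) := by
  by_cases hA : Advances r ρ
  · replace hadv := hadv hA
    cases ρ with
    | logic O ρ =>
      have hA' := hA
      obtain ⟨rfl, -⟩ := hA
      obtain ⟨Δ, hΔ, rfl⟩ := List.mem_map.1 hs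
      have hnu : ∀ φ, ¬ (PRule.logic (ρ.strip)).Unfolds p .nu φ := by
        rintro φ ⟨Γ, t, -, ⟨h, -⟩ | ⟨-, h⟩⟩ <;> cases h
      obtain ⟨ψ', h1, h2 | ⟨Γ, φ, t, rfl, rfl, rfl, rfl⟩⟩ :=
        LRule.exists_ancestor ((LRule.strip_anc ρ p q).1 hadv) hψ hΔ
      · exact ⟨ψ', .silent, h1, .logic _ _ h2, by simp, by simp, fun _ φ h => absurd h (hnu φ)⟩
      · refine ⟨_, _, h1, .mu φ t, by simp, ?_, fun _ φ h => absurd h (hnu φ)⟩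
        rintro b n ⟨⟩
        exact ⟨hA', φ.strip, ⟨Γ.map Fm.strip, t, by simp, .inl ⟨rfl, rfl⟩⟩, Fm.size_strip φ⟩
    | nuAnn O Γ φ t κ l =>
      have hA' := hA
      obtain ⟨rfl, hl⟩ := hA
      obtain rfl := List.mem_singleton.1 hs
      obtain ⟨rfl, hp⟩ := hadv
      rcases List.getElem?_concat_of_le hψ with ⟨h1, h2⟩ | ⟨rfl, rfl⟩
      · refine ⟨ψ, .silent, by grind, .annSide κ l ψ hl.1, by simp, by simp, ?_⟩
        rintro - χ ⟨Δ, t', h3, ⟨h4, -⟩ | ⟨-, h4⟩⟩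
        · cases h4
        · simp only [PRule.nu.injEq] at h4
          rw [← h4.1, List.length_map] at h3
          omega
      · refine ⟨_, .unfold .nu φ.size, by simp; rfl, .annMain κ l φ t hl.1, by simp, ?_, ?_⟩
        · rintro b n ⟨⟩
          exact ⟨hA', φ.strip, ⟨Γ.map Fm.strip, t, by simp, .inr ⟨rfl, rfl⟩⟩, Fm.size_strip φ⟩
        · rintro - χ ⟨Δ, t', h3, ⟨h4, -⟩ | ⟨-, h4⟩⟩
          · cases h4
          · simp only [PRule.nu.injEq] at h4
            rw [← h4.2.1, Fm.size_strip]
    | nu => exact hA.elim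
    | cw => exact hA.elim
  · obtain rfl := hnadv hA
    rcases h with ⟨-, ⟨κ, O, Γ, rfl, h⟩ | ⟨O, Γ, rfl, -⟩⟩ | ⟨-, h | h⟩
    · obtain rfl := List.mem_singleton.1 hs
      refine ⟨ψ, .reset κ, hψ, .reset κ ψ h.2.2, ?_, by simp, fun h => absurd h hA⟩
      rintro _ ⟨⟩
      exact ⟨O, Γ, rfl, h⟩
    · obtain rfl := List.mem_singleton.1 hs
      exact ⟨ψ, .silent, hψ, .prune ψ, by simp, by simp, fun h => absurd h hA⟩
    · cases ρ with
      | nu O Γ φ t l =>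
        obtain rfl := List.mem_singleton.1 hs
        rcases List.getElem?_concat_of_le hψ with ⟨h1, h2⟩ | ⟨rfl, rfl⟩
        · exact ⟨ψ, .silent, by grind, .nuSide l ψ hρ.2.2, by simp, by simp,
            fun h => absurd h hA⟩
        · exact ⟨_, .silent, by simp, .nuMain l φ t hρ.2.2, by simp, by simp,
            fun h => absurd h hA⟩
      | _ => exact h.elim
    · exact absurd h hA

open Classical in
/-- A bound for the number of steps until the translation advances. -/
noncomputable def waiting (s : Constraint × List AFormula) : ℕ :=
  s.1.V.card + if ∃ Γ φ t, s.2 = Γ ++ [.fix .nu none φ t] then 2 else 0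

/-- Resets and prunings remove variables. The preparatory `ν` adds one variable, which is outweighed
by the `2` that is lost once the principal formula is annotated. -/
theorem waiting_lt {r : PRule} {ρ : ARule} (hρ : ρ.Valid) (h : TransStep r ρ)
    (hA : ¬ Advances r ρ) {s : Constraint × List AFormula} (hs : s ∈ ρ.prems) :
    waiting s < waiting ρ.concl := by
  have key : ∀ (O : Constraint) (Γ : List AFormula) (L : Finset OrdVar), L ⊆ O.V →
      L.Nonempty → waiting (O.remove L, Γ) < waiting (O, Γ) := by
    intro O Γ L h1 h2
    refine Nat.add_lt_add_right (Finset.card_lt_card ?_) _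
    exact Finset.sdiff_ssubset h1 h2
  rcases h with ⟨-, ⟨κ, O, Γ, rfl, h⟩ | ⟨O, Γ, rfl, h⟩⟩ | ⟨-, h | h⟩
  · obtain rfl := List.mem_singleton.1 hs
    exact key _ _ _ (O.children_subset κ) h.1
  · obtain rfl := List.mem_singleton.1 hs
    exact key _ _ _ (O.prunable_subset Γ) h
  · cases ρ with
    | nu O Γ φ t l =>
      obtain rfl := List.mem_singleton.1 hs
      have hc : (O.add l).V.card ≤ O.V.card + 1 := Finset.card_insert_le _ _
      have h1 : ¬ ∃ Γ' φ' t', Γ ++ [Fm.fix .nu (some l) φ t] = Γ' ++ [.fix .nu none φ' t'] := by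
        rintro ⟨Γ', φ', t', h⟩
        have := (List.append_inj' h rfl).2
        simp at this
      change waiting (O.add l, _) < waiting (O, Γ ++ [.fix .nu none φ t])
      unfold waiting
      dsimp only
      rw [if_neg h1, if_pos ⟨Γ, φ, t, rfl⟩]
      omega
    | _ => exact h.elim
  · exact absurd h hA

/-! ### Branches of the translation and the plain branches they simulate. -/

section Branch

open Coderivation

variable {x : TransState} {β : ℕ → Bool}

/-- Otherwise `waiting` would decrease forever. -/
theorem frequently_adv (h : (transCoalg.unfold x).IsBranch β) (N : ℕ) :
    ∃ i ≥ N, (transCoalg.states x β i : TransState).Adv := by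
  by_contra hc
  push Not at hc
  have key : ∀ i ≥ N, waiting (transCoalg.states x β (i + 1) : TransState).1.2 <
      waiting (transCoalg.states x β i : TransState).1.2 := by
    intro i hi
    have hb := transCoalg.branch_lt h i
    have h1 := TransState.next_snd (List.getElem?_eq_getElem hb)
    have h2 := waiting_lt (transCoalg.states x β i : TransState).rule_valid
      (transCoalg.states x β i : TransState).rule_step (hc i hi) (List.getElem_mem hb)
    rw [← h1, TransState.rule_concl] at h2
    exact h2
  have key' : ∀ k, waiting (transCoalg.states x β (N + k) : TransState).1.2 + k ≤
      waiting (transCoalg.states x β N : TransState).1.2 := by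
    intro k
    induction k with
    | zero => rfl
    | succ k ih =>
      have := key (N + k) (by omega)
      rw [← Nat.add_assoc N k 1]
      omega
  have := key' (waiting (transCoalg.states x β N : TransState).1.2 + 1)
  omega

open Classical in
/-- The number of steps of the plain coderivation simulated before stage `i`. -/
noncomputable def advCount (x : TransState) (β : ℕ → Bool) (i : ℕ) : ℕ :=
  Nat.count (fun i => (transCoalg.states x β i : TransState).Adv) i

/-- The simulated branch of the plain coderivation. -/
noncomputable def simBranch (x : TransState) (β : ℕ → Bool) (n : ℕ) : Bool :=
  β (Nat.nth (fun i => (transCoalg.states x β i : TransState).Adv) n)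

theorem simNode_node (h : (transCoalg.unfold x).IsBranch β) (i : ℕ) :
    simNode x (node β i) = node (simBranch x β) (advCount x β i) := by
  classical
  induction i with
  | zero => simp [node, simNode, advCount]
  | succ i ih =>
    rw [node_succ, simNode_append (transCoalg.run_node h i), ih, advCount, advCount,
      Nat.count_succ]
    split
    · rw [node_succ, simBranch, Nat.nth_count ‹_›]
    · simp

theorem label_simBranch (h : (transCoalg.unfold x).IsBranch β) (i : ℕ) :
    x.1.1.label (node (simBranch x β) (advCount x β i)) =
      some (transCoalg.states x β i : TransState).1.1.rootRule := by
  have := simNode_label (transCoalg.run_node h i) []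
  rw [List.append_nil, simNode_node h] at this
  rw [this, label_nil]

theorem exists_advCount (h : (transCoalg.unfold x).IsBranch β) (n : ℕ) :
    ∃ i, advCount x β i = n ∧ (transCoalg.states x β i : TransState).Adv := by
  classical
  have hinf : (Set.ofPred fun i => (transCoalg.states x β i : TransState).Adv).Infinite := by
    rw [Set.infinite_iff_exists_gt]
    intro N
    obtain ⟨i, hi, hi'⟩ := frequently_adv h (N + 1)
    exact ⟨i, hi', hi⟩
  exact ⟨_, Nat.count_nth_of_infinite hinf n, Nat.nth_mem_of_infinite hinf n⟩

theorem simBranch_isBranch (h : (transCoalg.unfold x).IsBranch β) :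
    x.1.1.IsBranch (simBranch x β) := by
  intro n
  obtain ⟨i, rfl, -⟩ := exists_advCount h n
  rw [label_simBranch h]
  rfl

end Branch

/-- In a cyclic coderivation there are only finitely many rule instances. -/
theorem Coderivation.Cyclic.finite_rules {S : System} {D : Coderivation S} (h : D.Cyclic) :
    {r | ∃ u, D.label u = some r}.Finite := by
  refine (Set.Finite.image (fun E => E.rootRule) (s := D.subs) h).subset ?_
  rintro r ⟨u, hu⟩
  refine ⟨D.sub u (by rw [hu]; rfl), ⟨u, _, rfl⟩, ?_⟩
  have := (D.sub u (by rw [hu]; rfl)).label_nil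
  simp only [Coderivation.sub, List.append_nil, hu, Option.some.injEq] at this
  exact this.symm

/-- In a cyclic coderivation only sizes that progress infinitely often matter for a progressing
trace. -/
theorem PlainCoderivation.IsProgressingTrace.exists_min {D : PlainCoderivation}
    (hD : D.Cyclic) {β : ℕ → Bool} {k : ℕ} {τ : ℕ → ℕ} (h : D.IsProgressingTrace β k τ) :
    ∃ n N, (∀ i ≥ N, ∀ b φ, D.ProgressesAt β τ b φ i → n ≤ φ.size) ∧
      ∀ N', ∃ i ≥ N', ∃ φ, D.ProgressesAt β τ .nu φ i ∧ φ.size = n := by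
  obtain ⟨-, φ, hφ, hmin⟩ := h
  -- There are finitely many rule instances in `D`, and each unfolds at most one set term.
  have hfin : {q : FixKind × Formula | ∃ i, D.ProgressesAt β τ q.1 q.2 i}.Finite := by
    let F : PRule → Set (FixKind × Formula) := fun r => {q | ∃ p, r.Unfolds p q.1 q.2}
    have hF : ∀ r, (F r).Finite := by
      intro r
      refine Set.Subsingleton.finite ?_
      rintro ⟨b, φ⟩ ⟨p, Γ, t, -, h⟩ ⟨b', φ'⟩ ⟨p', Γ', t', -, h'⟩
      rcases h with ⟨rfl, rfl⟩ | ⟨rfl, rfl⟩ <;> rcases h' with ⟨rfl, h'⟩ | ⟨rfl, h'⟩ <;>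
        cases h' <;> rfl
    refine (hD.finite_rules.biUnion fun r _ => hF r).subset ?_
    rintro ⟨b, φ⟩ ⟨i, r, h1, h2⟩
    exact Set.mem_biUnion ⟨_, h1⟩ ⟨_, h2⟩
  -- Since there are finitely many set terms, those that progress only finitely often have all
  -- stopped after some common stage.
  have hev : ∀ᶠ i in Filter.atTop, ∀ q ∈ {q : FixKind × Formula | ∃ i, D.ProgressesAt β τ q.1 q.2 i},
      D.ProgressesAt β τ q.1 q.2 i → φ.size ≤ q.2.size := by
    rw [Filter.eventually_all_finite hfin]
    rintro q -
    by_cases hq : D.ProgressesInfOften β τ q.1 q.2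
    · exact Filter.Eventually.of_forall fun _ _ => hmin _ _ hq
    · exact (Filter.not_frequently.1 hq).mono fun i hi hi' => absurd hi' hi
  obtain ⟨N, hN⟩ := Filter.eventually_atTop.1 hev
  refine ⟨φ.size, N, fun i hi b χ h => hN i hi (b, χ) ⟨i, h⟩ h, fun N' => ?_⟩
  obtain ⟨i, hi, hi'⟩ := Filter.frequently_atTop.1 hφ N'
  exact ⟨i, hi, φ, hi', rfl⟩

section Branch

open Coderivation

variable {x : TransState} {β : ℕ → Bool}

theorem le_advCount_add (h : (transCoalg.unfold x).IsBranch β) (n : ℕ) :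
    ∃ N, ∀ i ≥ N, n ≤ advCount x β i := by
  classical
  obtain ⟨N, rfl, -⟩ := exists_advCount h n
  exact ⟨N, fun i hi => Nat.count_monotone _ hi⟩

theorem advCount_succ_of_adv {i : ℕ} (h : (transCoalg.states x β i : TransState).Adv) :
    advCount x β (i + 1) = advCount x β i + 1 := by
  classical
  simp [advCount, Nat.count_succ, h]

theorem advCount_succ_of_not_adv {i : ℕ} (h : ¬ (transCoalg.states x β i : TransState).Adv) :
    advCount x β (i + 1) = advCount x β i := by
  classical
  simp [advCount, Nat.count_succ, h]

theorem Anc.lt_length {r : PRule} {p q : ℕ} (h : r.Anc p q) : p < r.concl.length := by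
  cases r with
  | nu Γ φ t =>
    have := h.2
    simp only [PRule.concl, List.length_append, List.length_singleton]
    omega
  | logic r =>
    cases r <;> simp only [PRule.Anc, LRule.Anc] at h <;>
      simp only [PRule.concl, LRule.concl, List.length_append, List.length_map, List.length_cons] <;> omega

/-- The progressing trace of the simulated branch is lifted to annotated formulas, standing still
while the translation does not advance, and then `exists_stable_reset_of_trace` applies. -/
theorem exists_stable_reset_of_branch (hcyc : x.1.1.Cyclic) (hprog : x.1.1.Progressing)
    (hV : x.1.2.1.V = ∅) (h : (transCoalg.unfold x).IsBranch β) :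
    ∃ κ, AnnCoderivation.Stable (transCoalg.unfold x) β κ ∧
      AnnCoderivation.ResetInfOften (transCoalg.unfold x) β κ := by
  obtain ⟨k, τ, hτ⟩ := hprog _ (simBranch_isBranch h)
  obtain ⟨n, K, hmin, hinf⟩ := hτ.exists_min hcyc
  -- From stage `N` on, the simulated node lies beyond the start `k` of the trace and beyond the
  -- point `K` after which no body smaller than `n` is unfolded.
  obtain ⟨N, hN⟩ := le_advCount_add h (max k K)
  obtain ⟨T, hT, hxT, hcl⟩ := exists_finite_states hcyc x rfl hV
  -- the states along the branch, and the positions of the trace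
  let y : ℕ → TransState := fun i => transCoalg.states x β (N + i)
  let p : ℕ → ℕ := fun i => τ (advCount x β (N + i))
  have hyT : ∀ i, y i ∈ T := fun i => transCoalg.run_mem hcl hxT (transCoalg.run_node h (N + i))
  have hprem : ∀ i, (y (i + 1)).1.2 ∈ (y i).rule.prems := by
    intro i
    have hb := transCoalg.branch_lt h (N + i)
    have h1 := TransState.next_snd (List.getElem?_eq_getElem hb)
    change (TransState.next (y i) (β (N + i))).1.2 ∈ _
    rw [h1]
    exact List.getElem_mem hb
  have hlab : ∀ i, x.1.1.label (node (simBranch x β) (advCount x β (N + i))) =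
      some (y i).1.1.rootRule := fun i => label_simBranch h (N + i)
  have hanc : ∀ i, (y i).Adv → (y i).1.1.rootRule.Anc (p i) (p (i + 1)) := by
    intro i hi
    have h1 := hN (N + i) (by omega)
    obtain ⟨r, h2, h3⟩ := hτ.1 (advCount x β (N + i)) (by have := le_max_left k K; omega)
    rw [hlab] at h2
    cases h2
    rw [← advCount_succ_of_adv hi] at h3
    exact h3
  have hnanc : ∀ i, ¬ (y i).Adv → p (i + 1) = p i := by
    intro i hi
    change τ (advCount x β (N + i + 1)) = _
    rw [advCount_succ_of_not_adv hi]
  have step : ∀ i ψ, (y i).1.2.2[p i]? = some ψ →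
      ∃ ψ' e, (y (i + 1)).1.2.2[p (i + 1)]? = some ψ' ∧
        TraceStep (y i).1.2.1 (y i).1.2.2 ψ (y (i + 1)).1.2.1 ψ' e ∧
        (∀ κ, e = .reset κ → (y i).rule.IsReset κ) ∧
        (∀ b n, e = .unfold b n → (y i).Adv ∧
          ∃ φ, (y i).1.1.rootRule.Unfolds (p i) b φ ∧ φ.size = n) ∧
        ((y i).Adv → ∀ φ, (y i).1.1.rootRule.Unfolds (p i) .nu φ → e = .unfold .nu φ.size) := by
    intro i ψ hψ
    have := exists_traceStep (y i).rule_valid (y i).rule_step (hanc i) (hnanc i)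
      (by rw [(y i).rule_concl]; exact hψ) (hprem i)
    rwa [(y i).rule_concl] at this
  have hψ₀ : ∃ ψ, (y 0).1.2.2[p 0]? = some ψ := by
    have hlen : ∀ i, (y i).1.2.2.length = (y i).1.1.rootRule.concl.length := fun i => by
      rw [← (y i).2.1.strip, List.length_map]
    have hlt : p 0 < (y 0).1.2.2.length := by
      have h1 := hN (N + 0) (by omega)
      obtain ⟨r, h2, h3⟩ := hτ.1 (advCount x β (N + 0)) (by have := le_max_left k K; omega)
      rw [hlab] at h2
      cases h2
      rw [hlen]
      exact Anc.lt_length h3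
    exact ⟨_, List.getElem?_eq_getElem hlt⟩
  obtain ⟨ψ₀, hψ₀⟩ := hψ₀
  choose! f e hf using step
  let ψ : ℕ → AFormula := fun i => Nat.rec ψ₀ (fun i φ => f i φ) i
  have hψ : ∀ i, (y i).1.2.2[p i]? = some (ψ i) := by
    intro i
    induction i with
    | zero => exact hψ₀
    | succ i ih => exact (hf i _ ih).1
  obtain ⟨B, hB⟩ : ∃ B, ∀ z ∈ T, z.1.2.1.V ⊆ Finset.range B := by
    obtain ⟨B, hB⟩ := (hT.image fun z => z.1.2.1.V.sup id).bddAbove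
    refine ⟨B + 1, fun z hz κ hκ => Finset.mem_range.2 (Nat.lt_succ_of_le ?_)⟩
    exact (Finset.le_sup (f := id) hκ).trans (hB (Set.mem_image_of_mem _ hz))
  obtain ⟨κ, ⟨M, hM⟩, hκ⟩ := exists_stable_reset_of_trace (O := fun i => (y i).1.2.1)
    (Γ := fun i => (y i).1.2.2) (ψ := ψ) (e := fun i => e i (ψ i)) (n := n) (B := B)
    (fun i => hB _ (hyT i)) (fun i => (y i).2.1.ext)
    (fun i => List.mem_of_getElem? (hψ i)) (fun i => (hf i _ (hψ i)).2.1)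
    (fun i b m hb => by
      obtain ⟨-, φ, h1, rfl⟩ := (hf i _ (hψ i)).2.2.2.1 b m hb
      have h2 := hN (N + i) (by omega)
      exact hmin (advCount x β (N + i)) (by have := le_max_right k K; omega) b φ
        ⟨_, hlab i, h1⟩)
    (fun M => by
      obtain ⟨j, hj, φ, ⟨r, h1, h2⟩, rfl⟩ := hinf (advCount x β (N + M))
      obtain ⟨i, rfl, hi⟩ := exists_advCount h j
      -- An advance before stage `N + M` simulates a plain node of index less than `advCount x β (N
      -- + M)`, but `j` is not less than that.
      by_cases hiM : i < N + M
      · classical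
        have : advCount x β i < advCount x β (N + M) := by
          refine lt_of_lt_of_le ?_ (Nat.count_monotone _ (Nat.succ_le_of_lt hiM))
          change _ < advCount x β (i + 1)
          rw [advCount_succ_of_adv hi]
          omega
        omega
      · obtain ⟨i, rfl⟩ := Nat.exists_eq_add_of_le (show N ≤ i by omega)
        refine ⟨i, by omega, ?_⟩
        rw [hlab] at h1
        cases h1
        exact (hf i _ (hψ i)).2.2.2.2 hi φ h2)
  refine ⟨κ, ⟨N + M, fun i hi => ?_⟩, Filter.frequently_atTop.2 fun a => ?_⟩
  · obtain ⟨j, rfl⟩ := Nat.exists_eq_add_of_le (show N ≤ i by omega)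
    refine ⟨_, transCoalg.label_node h (N + j), ?_⟩
    change κ ∈ (y j).rule.concl.1.V
    rw [(y j).rule_concl]
    exact hM j (by omega)
  · obtain ⟨i, hi, hi'⟩ := hκ a
    exact ⟨N + i, by omega, _, transCoalg.label_node h (N + i), (hf i _ (hψ i)).2.2.1 κ hi'⟩

end Branch

/-- Cyclic progressing proofs with atomic identity steps translate into cyclic reset proofs. -/
theorem exists_translation {φ : Formula} {D : PlainCoderivation} (hc : D.Concludes [φ])
    (hcyc : D.Cyclic) (hprog : D.Progressing) (hid : D.AtomicIdent) :
    ∃ E : AnnCoderivation, IsTranslation D E ∧ E.Concludes (Constraint.empty, [φ.strip]) ∧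
      E.sequents.Finite ∧ E.IsResetProof ∧ E.Cyclic := by
  have hroot : D.rootRule.concl = [φ] := (D.concludes_iff _).1 hc
  have hx : Annotates (Constraint.empty, [φ.strip]) D.rootRule.concl := by
    refine ⟨?_, ⟨Constraint.isConstraint_empty, ?_, ?_⟩, ?_⟩
    · simp [hroot, Fm.strip_strip, Fm.strip_empty]
    · simp only [List.mem_singleton, forall_eq, Fm.scoped_strip]
      exact D.rootRule_valid.1 φ (by simp [hroot])
    · rintro κ ⟨ψ, hψ, hκ⟩
      rw [List.mem_singleton.1 hψ] at hκ
      exact absurd hκ (Fm.not_hasAnn_strip _ _)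
    · simp only [List.mem_singleton, forall_eq]
      exact Fm.nuOnly_strip _
  let x : TransState := ⟨(D, (Constraint.empty, [φ.strip])), hx, hid⟩
  obtain ⟨T, hT, hxT, hcl⟩ := exists_finite_states hcyc x rfl rfl
  refine ⟨transCoalg.unfold x, transCoalg_isTranslation x, ?_, sequents_finite hT hxT hcl,
    fun β hβ => exists_stable_reset_of_branch (x := x) hcyc hprog rfl hβ,
    transCoalg.unfold_cyclic_of_finite hT hcl hxT⟩
  have := transCoalg.unfold_concludes x
  rwa [show annSystem.concl (transCoalg.rule x) = x.1.2 from x.rule_concl] at this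

/-! ### Presenting given coderivations by states; tails of branches. -/

namespace Coderivation

variable {S : System}

theorem label_append_none (D : Coderivation S) {u : List Bool} (h : D.label u = none)
    (v : List Bool) : D.label (u ++ v) = none := by
  induction v generalizing u with
  | nil => simpa using h
  | cons b v ih =>
    rw [show u ++ b :: v = (u ++ [b]) ++ v by simp]
    refine ih ?_
    have := D.coherent u b
    rw [h] at this
    simpa using this

theorem label_cons_none (D : Coderivation S) {b : Bool}
    (h : ¬ b.toNat < (S.prems D.rootRule).length) (u : List Bool) : D.label (b :: u) = none := by
  refine D.label_append_none (u := [b]) ?_ u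
  have := D.label_singleton b
  rw [List.getElem?_eq_none (not_lt.1 h)] at this
  simpa using this

end Coderivation

namespace Coalg

open Coderivation

variable {S : System} (C : Coalg S)

/-- States that stand for given coderivations. -/
theorem unfold_eq {f : Coderivation S → C.St} (h1 : ∀ D, C.rule (f D) = D.rootRule)
    (h2 : ∀ D b, b.toNat < (S.prems D.rootRule).length → C.next (f D) b = f (D.child b))
    (D : Coderivation S) : C.unfold (f D) = D := by
  apply ext_label
  intro u
  rw [unfold_label]
  induction u generalizing D with
  | nil => simp [run, h1, label_nil]
  | cons b u ih =>
    simp only [run, h1]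
    split
    · rename_i hb
      rw [h2 D b hb, ih, D.child_label hb]
    · rename_i hb
      rw [D.label_cons_none hb]
      rfl

theorem unfold_label_node {s : C.St} {β : ℕ → Bool} (h : (C.unfold s).IsBranch β) (n : ℕ)
    (w : List Bool) :
    (C.unfold s).label (node β n ++ w) = (C.unfold (C.states s β n)).label w := by
  rw [unfold_label, run_append, C.run_node h]
  rfl

end Coalg

namespace PlainCoderivation

open Coderivation

/-- Progress concerns only what happens infinitely often, so a progressing trace of the tail,
shifted by `n`, is one of the whole branch. -/
theorem exists_progressingTrace_of_tail {D E : PlainCoderivation} {β : ℕ → Bool} {n : ℕ}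
    (h : ∀ w, D.label (node β n ++ w) = E.label w) (hD : D.IsBranch β) (hE : E.Progressing) :
    ∃ k τ, D.IsProgressingTrace β k τ := by
  have hlab : ∀ i, D.label (node β (n + i)) = E.label (node (fun i => β (n + i)) i) := fun i => by
    rw [node_add, h]
  obtain ⟨k, τ, hτ, φ, hφ, hmin⟩ := hE (fun i => β (n + i)) fun i => by
    rw [← hlab]
    exact hD _
  have hprog : ∀ b ψ, D.ProgressesInfOften β (fun i => τ (i - n)) b ψ ↔
      E.ProgressesInfOften (fun i => β (n + i)) τ b ψ := by
    intro b ψ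
    have key : ∀ i, D.ProgressesAt β (fun i => τ (i - n)) b ψ (n + i) ↔
        E.ProgressesAt (fun i => β (n + i)) τ b ψ i := by
      intro i
      simp only [ProgressesAt, hlab, Nat.add_sub_cancel_left]
    simp only [ProgressesInfOften, Filter.frequently_atTop]
    constructor
    · intro H a
      obtain ⟨i, hi, hi'⟩ := H (n + a)
      obtain ⟨j, rfl⟩ := Nat.exists_eq_add_of_le (show n ≤ i by omega)
      exact ⟨j, by omega, (key j).1 hi'⟩
    · intro H a
      obtain ⟨i, hi, hi'⟩ := H a
      exact ⟨n + i, by omega, (key i).2 hi'⟩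
  refine ⟨n + k, fun i => τ (i - n), fun i hi => ?_, φ, (hprog _ _).2 hφ,
    fun b ψ h => hmin b ψ ((hprog _ _).1 h)⟩
  obtain ⟨j, rfl⟩ := Nat.exists_eq_add_of_le (show n ≤ i by omega)
  rw [hlab]
  simpa only [Nat.add_sub_cancel_left, Nat.add_assoc] using hτ j (by omega)

end PlainCoderivation

/-! ### Replacing identity steps by cyclic proofs. -/

/-- There is a cyclic progressing proof with atomic identity steps. -/
def AtomicallyProves (Γ : List Formula) : Prop :=
  ∃ D : PlainCoderivation, D.Concludes Γ ∧ D.Cyclic ∧ D.Progressing ∧ D.AtomicIdent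

namespace AtomicallyProves

open Coderivation

/-- A coderivation with one more rule below it. -/
noncomputable abbrev consCoalg (r : PRule) (hr : r.Valid) (D : PlainCoderivation)
    (h : r.prems = [D.rootRule.concl]) : Coalg plainSystem where
  St := Option PlainCoderivation
  rule s := s.elim r rootRule
  next s b := some (s.elim D fun E => E.child b)
  valid s := by
    cases s with
    | none => exact hr
    | some E => exact E.rootRule_valid
  coh s b p hp := by
    cases s with
    | none =>
      simp only [Option.elim_none, h] at hp
      obtain rfl := List.mem_singleton.1 (List.mem_of_getElem? hp)
      rfl
    | some E => exact E.child_concl hp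

/-- One more rule at the root adds one state and shifts all branches by one. -/
theorem of_rule {r : PRule} (hr : r.Valid) (hid : ∀ Γ φ, r ≠ .logic (.ident Γ φ))
    {Γ : List Formula} (hΓ : r.prems = [Γ]) (h : AtomicallyProves Γ) :
    AtomicallyProves r.concl := by
  obtain ⟨D, hD, hcyc, hprog, hat⟩ := h
  obtain rfl := (D.concludes_iff _).1 hD
  let C := consCoalg r hr D hΓ
  have hsome : ∀ E : PlainCoderivation, C.unfold (some E) = E := fun E =>
    C.unfold_eq (f := some) (fun _ => rfl) (fun _ _ _ => rfl) E
  let T : Set C.St := insert none (some '' subs D)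
  have hT : T.Finite := (Set.Finite.image some (s := subs D) hcyc).insert _
  have hcl : ∀ s ∈ T, ∀ b : Bool, b.toNat < (plainSystem.prems (C.rule s)).length →
      C.next s b ∈ T := by
    rintro s (rfl | ⟨E, hE, rfl⟩) b -
    · exact .inr ⟨D, D.self_mem_subs, rfl⟩
    · exact .inr ⟨_, child_mem_subs hE b, rfl⟩
  refine ⟨C.unfold none, C.unfold_concludes none,
    C.unfold_cyclic_of_finite hT hcl (Set.mem_insert _ _), fun β hβ => ?_, fun u Γ φ hu => ?_⟩
  · refine PlainCoderivation.exists_progressingTrace_of_tail (n := 1) (E := D) (fun w => ?_) hβ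
      hprog
    rw [C.unfold_label_node hβ]
    exact congrArg (fun E : PlainCoderivation => E.label w) (hsome D)
  · rw [Coalg.unfold_label, Option.map_eq_some_iff] at hu
    obtain ⟨s, hs, hs'⟩ := hu
    rcases C.run_mem hcl (Set.mem_insert _ _) hs with rfl | ⟨E, hE, rfl⟩
    · exact absurd hs' (hid Γ φ)
    · refine hat.of_mem_subs hE [] Γ φ ?_
      rw [label_nil]
      exact congrArg some hs'

theorem weaken {Γ : List Formula} (h : AtomicallyProves Γ) {Δ : List Formula}
    (hΔ : PRule.IsSequent (Γ ++ Δ)) : AtomicallyProves (Γ ++ Δ) :=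
  of_rule (r := .logic (.wk Γ Δ))
    ⟨hΔ, fun Ξ hΞ => List.mem_singleton.1 hΞ ▸ fun φ hφ => hΔ φ (by simp [hφ]), trivial⟩
    (by simp) rfl h

theorem swap {Γ Δ : List Formula} {φ ψ : Formula} (h : AtomicallyProves (Γ ++ ψ :: φ :: Δ))
    (hs : PRule.IsSequent (Γ ++ ψ :: φ :: Δ)) : AtomicallyProves (Γ ++ φ :: ψ :: Δ) :=
  of_rule (r := .logic (.exch Γ φ ψ Δ))
    ⟨fun χ hχ => hs χ (by simp [PRule.concl, LRule.concl] at hχ ⊢; tauto),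
      by simpa [PRule.prems, LRule.prems] using hs, trivial⟩
    (by simp) rfl h

/-- The prefix `Ξ` makes the induction work: it absorbs a common first formula, and exchange acts at
any position. -/
theorem perm_append {Γ Δ : List Formula} (h : Γ.Perm Δ) (Ξ : List Formula)
    (hs : PRule.IsSequent (Ξ ++ Γ)) (hΓ : AtomicallyProves (Ξ ++ Γ)) :
    AtomicallyProves (Ξ ++ Δ) := by
  induction h generalizing Ξ with
  | nil => exact hΓ
  | cons φ _ ih =>
    have := ih (Ξ ++ [φ]) (by simpa using hs) (by simpa using hΓ)
    simpa using this
  | swap φ ψ Γ => exact swap hΓ hs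
  | trans h1 _ ih1 ih2 =>
    refine ih2 Ξ (fun χ hχ => hs χ ?_) (ih1 Ξ hs hΓ)
    simp only [List.mem_append, h1.mem_iff] at hχ ⊢
    exact hχ

theorem append_left {Γ Δ : List Formula} (h : AtomicallyProves Δ)
    (hs : PRule.IsSequent (Γ ++ Δ)) : AtomicallyProves (Γ ++ Δ) := by
  have hs' : PRule.IsSequent (Δ ++ Γ) := fun φ hφ => hs φ (by simp at hφ ⊢; tauto)
  simpa using perm_append (List.perm_append_comm (l₁ := Δ) (l₂ := Γ)) [] (by simpa using hs')
    (by simpa using h.weaken hs')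

open Classical in
/-- A coderivation in which the subproofs that satisfy `P` are replaced. -/
noncomputable abbrev graftCoalg (P : PlainCoderivation → Prop)
    (G : PlainCoderivation → PlainCoderivation)
    (hG : ∀ D, P D → (G D).rootRule.concl = D.rootRule.concl) : Coalg plainSystem where
  St := PlainCoderivation ⊕ PlainCoderivation
  rule s := s.elim rootRule rootRule
  next s b := s.elim (fun D => if P (D.child b) then .inr (G (D.child b)) else .inl (D.child b))
    fun E => .inr (E.child b)
  valid s := by
    rcases s with D | E
    · exact D.rootRule_valid
    · exact E.rootRule_valid
  coh s b p hp := by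
    rcases s with D | E
    · have := D.child_concl hp
      simp only [Sum.elim_inl]
      split
      · rw [← this]
        exact hG _ ‹_›
      · exact this
    · exact E.child_concl hp

/-- Identity steps can be replaced by cyclic proofs. -/
theorem of_ident (hI : ∀ φ : Formula, φ.Scoped 0 0 → AtomicallyProves [φ.neg, φ])
    {D : PlainCoderivation} {Γ : List Formula} (hD : D.Concludes Γ) (hcyc : D.Cyclic)
    (hprog : D.Progressing) : AtomicallyProves Γ := by
  classical
  let P : PlainCoderivation → Prop := fun D => ∃ Γ φ, D.rootRule = .logic (.ident Γ φ)
  have hP : ∀ D, P D → AtomicallyProves D.rootRule.concl := by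
    rintro D ⟨Γ, φ, h⟩
    have hv := D.rootRule_valid.1
    change PRule.IsSequent (PRule.concl D.rootRule) at hv
    rw [h] at hv ⊢
    exact append_left (hI φ (hv φ (by simp [PRule.concl, LRule.concl]))) hv
  have hP' : ∀ D, ∃ E : PlainCoderivation, P D →
      E.rootRule.concl = D.rootRule.concl ∧ E.Cyclic ∧ E.Progressing ∧ E.AtomicIdent := by
    intro D
    by_cases h : P D
    · obtain ⟨E, h1, h2⟩ := hP D h
      exact ⟨E, fun _ => ⟨(E.concludes_iff _).1 h1, h2⟩⟩
    · exact ⟨D, fun h' => absurd h' h⟩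
  choose G hG using hP'
  by_cases hPD : P D
  · rw [← (D.concludes_iff _).1 hD]
    exact hP D hPD
  let C := graftCoalg P G fun D h => (hG D h).1
  have hinr : ∀ E : PlainCoderivation, C.unfold (.inr E) = E := fun E =>
    C.unfold_eq (f := .inr) (fun _ => rfl) (fun _ _ _ => rfl) E
  -- Finitely many sub-coderivations of `D` end with an identity, and each is replaced by a proof
  -- with finitely many sub-coderivations.
  let T : Set C.St := .inl '' {E | E ∈ subs D ∧ ¬ P E} ∪
    .inr '' ⋃ E ∈ {E | E ∈ subs D ∧ P E}, subs (G E)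
  have hcyc' : (subs D).Finite := hcyc
  have hT : T.Finite := by
    refine ((hcyc'.subset fun E h => h.1).image _).union (Set.Finite.image _ ?_)
    exact (hcyc'.subset fun E h => h.1).biUnion fun E hE => (hG E hE.2).2.1
  have hcl : ∀ s ∈ T, ∀ b : Bool, b.toNat < (plainSystem.prems (C.rule s)).length →
      C.next s b ∈ T := by
    rintro s (⟨E, ⟨hE, hE'⟩, rfl⟩ | ⟨E, hE, rfl⟩) b -
    · have hch := child_mem_subs hE b
      by_cases h : P (E.child b)
      · refine .inr ⟨_, Set.mem_biUnion (x := E.child b) ⟨hch, h⟩ (self_mem_subs _), ?_⟩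
        exact (if_pos h).symm
      · exact .inl ⟨_, ⟨hch, h⟩, (if_neg h).symm⟩
    · obtain ⟨F, hF, hE⟩ := Set.mem_iUnion₂.1 hE
      exact .inr ⟨_, Set.mem_biUnion hF (child_mem_subs hE b), rfl⟩
  have h0 : (.inl D : C.St) ∈ T := .inl ⟨D, ⟨self_mem_subs D, hPD⟩, rfl⟩
  refine ⟨C.unfold (.inl D), ?_, C.unfold_cyclic_of_finite hT hcl h0, fun β hβ => ?_,
    fun u Δ φ hu => ?_⟩
  · rw [← (D.concludes_iff _).1 hD]
    exact C.unfold_concludes (.inl D)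
  -- A branch that enters a replacement has a tail in a progressing proof; any other branch is a
  -- branch of `D`, with the same labels.
  · by_cases hex : ∃ n E, C.states (.inl D) β n = .inr E
    · obtain ⟨E, hn⟩ := Nat.find_spec hex
      have hmin := fun k => Nat.find_min hex (m := k)
      generalize Nat.find hex = n at hn hmin
      obtain ⟨n, rfl⟩ : ∃ k, n = k + 1 := by
        cases n with
        | zero => cases hn
        | succ k => exact ⟨k, rfl⟩
      obtain ⟨F, hF⟩ : ∃ F, C.states (.inl D) β n = .inl F := by
        rcases h : C.states (.inl D) β n with F | F
        · exact ⟨F, rfl⟩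
        · exact absurd ⟨F, h⟩ (hmin n (Nat.lt_succ_self n))
      have hn' := hn
      simp only [Coalg.states] at hn
      rw [hF] at hn
      have hE : P (F.child (β n)) ∧ G (F.child (β n)) = E := by
        change (if P (F.child (β n)) then _ else _) = _ at hn
        split at hn
        · exact ⟨‹_›, Sum.inr.inj hn⟩
        · cases hn
      refine PlainCoderivation.exists_progressingTrace_of_tail (n := n + 1) (E := E)
        (fun w => ?_) hβ (hE.2 ▸ (hG _ hE.1).2.2.1)
      rw [C.unfold_label_node hβ, hn']
      exact congrArg (fun E : PlainCoderivation => E.label w) (hinr E)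
    · push Not at hex
      have key : ∀ n, ∃ F : PlainCoderivation, C.states (.inl D) β n = .inl F ∧
          ∀ w, D.label (node β n ++ w) = F.label w := by
        intro n
        induction n with
        | zero => exact ⟨D, rfl, fun w => rfl⟩
        | succ n ih =>
          obtain ⟨F, hF, hw⟩ := ih
          have hlt := C.branch_lt hβ n
          have hne := hex (n + 1)
          simp only [Coalg.states] at hne ⊢
          rw [hF] at hlt hne ⊢
          refine ⟨F.child (β n), ?_, fun w => ?_⟩
          · change (if P (F.child (β n)) then _ else _) = _
            split
            · refine absurd ?_ (hne (G (F.child (β n))))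
              exact if_pos ‹_›
            · rfl
          · rw [node_succ, List.append_assoc, hw, F.child_label hlt]
            rfl
      have hlab : ∀ n, (C.unfold (.inl D)).label (node β n) = D.label (node β n) := by
        intro n
        obtain ⟨F, hF, hw⟩ := key n
        have := hw []
        rw [List.append_nil, label_nil] at this
        rw [C.label_node hβ, hF, this]
        rfl
      obtain ⟨k, τ, hτ⟩ := hprog β fun n => by rw [← hlab]; exact hβ n
      refine ⟨k, τ, ?_⟩
      simpa only [PlainCoderivation.IsProgressingTrace, PlainCoderivation.IsTrace,
        PlainCoderivation.ProgressesInfOften, PlainCoderivation.ProgressesAt, hlab] using hτ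
  · rw [Coalg.unfold_label, Option.map_eq_some_iff] at hu
    obtain ⟨s, hs, hs'⟩ := hu
    rcases C.run_mem hcl h0 hs with ⟨E, ⟨hE, hE'⟩, rfl⟩ | ⟨E, hE, rfl⟩
    · exact absurd ⟨Δ, φ, hs'⟩ hE'
    · obtain ⟨F, hF, hE⟩ := Set.mem_iUnion₂.1 hE
      refine (hG F hF.2).2.2.2.of_mem_subs hE [] Δ φ ?_
      rw [label_nil]
      exact congrArg some hs'

end AtomicallyProves

/-! ### Substitution, negation and unfolding. -/

namespace Tm

theorem Scoped.inst_eq {n k : ℕ} {t : Tm} (h : t.Scoped n) (hk : n ≤ k) (u : Tm) :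
    t.inst k u = t := by
  induction t with
  | bv i => simp [inst, (lt_of_lt_of_le h hk).ne]
  | succ t ih => simp [inst, ih h]
  | add s t ih₁ ih₂ | mul s t ih₁ ih₂ => simp [inst, ih₁ h.1, ih₂ h.2]
  | _ => rfl

theorem subst_inst {θ : ℕ → Tm} (hθ : ∀ x, (θ x).Scoped 0) (k : ℕ) (u t : Tm) :
    (t.inst k u).subst θ = (t.subst θ).inst k (u.subst θ) := by
  induction t with
  | fv x => simp [inst, subst, (hθ x).inst_eq (Nat.zero_le k)]
  | bv i => by_cases h : i = k <;> simp [inst, subst, h]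
  | _ => simp_all [inst, subst]

theorem subst_single_of_not_hasFV {y : ℕ} {s t : Tm} (h : ¬ t.HasFV y) :
    t.subst (LRule.single y s) = t := by
  induction t with
  | fv x => simp [subst, LRule.single, Function.update_of_ne (Ne.symm h)]
  | _ => simp_all [subst, HasFV]

theorem Scoped.mono {m n : ℕ} {t : Tm} (h : t.Scoped m) (hmn : m ≤ n) : t.Scoped n := by
  induction t with
  | bv i => exact lt_of_lt_of_le h hmn
  | succ t ih => exact ih h
  | add s t ih₁ ih₂ | mul s t ih₁ ih₂ => exact ⟨ih₁ h.1, ih₂ h.2⟩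
  | _ => trivial

theorem Scoped.subst {θ : ℕ → Tm} (hθ : ∀ x, (θ x).Scoped 0) {n : ℕ} {t : Tm}
    (h : t.Scoped n) : (t.subst θ).Scoped n := by
  induction t with
  | fv x => exact (hθ x).mono (Nat.zero_le n)
  | succ t ih => exact ih h
  | add s t ih₁ ih₂ | mul s t ih₁ ih₂ => exact ⟨ih₁ h.1, ih₂ h.2⟩
  | bv i => exact h
  | zero => trivial

end Tm

theorem LRule.scoped_single {t : Tm} (ht : t.Scoped 0) (y x : ℕ) :
    (LRule.single y t x).Scoped 0 := by
  by_cases h : x = y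
  · simpa [LRule.single, h] using ht
  · simp [LRule.single, Function.update_of_ne h, Tm.Scoped]

namespace Fm

variable {P : Type}

theorem size_neg (φ : Fm P) : φ.neg.size = φ.size := by
  induction φ <;> simp_all [neg, size]

theorem scoped_neg (m n : ℕ) (φ : Fm P) : φ.neg.Scoped m n ↔ φ.Scoped m n := by
  induction φ generalizing m n <;> simp_all [neg, Scoped]

theorem hasFV_neg (x : ℕ) (φ : Fm P) : φ.neg.HasFV x ↔ φ.HasFV x := by
  induction φ <;> simp_all [neg, HasFV]

theorem neg_inst (k : ℕ) (u : Tm) (φ : Fm P) : (φ.inst k u).neg = φ.neg.inst k u := by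
  induction φ generalizing k <;> simp_all [neg, inst]

theorem neg_instSet (b : FixKind) (a : Option P) (χ : Fm P) (k : ℕ) (φ : Fm P) :
    (instSet b a χ k φ).neg = instSet b.dual a χ.neg k φ.neg := by
  induction φ generalizing k with
  | mem t X => by_cases h : X = k <;> simp [neg, instSet, h]
  | _ => simp_all [neg, instSet]

theorem neg_unfold (b : FixKind) (a : Option P) (φ : Fm P) (t : Tm) :
    (unfold b a φ t).neg = unfold b.dual a φ.neg t := by
  simp [unfold, neg_inst, neg_instSet]

theorem neg_subst (θ : ℕ → Tm) (φ : Fm P) : (φ.subst θ).neg = φ.neg.subst θ := by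
  induction φ <;> simp_all [neg, subst]

theorem subst_inst {θ : ℕ → Tm} (hθ : ∀ x, (θ x).Scoped 0) (k : ℕ) (u : Tm) (φ : Fm P) :
    (φ.inst k u).subst θ = (φ.subst θ).inst k (u.subst θ) := by
  induction φ generalizing k <;> simp_all [inst, subst, Tm.subst_inst hθ]

theorem subst_instSet (θ : ℕ → Tm) (b : FixKind) (a : Option P) (χ : Fm P) (k : ℕ)
    (φ : Fm P) :
    (instSet b a χ k φ).subst θ = instSet b a (χ.subst θ) k (φ.subst θ) := by
  induction φ generalizing k with
  | mem t X => by_cases h : X = k <;> simp [subst, instSet, h]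
  | _ => simp_all [subst, instSet]

theorem subst_single_of_not_hasFV {y : ℕ} {s : Tm} {φ : Fm P} (h : ¬ φ.HasFV y) :
    φ.subst (LRule.single y s) = φ := by
  induction φ <;> simp_all [subst, HasFV, Tm.subst_single_of_not_hasFV]

/-- With the substitution rule, the identity for the unfolding at any `t` thus follows from the one
at a single fresh variable. This keeps the number of identities finite although the terms vary. -/
theorem unfold_eq_subst {b : FixKind} {a : Option P} {φ : Fm P} {t : Tm} {y : ℕ}
    (hy : ¬ φ.HasFV y) (ht : t.Scoped 0) :
    unfold b a φ t = (unfold b a φ (.fv y)).subst (LRule.single y t) := by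
  rw [unfold, unfold, subst_inst (LRule.scoped_single ht y), subst_instSet,
    subst_single_of_not_hasFV hy]
  simp [Tm.subst, LRule.single]

theorem Scoped.subst {θ : ℕ → Tm} (hθ : ∀ x, (θ x).Scoped 0) {m n : ℕ} {φ : Fm P}
    (h : φ.Scoped m n) : (φ.subst θ).Scoped m n := by
  induction φ generalizing m n with
  | fix b a φ t ih => exact ⟨ih h.1, h.2.subst hθ⟩
  | and φ ψ ih₁ ih₂ | or φ ψ ih₁ ih₂ => exact ⟨ih₁ h.1, ih₂ h.2⟩
  | all φ ih | ex φ ih => exact ih (n := n + 1) h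
  | mem t X => exact ⟨h.1.subst hθ, h.2⟩
  | lt s t | nlt s t | eq s t | neq s t => exact ⟨h.1.subst hθ, h.2.subst hθ⟩

end Fm

/-! ### Cyclic proofs of identities -/

/-- How the identity for the formula of `q` reduces to identities for other formulas. -/
inductive IdentityStep {Q : Type} (fm : Q → Formula) (q : Q) : Prop
  | atom : (fm q).IsNumAtom → IdentityStep fm q
  | and (q₁ q₂) : fm q = .and (fm q₁) (fm q₂) → IdentityStep fm q
  | or (q₁ q₂) : fm q = .or (fm q₁) (fm q₂) → IdentityStep fm q
  | all (φ y q') : fm q = .all φ → ¬ φ.HasFV y → fm q' = φ.inst 0 (.fv y) → IdentityStep fm q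
  | ex (φ y q') : fm q = .ex φ → ¬ φ.HasFV y → fm q' = φ.inst 0 (.fv y) → IdentityStep fm q
  | fix (b φ t y q') : fm q = .fix b none φ t → ¬ φ.HasFV y →
      fm q' = Fm.unfold b none φ (.fv y) → IdentityStep fm q

/-- Finite derivations with open leaves `¬φ, φ`, where `φ` is given by an element of `Q`. The
numbers are the positions of two traces. -/
inductive OpenDeriv (Q : Type) : Type
  | leaf (q : Q)
  | ax (r : PRule)
  | un (r : PRule) (i j : ℕ) (t : OpenDeriv Q)
  | bin (r : PRule) (i j : ℕ) (t t' : OpenDeriv Q)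

namespace OpenDeriv

variable {Q : Type} (fm : Q → Formula)

def concl : OpenDeriv Q → List Formula
  | leaf q => [(fm q).neg, fm q]
  | ax r => r.concl
  | un r _ _ _ => r.concl
  | bin r _ _ _ _ => r.concl

/-- The positions of the traces. -/
def pos : OpenDeriv Q → Bool → ℕ
  | leaf _, b => b.toNat
  | ax _, b => b.toNat
  | un _ i j _, b => cond b j i
  | bin _ i j _ _, b => cond b j i

/-- The only set terms that a rule unfolds along the traces are those of `¬φ, φ`. -/
def UnfoldsOnly (r : PRule) (i j : ℕ) (φ : Formula) : Prop :=
  (∀ b ψ, r.Unfolds i b ψ → ∃ t, φ.neg = .fix b none ψ t) ∧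
    ∀ b ψ, r.Unfolds j b ψ → ∃ t, φ = .fix b none ψ t

/-- `φ` starts with a fixed point binder. -/
def IsFix (φ : Formula) : Prop := ∃ b ψ t, φ = .fix b none ψ t

/-- The derivation is correct, as a derivation of the identity for `φ`. -/
def Good (φ : Formula) : OpenDeriv Q → Prop
  | leaf q => ¬ IsFix φ → (fm q).size < φ.size
  | ax r => r.Valid ∧ r.prems = [] ∧
      ∀ Γ ψ, r = .logic (.ident Γ ψ) → Γ = [] ∧ ψ.IsNumAtom
  | un r i j t => r.Valid ∧ r.prems = [t.concl fm] ∧ r.Anc i (t.pos false) ∧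
      r.Anc j (t.pos true) ∧ UnfoldsOnly r i j φ ∧ t.Good φ
  | bin r i j t t' => r.Valid ∧ r.prems = [t.concl fm, t'.concl fm] ∧
      (r.Anc i (t.pos false) ∧ r.Anc j (t.pos true)) ∧
      (r.Anc i (t'.pos false) ∧ r.Anc j (t'.pos true)) ∧ UnfoldsOnly r i j φ ∧
      t.Good φ ∧ t'.Good φ

theorem unfoldsOnly_of_ne {r : PRule} (h : ∀ b Γ φ t,
    ¬ ((b = FixKind.mu ∧ r = .logic (.mu Γ φ t)) ∨ (b = .nu ∧ r = .nu Γ φ t))) (i j : ℕ)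
    (φ : Formula) : UnfoldsOnly r i j φ :=
  ⟨fun b ψ ⟨Γ, t, _, h'⟩ => absurd h' (h b Γ ψ t), fun b ψ ⟨Γ, t, _, h'⟩ => absurd h' (h b Γ ψ t)⟩

/-- The rule `μ` or `ν`. -/
def fixRule (Γ : List Formula) (φ : Formula) (t : Tm) : FixKind → PRule
  | .mu => .logic (.mu Γ φ t)
  | .nu => .nu Γ φ t

section fixRule

variable (Γ : List Formula) (φ : Formula) (t : Tm) (b : FixKind)

theorem fixRule_concl : (fixRule Γ φ t b).concl = Γ ++ [.fix b none φ t] := by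
  cases b <;> rfl

theorem fixRule_prems : (fixRule Γ φ t b).prems = [Γ ++ [Fm.unfold b none φ t]] := by
  cases b <;> rfl

theorem fixRule_valid (h1 : PRule.IsSequent (Γ ++ [.fix b none φ t]))
    (h2 : PRule.IsSequent (Γ ++ [Fm.unfold b none φ t])) : (fixRule Γ φ t b).Valid := by
  refine ⟨by rwa [fixRule_concl], by simpa [fixRule_prems] using h2, ?_⟩
  cases b <;> trivial

theorem fixRule_anc (p q : ℕ) : (fixRule Γ φ t b).Anc p q ↔ p = q ∧ p ≤ Γ.length := by
  cases b <;> rfl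

theorem fixRule_unfolds (p : ℕ) (b' : FixKind) (ψ : Formula) :
    (fixRule Γ φ t b).Unfolds p b' ψ ↔ p = Γ.length ∧ b' = b ∧ ψ = φ := by
  constructor
  · rintro ⟨Δ, s, h1, h2⟩
    cases b <;> simp [fixRule] at h2 <;> obtain ⟨rfl, rfl, rfl, rfl⟩ := h2 <;> simp [h1]
  · rintro ⟨h1, rfl, rfl⟩
    refine ⟨Γ, t, h1, ?_⟩
    cases b' <;> simp [fixRule]

end fixRule

theorem _root_.MuPA.PRule.isSequent_cons {φ : Formula} {Γ : List Formula} :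
    PRule.IsSequent (φ :: Γ) ↔ φ.Scoped 0 0 ∧ PRule.IsSequent Γ := by
  simp [PRule.IsSequent]

theorem _root_.MuPA.PRule.isSequent_nil : PRule.IsSequent [] := by
  simp [PRule.IsSequent]

/-- Usual expansion of identities, with one trace on each side. The last clause locates the
unfoldings for a fixed point, of `φ` by the first rule and of `¬φ` by the third, so that either
trace can be shown to progress. -/
theorem exists_deriv (hsc : ∀ q, (fm q).Scoped 0 0) {q : Q} (h : IdentityStep fm q) :
    ∃ t : OpenDeriv Q, (∀ q', t ≠ leaf q') ∧ t.concl fm = [(fm q).neg, fm q] ∧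
      t.Good fm (fm q) ∧ (∀ b, t.pos b = b.toNat) ∧
      ∀ b ψ s, fm q = .fix b none ψ s →
        ∃ r₁ i₁ j₁ r₂ i₂ j₂ r₃ i₃ j₃ t₃, t = un r₁ i₁ j₁ (un r₂ i₂ j₂ (un r₃ i₃ j₃ t₃)) ∧
          r₁.Unfolds j₁ b ψ ∧ r₃.Unfolds i₃ b.dual ψ.neg := by
  have hs := hsc q
  have nseq := @PRule.isSequent_nil
  cases h with
  | atom h =>
    refine ⟨ax (.logic (.ident [] (fm q))), by simp, rfl, ⟨⟨?_, by simp [PRule.prems, LRule.prems],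
      trivial⟩, rfl, ?_⟩, fun b => rfl, ?_⟩
    · simp [PRule.concl, LRule.concl, PRule.isSequent_cons, Fm.scoped_neg, hs, nseq]
    · rintro Γ ψ ⟨⟩
      exact ⟨rfl, h⟩
    · rintro b ψ s h'
      rw [h'] at h
      exact h.elim
  | and q₁ q₂ h =>
    have h1 := hsc q₁
    have h2 := hsc q₂
    have hnf : ∀ b ψ s, fm q ≠ .fix b none ψ s := by simp [h]
    set a := fm q₁ with ha
    set b := fm q₂ with hb
    refine ⟨bin (.logic (.and [.or a.neg b.neg] a b)) 0 1
      (un (.logic (.exch [] (.or a.neg b.neg) a [])) 0 1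
        (un (.logic (.or [a] a.neg b.neg)) 1 0
          (un (.logic (.wk [a, a.neg] [b.neg])) 1 0
            (un (.logic (.exch [] a a.neg [])) 1 0 (leaf q₁)))))
      (un (.logic (.exch [] (.or a.neg b.neg) b [])) 0 1
        (un (.logic (.or [b] a.neg b.neg)) 1 0
          (un (.logic (.exch [b] a.neg b.neg [])) 2 0
            (un (.logic (.wk [b, b.neg] [a.neg])) 1 0
              (un (.logic (.exch [] b b.neg [])) 1 0 (leaf q₂)))))), by simp, ?_, ?_, ?_,
      fun b ψ s h' => absurd h' (hnf b ψ s)⟩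
    · simp [concl, h, PRule.concl, LRule.concl, Fm.neg]
    · simp [Good, concl, pos, PRule.Valid, PRule.concl, PRule.prems, LRule.concl, LRule.prems,
        PRule.isSequent_cons, nseq, PRule.Side, LRule.Side, Fm.scoped_neg, Fm.Scoped, h1, h2,
        PRule.Anc, LRule.Anc, unfoldsOnly_of_ne, ← ha, ← hb, h, Fm.size]
    · rintro (_ | _) <;> rfl
  | or q₁ q₂ h =>
    have h1 := hsc q₁
    have h2 := hsc q₂
    have hnf : ∀ b ψ s, fm q ≠ .fix b none ψ s := by simp [h]
    set a := fm q₁ with ha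
    set b := fm q₂ with hb
    refine ⟨un (.logic (.exch [] (.and a.neg b.neg) (.or a b) [])) 0 1
      (bin (.logic (.and [.or a b] a.neg b.neg)) 1 0
        (un (.logic (.exch [] (.or a b) a.neg [])) 1 0
          (un (.logic (.or [a.neg] a b)) 0 1
            (un (.logic (.wk [a.neg, a] [b])) 0 1 (leaf q₁))))
        (un (.logic (.exch [] (.or a b) b.neg [])) 1 0
          (un (.logic (.or [b.neg] a b)) 0 1
            (un (.logic (.exch [b.neg] a b [])) 0 2
              (un (.logic (.wk [b.neg, b] [a])) 0 1 (leaf q₂)))))), by simp, ?_, ?_, ?_,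
      fun b ψ s h' => absurd h' (hnf b ψ s)⟩
    · simp [concl, h, PRule.concl, LRule.concl, Fm.neg]
    · simp [Good, concl, pos, PRule.Valid, PRule.concl, PRule.prems, LRule.concl, LRule.prems,
        PRule.isSequent_cons, nseq, PRule.Side, LRule.Side, Fm.scoped_neg, Fm.Scoped, h1, h2,
        PRule.Anc, LRule.Anc, unfoldsOnly_of_ne, ← ha, ← hb, h, Fm.size]
    · rintro (_ | _) <;> rfl
  | all φ y q' h hy h' =>
    have h1 := hsc q'
    have hnf : ∀ b ψ s, fm q ≠ .fix b none ψ s := by simp [h]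
    rw [h] at hs
    rw [h'] at h1
    refine ⟨un (.logic (.all [.ex φ.neg] φ y)) 0 1
      (un (.logic (.exch [] (.ex φ.neg) (φ.inst 0 (.fv y)) [])) 0 1
        (un (.logic (.ex [φ.inst 0 (.fv y)] φ.neg (.fv y))) 1 0
          (un (.logic (.exch [] (φ.inst 0 (.fv y)) (φ.inst 0 (.fv y)).neg [])) 1 0 (leaf q')))),
      by simp, ?_, ?_, ?_, fun b ψ s h' => absurd h' (hnf b ψ s)⟩
    · simp [concl, h, PRule.concl, LRule.concl, Fm.neg]
    · have hs' : (Fm.ex φ.neg).Scoped 0 0 := (Fm.scoped_neg 0 0 (.all φ)).2 hs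
      have hsn : (φ.neg.inst 0 (.fv y)).Scoped 0 0 := by
        rw [← Fm.neg_inst, Fm.scoped_neg]
        exact h1
      simp [Good, concl, pos, PRule.Valid, PRule.concl, PRule.prems, LRule.concl, LRule.prems,
        PRule.isSequent_cons, nseq, PRule.Side, LRule.Side, hs, hs', h1, h',
        PRule.Anc, LRule.Anc, unfoldsOnly_of_ne, h, Fm.size, Fm.HasFV, Fm.hasFV_neg,
        hy, Tm.Scoped, Fm.size_inst, Fm.neg_inst, hsn]
    · rintro (_ | _) <;> rfl
  | ex φ y q' h hy h' =>
    have h1 := hsc q'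
    have hnf : ∀ b ψ s, fm q ≠ .fix b none ψ s := by simp [h]
    rw [h] at hs
    rw [h'] at h1
    refine ⟨un (.logic (.exch [] (.all φ.neg) (.ex φ) [])) 0 1
      (un (.logic (.all [.ex φ] φ.neg y)) 1 0
        (un (.logic (.exch [] (.ex φ) (φ.inst 0 (.fv y)).neg [])) 1 0
          (un (.logic (.ex [(φ.inst 0 (.fv y)).neg] φ (.fv y))) 0 1 (leaf q')))),
      by simp, ?_, ?_, ?_, fun b ψ s h' => absurd h' (hnf b ψ s)⟩
    · simp [concl, h, PRule.concl, LRule.concl, Fm.neg]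
    · have hs' : (Fm.all φ.neg).Scoped 0 0 := (Fm.scoped_neg 0 0 (.ex φ)).2 hs
      have hsn : (φ.neg.inst 0 (.fv y)).Scoped 0 0 := by
        rw [← Fm.neg_inst, Fm.scoped_neg]
        exact h1
      simp [Good, concl, pos, PRule.Valid, PRule.concl, PRule.prems, LRule.concl, LRule.prems,
        PRule.isSequent_cons, nseq, PRule.Side, LRule.Side, hs, hs', h1, h',
        PRule.Anc, LRule.Anc, unfoldsOnly_of_ne, h, Fm.size, Fm.HasFV, Fm.hasFV_neg,
        hy, Tm.Scoped, Fm.size_inst, Fm.neg_inst, hsn]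
    · rintro (_ | _) <;> rfl
  | fix b φ t y q' h hy h' =>
    have h1 := hsc q'
    rw [h] at hs
    rw [h'] at h1
    have ht := hs.2
    have hu := Fm.unfold_eq_subst (b := b) (a := none) hy ht
    have h2 : (Fm.unfold b none φ t).Scoped 0 0 := hu ▸ h1.subst (LRule.scoped_single ht y)
    have hs' : (Fm.fix b.dual none φ.neg t).Scoped 0 0 := (Fm.scoped_neg 0 0 (.fix b none φ t)).2 hs
    have hn := Fm.neg_unfold b none φ t
    -- Both sides are unfolded, and the substitution of `t` for the fresh `y` leads to the identity
    -- of `q'`.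
    refine ⟨un (fixRule [.fix b.dual none φ.neg t] φ t b) 0 1
      (un (.logic (.exch [] (.fix b.dual none φ.neg t) (Fm.unfold b none φ t) [])) 0 1
        (un (fixRule [Fm.unfold b none φ t] φ.neg t b.dual) 1 0
          (un (.logic (.exch [] (Fm.unfold b none φ t) (Fm.unfold b none φ t).neg [])) 1 0
            (un (.logic (.sub (LRule.single y t) [(fm q').neg, fm q'])) 0 1 (leaf q'))))),
      by simp, ?_, ?_, ?_, ?_⟩
    · simp [concl, h, fixRule_concl, Fm.neg]
    · have hfix : IsFix (.fix b none φ t) := ⟨_, _, _, rfl⟩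
      have h3 : (Fm.unfold b none φ t).neg.Scoped 0 0 := (Fm.scoped_neg _ _ _).2 h2
      simp only [Good, concl, pos, fixRule_concl, fixRule_prems, fixRule_anc, h, h', hfix,
        not_true_eq_false, false_imp_iff, and_true, ← hn]
      refine ⟨fixRule_valid _ _ _ _ ?_ ?_, by simp [PRule.concl, LRule.concl], by simp, by simp,
        ?_, ⟨?_, ?_, trivial⟩, by simp [PRule.prems, LRule.prems],
        by simp [PRule.Anc, LRule.Anc], by simp [PRule.Anc, LRule.Anc], ?_,
        fixRule_valid _ _ _ _ ?_ ?_, by simp [PRule.concl, LRule.concl],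
        by simp, by simp, ?_,
        ⟨?_, ?_, trivial⟩, ?_, by simp [PRule.Anc, LRule.Anc],
        by simp [PRule.Anc, LRule.Anc], ?_, ⟨?_, ?_, LRule.scoped_single ht y⟩, ?_,
        by simp [PRule.Anc, LRule.Anc], by simp [PRule.Anc, LRule.Anc], ?_⟩
      all_goals first
        | (simp only [UnfoldsOnly, fixRule_unfolds, Fm.neg]; constructor <;> simp <;> done)
        | exact unfoldsOnly_of_ne (by simp) _ _ _
        | (simp [PRule.isSequent_cons, nseq, hs, hs', h2, h3, h1, PRule.concl, LRule.concl,
            PRule.prems, LRule.prems, ← hn, ← hu, Fm.scoped_neg, ← Fm.neg_subst]; done)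
    · rintro (_ | _) <;> rfl
    · rintro b' ψ s h3
      rw [h] at h3
      cases h3
      refine ⟨_, _, _, _, _, _, _, _, _, _, rfl, ?_, ?_⟩
      · simp [fixRule_unfolds]
      · simp [fixRule_unfolds]

end OpenDeriv

namespace OpenDeriv

variable {Q : Type}

/-- The value at a leaf is a dummy: states of the coderivation below are never leaves. -/
def rule : OpenDeriv Q → PRule
  | leaf _ => .logic (.eqRefl .zero)
  | ax r => r
  | un r _ _ _ => r
  | bin r _ _ _ _ => r

def child : OpenDeriv Q → Bool → OpenDeriv Q
  | leaf q, _ => leaf q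
  | ax r, _ => ax r
  | un _ _ _ t, _ => t
  | bin _ _ _ t t', b => cond b t' t

def depth : OpenDeriv Q → ℕ
  | leaf _ => 0
  | ax _ => 0
  | un _ _ _ t => t.depth + 1
  | bin _ _ _ t t' => t.depth + t'.depth + 1

def subtrees : OpenDeriv Q → List (OpenDeriv Q)
  | leaf q => [leaf q]
  | ax r => [ax r]
  | un r i j t => un r i j t :: t.subtrees
  | bin r i j t t' => bin r i j t t' :: (t.subtrees ++ t'.subtrees)

theorem self_mem_subtrees (t : OpenDeriv Q) : t ∈ t.subtrees := by
  cases t <;> simp [subtrees]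

theorem child_mem_subtrees {t t' : OpenDeriv Q} (h : t ∈ t'.subtrees) (b : Bool) :
    t.child b ∈ t'.subtrees := by
  induction t' with
  | leaf q =>
    obtain rfl := List.mem_singleton.1 h
    exact h
  | ax r =>
    obtain rfl := List.mem_singleton.1 h
    exact h
  | un r i j t' ih =>
    rcases List.mem_cons.1 h with rfl | h
    · exact List.mem_cons_of_mem _ t'.self_mem_subtrees
    · exact List.mem_cons_of_mem _ (ih h)
  | bin r i j t₁ t₂ ih₁ ih₂ =>
    refine List.mem_cons_of_mem _ (List.mem_append.2 ?_)
    rcases List.mem_cons.1 h with rfl | h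
    · cases b
      · exact .inl t₁.self_mem_subtrees
      · exact .inr t₂.self_mem_subtrees
    · exact (List.mem_append.1 h).imp ih₁ ih₂

theorem rule_concl (fm : Q → Formula) {t : OpenDeriv Q} (h : ∀ q, t ≠ leaf q) :
    t.rule.concl = t.concl fm := by
  cases t with
  | leaf q => exact absurd rfl (h q)
  | _ => rfl

variable {fm : Q → Formula} {φ : Formula}

theorem Good.valid {t : OpenDeriv Q} (h : t.Good fm φ) : t.rule.Valid := by
  cases t with
  | leaf q =>
    simp [rule, PRule.Valid, PRule.concl, LRule.concl, PRule.prems, LRule.prems, PRule.Side,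
      LRule.Side, PRule.IsSequent, Fm.Scoped, Tm.Scoped]
  | _ => exact h.1

theorem Good.ident {t : OpenDeriv Q} (h : t.Good fm φ) {Γ : List Formula} {ψ : Formula}
    (ht : t.rule = .logic (.ident Γ ψ)) : Γ = [] ∧ ψ.IsNumAtom := by
  cases t with
  | leaf q => cases ht
  | ax r => exact h.2.2 _ _ ht
  | un r i j t =>
    have h2 := h.2.1
    rw [show r = _ from ht] at h2
    cases h2
  | bin r i j t t' =>
    have h2 := h.2.1
    rw [show r = _ from ht] at h2
    cases h2

theorem Good.step {t : OpenDeriv Q} (h : t.Good fm φ) (hl : ∀ q, t ≠ leaf q) {b : Bool}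
    (hb : b.toNat < t.rule.prems.length) :
    t.rule.prems[b.toNat]? = some ((t.child b).concl fm) ∧
      (∀ c, t.rule.Anc (t.pos c) ((t.child b).pos c)) ∧
      (t.child b).Good fm φ ∧ (t.child b).depth < t.depth ∧
      UnfoldsOnly t.rule (t.pos false) (t.pos true) φ := by
  cases t with
  | leaf q => exact absurd rfl (hl q)
  | ax r =>
    have h2 := h.2.1
    simp [rule, h2] at hb
  | un r i j t =>
    have h2 := h.2.1
    simp only [rule, h2, List.length_singleton, Nat.lt_one_iff, Bool.toNat_eq_zero] at hb ⊢
    subst hb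
    refine ⟨rfl, ?_, h.2.2.2.2.2, Nat.lt_succ_self _, h.2.2.2.2.1⟩
    rintro (_ | _)
    · exact h.2.2.1
    · exact h.2.2.2.1
  | bin r i j t t' =>
    have h2 := h.2.1
    simp only [rule, h2]
    cases b
    · refine ⟨rfl, ?_, h.2.2.2.2.2.1, ?_, h.2.2.2.2.1⟩
      · rintro (_ | _)
        · exact h.2.2.1.1
        · exact h.2.2.1.2
      · simp only [child, cond_false, depth]
        omega
    · refine ⟨rfl, ?_, h.2.2.2.2.2.2, ?_, h.2.2.2.2.1⟩
      · rintro (_ | _)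
        · exact h.2.2.2.1.1
        · exact h.2.2.2.1.2
      · simp only [child, cond_true, depth]
        omega

end OpenDeriv

/-! ### Gluing finite derivations to a cyclic proof, and its progress. -/

section Identity

open OpenDeriv Coderivation

variable {Q : Type} (fm : Q → Formula)

/-- A choice of derivations for the identities. -/
structure IdentityDerivs where
  tree : Q → OpenDeriv Q
  ne_leaf : ∀ q q', tree q ≠ leaf q'
  concl : ∀ q, (tree q).concl fm = [(fm q).neg, fm q]
  good : ∀ q, (tree q).Good fm (fm q)
  pos : ∀ q b, (tree q).pos b = b.toNat
  unfolds : ∀ q b ψ s, fm q = .fix b none ψ s →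
    ∃ r₁ i₁ j₁ r₂ i₂ j₂ r₃ i₃ j₃ t₃, tree q = un r₁ i₁ j₁ (un r₂ i₂ j₂ (un r₃ i₃ j₃ t₃)) ∧
      r₁.Unfolds j₁ b ψ ∧ r₃.Unfolds i₃ b.dual ψ.neg

variable {fm}

namespace IdentityDerivs

variable (I : IdentityDerivs fm)

/-- Positions in the derivations. -/
abbrev State (_ : IdentityDerivs fm) : Type :=
  {s : Q × OpenDeriv Q // (∀ q, s.2 ≠ leaf q) ∧ s.2.Good fm (fm s.1)}

/-- Leaves are replaced by the derivations chosen for them. -/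
def start (q : Q) : I.State := ⟨(q, I.tree q), I.ne_leaf q, I.good q⟩

def resume (q : Q) : (t : OpenDeriv Q) → t.Good fm (fm q) → I.State
  | leaf q', _ => I.start q'
  | ax r, h => ⟨(q, ax r), by simp, h⟩
  | un r i j t, h => ⟨(q, un r i j t), by simp, h⟩
  | bin r i j t t', h => ⟨(q, bin r i j t t'), by simp, h⟩

theorem resume_cases (q : Q) (t : OpenDeriv Q) (h : t.Good fm (fm q)) :
    (∃ q', t = leaf q' ∧ I.resume q t h = I.start q') ∨
      ((∀ q', t ≠ leaf q') ∧ (I.resume q t h).1 = (q, t)) := by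
  cases t with
  | leaf q' => exact .inl ⟨q', rfl, rfl⟩
  | _ => exact .inr ⟨by simp, rfl⟩

theorem resume_concl (q : Q) (t : OpenDeriv Q) (h : t.Good fm (fm q)) :
    (I.resume q t h).1.2.concl fm = t.concl fm := by
  cases t with
  | leaf q' => exact I.concl q'
  | _ => rfl

theorem resume_pos (q : Q) (t : OpenDeriv Q) (h : t.Good fm (fm q)) (b : Bool) :
    (I.resume q t h).1.2.pos b = t.pos b := by
  cases t with
  | leaf q' => exact I.pos q' b
  | _ => rfl

open Classical in
noncomputable def next (s : I.State) (b : Bool) : I.State :=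
  if h : b.toNat < s.1.2.rule.prems.length then
    I.resume s.1.1 (s.1.2.child b) (s.2.2.step s.2.1 h).2.2.1
  else s

/-- The cyclic coderivation obtained from the chosen derivations. -/
noncomputable abbrev coalg : Coalg plainSystem where
  St := I.State
  rule s := s.1.2.rule
  next := I.next
  valid s := s.2.2.valid
  coh s b p h := by
    have hb : b.toNat < s.1.2.rule.prems.length := (List.getElem?_eq_some_iff.1 h).1
    have h1 := (s.2.2.step s.2.1 hb).1
    change s.1.2.rule.prems[b.toNat]? = some p at h
    rw [h1] at h
    simp only [next, dif_pos hb]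
    change PRule.concl _ = p
    rw [OpenDeriv.rule_concl fm (I.resume _ _ _).2.1, I.resume_concl]
    exact Option.some.inj h

theorem cyclic [Finite Q] (s : I.State) (hs : s.1.2 ∈ (I.tree s.1.1).subtrees) :
    (I.coalg.unfold s).Cyclic := by
  refine I.coalg.unfold_cyclic_of_finite (T := {s : I.State | s.1.2 ∈ (I.tree s.1.1).subtrees})
    ?_ ?_ hs
  · refine Set.Finite.of_finite_image (f := Subtype.val) ?_ Subtype.val_injective.injOn
    refine Set.Finite.subset (s := ⋃ q, (fun t => (q, t)) '' {t | t ∈ (I.tree q).subtrees}) ?_ ?_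
    · exact Set.finite_iUnion fun q => (List.finite_toSet _).image _
    · rintro _ ⟨⟨⟨q, t⟩, h⟩, ht, rfl⟩
      exact Set.mem_iUnion.2 ⟨q, t, ht, rfl⟩
  · rintro s hs b hb
    change (I.next s b).1.2 ∈ (I.tree (I.next s b).1.1).subtrees
    rw [next, dif_pos hb]
    rcases I.resume_cases s.1.1 (s.1.2.child b) (s.2.2.step s.2.1 hb).2.2.1 with
      ⟨q', -, h⟩ | ⟨-, h⟩
    · rw [h]
      exact self_mem_subtrees _
    · rw [h]
      exact child_mem_subtrees hs b

theorem atomicIdent (s : I.State) :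
    PlainCoderivation.AtomicIdent (I.coalg.unfold s) := by
  intro u Γ φ h
  rw [Coalg.unfold_label, Option.map_eq_some_iff] at h
  obtain ⟨s', -, h⟩ := h
  exact s'.2.2.ident h

section Branch

variable {I} {s : I.State} {β : ℕ → Bool}

/-- A step either passes a leaf to another identity, for a smaller formula unless the old one is a
fixed point, or goes up within the present finite derivation. -/
theorem step_cases (h : (I.coalg.unfold s).IsBranch β) (i : ℕ) :
    (∃ q, I.coalg.states s β (i + 1) = I.start q ∧
      (¬ IsFix (fm (I.coalg.states s β i : I.State).1.1) →
        (fm q).size < (fm (I.coalg.states s β i : I.State).1.1).size)) ∨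
    (I.coalg.states s β (i + 1) : I.State).1 = ((I.coalg.states s β i : I.State).1.1,
      (I.coalg.states s β i : I.State).1.2.child (β i)) ∧
      (I.coalg.states s β (i + 1) : I.State).1.2.depth <
        (I.coalg.states s β i : I.State).1.2.depth := by
  have hb := I.coalg.branch_lt h i
  simp only [Coalg.states]
  generalize (I.coalg.states s β i) = y at hb ⊢
  have hst := y.2.2.step y.2.1 hb
  change (∃ q, I.next y (β i) = _ ∧ _) ∨ (I.next y (β i)).1 = _ ∧ (I.next y (β i)).1.2.depth < _
  rw [next, dif_pos hb]
  rcases I.resume_cases y.1.1 (y.1.2.child (β i)) hst.2.2.1 with ⟨q', h1, h2⟩ | ⟨-, h2⟩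
  · refine .inl ⟨q', h2, ?_⟩
    have := hst.2.2.1
    rw [h1] at this
    exact this
  · rw [h2]
    exact .inr ⟨rfl, hst.2.2.2.1⟩

/-- Every branch visits identities for fixed points infinitely often. -/
theorem exists_start_fix (h : (I.coalg.unfold s).IsBranch β) (N : ℕ) :
    ∃ i ≥ N, ∃ q, I.coalg.states s β i = I.start q ∧ IsFix (fm q) := by
  classical
  by_contra hc
  push Not at hc
  -- If no identity of a fixed point is entered any more, this measure decreases: the first
  -- component pays for leaving the last fixed point, the size for passing other leaves, the depth
  -- for steps within a derivation.
  let μ : ℕ → ℕ ×ₗ ℕ ×ₗ ℕ := fun i =>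
    toLex (if IsFix (fm (I.coalg.states s β (N + i) : I.State).1.1) then 1 else 0,
      toLex ((fm (I.coalg.states s β (N + i) : I.State).1.1).size,
        (I.coalg.states s β (N + i) : I.State).1.2.depth))
  have hμ : ∀ i, μ (i + 1) < μ i := by
    intro i
    rcases step_cases h (N + i) with ⟨q, h1, h2⟩ | ⟨h1, h2⟩
    · have h3 := hc (N + i + 1) (by omega) q h1
      simp only [μ, ← Nat.add_assoc]
      rw [h1]
      change toLex (if IsFix (fm q) then 1 else 0, toLex ((fm q).size, _)) < _
      rw [if_neg h3]
      by_cases h4 : IsFix (fm (I.coalg.states s β (N + i) : I.State).1.1)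
      · rw [if_pos h4]
        exact Prod.Lex.toLex_lt_toLex.2 (.inl Nat.zero_lt_one)
      · rw [if_neg h4]
        exact Prod.Lex.toLex_lt_toLex.2 (.inr ⟨rfl, Prod.Lex.toLex_lt_toLex.2 (.inl (h2 h4))⟩)
    · have h3 := congrArg Prod.fst h1
      simp only [μ, ← Nat.add_assoc]
      rw [h3]
      exact Prod.Lex.toLex_lt_toLex.2 (.inr ⟨rfl, Prod.Lex.toLex_lt_toLex.2 (.inr ⟨rfl, h2⟩)⟩)
  obtain ⟨i, hi⟩ := WellFounded.not_rel_apply_succ (r := (· < ·)) μ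
  exact hi (hμ i)

/-- The derivation in progress at stage `j` was entered at its root, at stage `i₀` or later. -/
theorem exists_start (h : (I.coalg.unfold s).IsBranch β) {i₀ : ℕ} {q₀ : Q}
    (h₀ : I.coalg.states s β i₀ = I.start q₀) {j : ℕ} (hj : i₀ ≤ j) :
    ∃ i ≥ i₀, I.coalg.states s β i = I.start (I.coalg.states s β j : I.State).1.1 := by
  induction j, hj using Nat.le_induction with
  | base => exact ⟨i₀, le_rfl, by rw [h₀]; rfl⟩
  | succ j hj ih =>
    rcases step_cases h j with ⟨q, h1, -⟩ | ⟨h1, -⟩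
    · exact ⟨j + 1, by omega, by rw [h1]; rfl⟩
    · rw [congrArg Prod.fst h1]
      exact ih

/-- Let `q` be a smallest fixed point identity entered infinitely often. Its `ν`-side is `φ` or
`¬φ`; the trace on that side unfolds it infinitely often, and any other set term unfolded infinitely
often belongs to such an identity too and is not smaller. -/
theorem progressing [Finite Q] (s : I.State) :
    PlainCoderivation.Progressing (I.coalg.unfold s) := by
  intro β h
  let y : ℕ → I.State := I.coalg.states s β
  let V : Q → Prop := fun q => ∃ᶠ i in Filter.atTop, y i = I.start q
  -- identities for fixed points that are met infinitely often are visited infinitely often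
  have hV : ∀ P : Q → Prop, (∃ᶠ i in Filter.atTop, P (y i).1.1) → ∃ q, P q ∧ V q := by
    intro P hP
    by_contra hc
    push Not at hc
    have hev : ∀ᶠ i in Filter.atTop, ∀ q, P q → y i ≠ I.start q := by
      rw [Filter.eventually_all]
      intro q
      by_cases hq : P q
      · exact (Filter.not_frequently.1 (hc q hq)).mono fun i hi _ => hi
      · exact Filter.Eventually.of_forall fun i hi => absurd hi hq
    obtain ⟨N, hN⟩ := Filter.eventually_atTop.1 hev
    obtain ⟨i₀, hi₀, q₀, h₀, -⟩ := exists_start_fix h N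
    obtain ⟨j, hj, hj'⟩ := Filter.frequently_atTop.1 hP i₀
    obtain ⟨i, hi, hi'⟩ := exists_start h h₀ hj
    exact hN i (by omega) _ hj' hi'
  have hfix : ∃ q, IsFix (fm q) ∧ V q := by
    refine hV (fun q => IsFix (fm q)) (Filter.frequently_atTop.2 fun N => ?_)
    obtain ⟨i, hi, q, hq, hq'⟩ := exists_start_fix h N
    refine ⟨i, hi, ?_⟩
    change IsFix (fm (I.coalg.states s β i : I.State).1.1)
    rw [hq]
    exact hq'
  obtain ⟨q, ⟨⟨b, ψ, t, hq⟩, hqV⟩, hmin⟩ := Set.exists_min_image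
    {q | IsFix (fm q) ∧ V q} (fun q => (fm q).size) (Set.toFinite _) hfix
  have hlab : ∀ i, (I.coalg.unfold s).label (node β i) = some (y i).1.2.rule :=
    fun i => I.coalg.label_node h i
  have htrace : ∀ c, PlainCoderivation.IsTrace (I.coalg.unfold s) β 0
      fun i => (y i).1.2.pos c := by
    intro c i _
    refine ⟨_, hlab i, ?_⟩
    have hb := I.coalg.branch_lt h i
    have hst := (y i).2.2.step (y i).2.1 hb
    have h1 : y (i + 1) = I.resume _ _ hst.2.2.1 := by
      change I.next (y i) (β i) = _
      rw [next, dif_pos hb]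
    dsimp only
    rw [h1, I.resume_pos]
    exact hst.2.1 c
  have hprog : ∀ c b' χ, PlainCoderivation.ProgressesInfOften (I.coalg.unfold s) β
      (fun i => (y i).1.2.pos c) b' χ → (fm q).size ≤ χ.size + 5 := by
    intro c b' χ hχ
    -- Whatever a trace unfolds is the set term of the identity in progress, up to duality on the
    -- left, so identities of that size are in progress infinitely often.
    obtain ⟨q', ⟨h1, h2⟩, h3⟩ := hV (fun q => IsFix (fm q) ∧ (fm q).size = χ.size + 5)
      (hχ.mono fun i hi => by
        obtain ⟨r, hr, hr'⟩ := hi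
        rw [hlab] at hr
        cases hr
        have hst := (y i).2.2.step (y i).2.1 (I.coalg.branch_lt h i)
        cases c with
        | true =>
          obtain ⟨t', ht'⟩ := hst.2.2.2.2.2 b' χ hr'
          exact ⟨⟨_, _, _, ht'⟩, by rw [ht']; rfl⟩
        | false =>
          obtain ⟨t', ht'⟩ := hst.2.2.2.2.1 b' χ hr'
          have ht'' : fm (y i).1.1 = .fix b'.dual none χ.neg t' := by
            rw [← Fm.neg_neg (fm _), ht']
            rfl
          exact ⟨⟨_, _, _, ht''⟩, by rw [ht'']; simp [Fm.size, Fm.size_neg]⟩)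
    rw [← h2]
    exact hmin q' ⟨h1, h3⟩
  obtain ⟨r₁, i₁, j₁, r₂, i₂, j₂, r₃, i₃, j₃, t₃, ht, hr₁, hr₃⟩ := I.unfolds q b ψ t hq
  have hsize : (fm q).size = ψ.size + 5 := by rw [hq]; rfl
  cases b with
  | nu =>
    refine ⟨0, _, htrace true, ψ, hqV.mono fun i hi => ⟨_, hlab i, ?_⟩, fun b' χ h => ?_⟩
    · have : (y i).1.2 = I.tree q := by rw [hi]; rfl
      change (y i).1.2.rule.Unfolds ((y i).1.2.pos true) _ _
      rw [this, ht]
      exact hr₁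
    · have := hprog _ _ _ h
      omega
  | mu =>
    refine ⟨0, _, htrace false, ψ.neg, Filter.frequently_atTop.2 fun N => ?_, fun b' χ h => ?_⟩
    · obtain ⟨i, hi, hi'⟩ := Filter.frequently_atTop.1 hqV N
      have h0 : (y i).1 = (q, I.tree q) := by rw [hi']; rfl
      have hnext : ∀ j r i' j' r' i'' j'' t', (y j).1.2 = un r i' j' (un r' i'' j'' t') →
          (y (j + 1)).1.2 = un r' i'' j'' t' := by
        intro j r i' j' r' i'' j'' t' hj
        have hb := I.coalg.branch_lt h j
        have hst := (y j).2.2.step (y j).2.1 hb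
        have h1 : y (j + 1) = I.resume _ _ hst.2.2.1 := by
          change I.next (y j) (β j) = _
          rw [next, dif_pos hb]
        have h2 : (y j).1.2.child (β j) = un r' i'' j'' t' := by rw [hj]; rfl
        rcases I.resume_cases _ _ hst.2.2.1 with ⟨q', h3, -⟩ | ⟨-, h3⟩
        · rw [h2] at h3
          cases h3
        · rw [h1, h3, h2]
      have h1 : (y i).1.2 = _ := (congrArg Prod.snd h0).trans ht
      have h3 := hnext _ _ _ _ _ _ _ _ (hnext _ _ _ _ _ _ _ _ h1)
      -- The left side is unfolded by the third rule, two steps after the identity is entered.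
      refine ⟨i + 1 + 1, by omega, _, hlab _, ?_⟩
      change (y (i + 1 + 1)).1.2.rule.Unfolds ((y (i + 1 + 1)).1.2.pos false) _ _
      rw [h3]
      exact hr₃
    · have := hprog _ _ _ h
      rw [Fm.size_neg]
      omega

end Branch

end IdentityDerivs

/-- Identities have cyclic proofs if they reduce to finitely many identities. -/
theorem atomicallyProves_identity [Finite Q] (hsc : ∀ q, (fm q).Scoped 0 0)
    (hstep : ∀ q, IdentityStep fm q) (q : Q) : AtomicallyProves [(fm q).neg, fm q] := by
  choose tree h1 h2 h3 h4 h5 using fun q => OpenDeriv.exists_deriv fm hsc (hstep q)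
  let I : IdentityDerivs fm := ⟨tree, h1, h2, h3, h4, h5⟩
  refine ⟨I.coalg.unfold (I.start q), ?_, I.cyclic _ (self_mem_subtrees _), I.progressing _,
    I.atomicIdent _⟩
  have := I.coalg.unfold_concludes (I.start q)
  rwa [show plainSystem.concl (I.coalg.rule (I.start q)) = [(fm q).neg, fm q] from
    (OpenDeriv.rule_concl fm (h1 q)).trans (h2 q)] at this

end Identity

/-! ### The finitely many identities to which a given one reduces. -/

namespace Tm

theorem exists_fv_bound (t : Tm) : ∃ n, ∀ x, t.HasFV x → x < n := by
  induction t with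
  | fv y => exact ⟨y + 1, fun x h => by simp only [HasFV] at h; omega⟩
  | succ t ih => exact ih
  | add s t ih₁ ih₂ | mul s t ih₁ ih₂ =>
    obtain ⟨n₁, h₁⟩ := ih₁
    obtain ⟨n₂, h₂⟩ := ih₂
    exact ⟨max n₁ n₂, fun x h => lt_max_iff.2 (h.imp (h₁ x) (h₂ x))⟩
  | _ => exact ⟨0, fun x h => h.elim⟩

theorem Scoped.inst_fv {n : ℕ} {t : Tm} (h : t.Scoped (n + 1)) (y : ℕ) :
    (t.inst n (.fv y)).Scoped n := by
  induction t with
  | bv i =>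
    simp only [Scoped] at h
    by_cases hi : i = n
    · simp [inst, hi, Scoped]
    · simp only [inst, hi, if_false, Scoped]
      omega
  | _ => simp_all [inst, Scoped]

end Tm

namespace Fm

variable {P : Type}

theorem exists_fv_bound (φ : Fm P) : ∃ n, ∀ x, φ.HasFV x → x < n := by
  induction φ with
  | and φ ψ ih₁ ih₂ | or φ ψ ih₁ ih₂ =>
    obtain ⟨n₁, h₁⟩ := ih₁
    obtain ⟨n₂, h₂⟩ := ih₂
    exact ⟨max n₁ n₂, fun x h => lt_max_iff.2 (h.imp (h₁ x) (h₂ x))⟩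
  | lt s t | nlt s t | eq s t | neq s t =>
    obtain ⟨n₁, h₁⟩ := s.exists_fv_bound
    obtain ⟨n₂, h₂⟩ := t.exists_fv_bound
    exact ⟨max n₁ n₂, fun x h => lt_max_iff.2 (h.imp (h₁ x) (h₂ x))⟩
  | fix b a φ t ih =>
    obtain ⟨n₁, h₁⟩ := ih
    obtain ⟨n₂, h₂⟩ := t.exists_fv_bound
    exact ⟨max n₁ n₂, fun x h => lt_max_iff.2 (h.imp (h₁ x) (h₂ x))⟩
  | mem t X => exact t.exists_fv_bound
  | all φ ih | ex φ ih => exact ih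

theorem exists_not_hasFV (φ : Fm P) : ∃ y, ¬ φ.HasFV y := by
  obtain ⟨n, h⟩ := φ.exists_fv_bound
  exact ⟨n, fun h' => (h n h').false⟩

theorem Scoped.inst_fv {m n : ℕ} {φ : Fm P} (h : φ.Scoped m (n + 1)) (y : ℕ) :
    (φ.inst n (.fv y)).Scoped m n := by
  induction φ generalizing m n with
  | lt s t | nlt s t | eq s t | neq s t => exact ⟨h.1.inst_fv y, h.2.inst_fv y⟩
  | mem t X => exact ⟨h.1.inst_fv y, h.2⟩
  | fix b a φ t ih => exact ⟨ih h.1, h.2.inst_fv y⟩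
  | and φ ψ ih₁ ih₂ | or φ ψ ih₁ ih₂ => exact ⟨ih₁ h.1, ih₂ h.2⟩
  | all φ ih | ex φ ih => exact ih (n := n + 1) h

theorem Scoped.inst_eq {m n k : ℕ} {φ : Fm P} (h : φ.Scoped m n) (hk : n ≤ k) (u : Tm) :
    φ.inst k u = φ := by
  induction φ generalizing m n k with
  | lt s t | nlt s t | eq s t | neq s t => simp [inst, h.1.inst_eq hk u, h.2.inst_eq hk u]
  | mem t X => simp [inst, h.1.inst_eq hk u]
  | fix b a φ t ih => simp [inst, ih h.1 (Nat.succ_le_succ hk), h.2.inst_eq hk u]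
  | and φ ψ ih₁ ih₂ | or φ ψ ih₁ ih₂ => simp [inst, ih₁ h.1 hk, ih₂ h.2 hk]
  | all φ ih | ex φ ih => simp [inst, ih (n := n + 1) h (Nat.succ_le_succ hk)]

theorem Scoped.mono {m n m' n' : ℕ} {φ : Fm P} (h : φ.Scoped m n) (hm : m ≤ m') (hn : n ≤ n') :
    φ.Scoped m' n' := by
  induction φ generalizing m n m' n' with
  | lt s t | nlt s t | eq s t | neq s t => exact ⟨h.1.mono hn, h.2.mono hn⟩
  | mem t X => exact ⟨h.1.mono hn, lt_of_lt_of_le h.2 hm⟩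
  | fix b a φ t ih => exact ⟨ih h.1 (Nat.succ_le_succ hm) (Nat.succ_le_succ hn), h.2.mono hn⟩
  | and φ ψ ih₁ ih₂ | or φ ψ ih₁ ih₂ => exact ⟨ih₁ h.1 hm hn, ih₂ h.2 hm hn⟩
  | all φ ih | ex φ ih => exact ih (n := n + 1) (n' := n' + 1) h hm (Nat.succ_le_succ hn)

/-- Replace the set variables with indices `k`, `k + 1`, … by the set terms `σ 0`, `σ 1`, …. -/
def instSets (σ : ℕ → FixKind × Fm P) : ℕ → Fm P → Fm P
  | _, lt s t => lt s t
  | _, nlt s t => nlt s t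
  | _, eq s t => eq s t
  | _, neq s t => neq s t
  | k, mem t X => if X < k then mem t X else fix (σ (X - k)).1 none (σ (X - k)).2 t
  | k, fix b a φ t => fix b a (instSets σ (k + 1) φ) t
  | k, and φ ψ => and (instSets σ k φ) (instSets σ k ψ)
  | k, or φ ψ => or (instSets σ k φ) (instSets σ k ψ)
  | k, all φ => all (instSets σ k φ)
  | k, ex φ => ex (instSets σ k φ)

section InstSets

variable {σ : ℕ → FixKind × Fm P}

theorem SetClosed.instSets_eq {k : ℕ} {φ : Fm P} (h : φ.SetClosed k) : instSets σ k φ = φ := by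
  induction φ generalizing k with
  | mem t X => simp [instSets, show X < k from h]
  | _ => simp_all [instSets, SetClosed]

theorem Scoped.instSets (hσ : ∀ j, (σ j).2.Scoped 1 1) {m n k : ℕ} {φ : Fm P}
    (h : φ.Scoped m n) : (instSets σ k φ).Scoped k n := by
  induction φ generalizing m n k with
  | lt s t | nlt s t | eq s t | neq s t => exact h
  | mem t X =>
    by_cases hX : X < k
    · simpa [Fm.instSets, hX, Scoped] using h.1
    · simpa [Fm.instSets, hX, Scoped, h.1] using (hσ _).mono (by omega) (by omega)
  | fix b a φ t ih => exact ⟨ih h.1, h.2⟩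
  | and φ ψ ih₁ ih₂ | or φ ψ ih₁ ih₂ => exact ⟨ih₁ h.1, ih₂ h.2⟩
  | all φ ih | ex φ ih => exact ih (n := n + 1) h

theorem instSets_inst (hσ : ∀ j, (σ j).2.Scoped 1 1) (k j : ℕ) (u : Tm) (φ : Fm P) :
    instSets σ k (φ.inst j u) = (instSets σ k φ).inst j u := by
  induction φ generalizing k j with
  | mem t X =>
    by_cases hX : X < k
    · simp [inst, instSets, hX]
    · simp [inst, instSets, hX, (hσ _).inst_eq]
  | _ => simp_all [inst, instSets]

theorem instSet_instSets (hσ : ∀ j, (σ j).2.Scoped 1 1) (b : FixKind) (χ : Fm P) (k : ℕ)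
    (φ : Fm P) : instSet b none χ k (instSets σ (k + 1) φ) =
      instSets (fun j => Nat.casesOn j (b, χ) σ) k φ := by
  induction φ generalizing k with
  | mem t X =>
    rcases lt_trichotomy X k with hX | rfl | hX
    · simp [instSets, instSet, hX, hX.ne, hX.trans (Nat.lt_succ_self k)]
    · simp [instSets, instSet]
    · obtain ⟨j, rfl⟩ := Nat.exists_eq_add_of_lt hX
      have h1 : k + j + 1 - k = j + 1 := by omega
      have h2 : k + j + 1 - (k + 1) = j := by omega
      simp [instSets, instSet, h1, h2, show ¬ k + j + 1 < k by omega,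
        show ¬ k + j + 1 < k + 1 by omega,
        instSet_of_setClosed ((hσ j).setClosed.mono (show 1 ≤ k + 1 by omega))]
  | _ => simp_all [instSets, instSet]

/-- An unfolding is larger than the fixed point, but it is an instance of the smaller formula `φ`
under a longer list of set terms. This makes recursion on the uninstantiated formula possible. -/
theorem unfold_instSets (hσ : ∀ j, (σ j).2.Scoped 1 1) (b : FixKind) (φ : Fm P) (t : Tm)
    (h : (instSets σ 1 φ).Scoped 1 1) : unfold b none (instSets σ 1 φ) t =
      instSets (fun j => Nat.casesOn j (b, instSets σ 1 φ) σ) 0 (φ.inst 0 t) := by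
  rw [unfold, instSet_instSets hσ, instSets_inst]
  rintro (_ | j)
  exacts [h, hσ j]

end InstSets

end Fm

/-- The identity for `φ` reduces to identities for formulas in `S`. -/
def ReducesTo (S : Set Formula) : Formula → Prop
  | .and φ ψ | .or φ ψ => φ ∈ S ∧ ψ ∈ S
  | .all φ | .ex φ => ∃ y, ¬ φ.HasFV y ∧ φ.inst 0 (.fv y) ∈ S
  | .fix b _ φ _ => ∃ y, ¬ φ.HasFV y ∧ Fm.unfold b none φ (.fv y) ∈ S
  | .mem _ _ => False
  | _ => True

theorem ReducesTo.mono {S T : Set Formula} {φ : Formula} (h : ReducesTo S φ) (hST : S ⊆ T) :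
    ReducesTo T φ := by
  cases φ with
  | and | or => exact ⟨hST h.1, hST h.2⟩
  | all | ex | fix => exact h.imp fun y h => ⟨h.1, hST h.2⟩
  | mem => exact h
  | _ => trivial

theorem ReducesTo.identityStep {S : Set Formula} (φ : S) (h : ReducesTo S φ.1) :
    IdentityStep (fun φ : S => φ.1) φ := by
  obtain ⟨φ, hφ⟩ := φ
  cases φ with
  | and φ ψ => exact .and ⟨φ, h.1⟩ ⟨ψ, h.2⟩ rfl
  | or φ ψ => exact .or ⟨φ, h.1⟩ ⟨ψ, h.2⟩ rfl
  | all φ =>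
    obtain ⟨y, hy, h⟩ := h
    exact .all φ y ⟨_, h⟩ rfl hy rfl
  | ex φ =>
    obtain ⟨y, hy, h⟩ := h
    exact .ex φ y ⟨_, h⟩ rfl hy rfl
  | fix b a φ t =>
    obtain ⟨y, hy, h⟩ := h
    exact .fix b φ t y ⟨_, h⟩ (by rcases a with _ | ⟨⟨⟩⟩; rfl) hy rfl
  | mem => exact h.elim
  | _ => exact .atom trivial

-- The closure has one formula for each subformula of `φ`, with set terms for its free set variables
-- and fresh number variables for the bound ones. The set `A` holds the unfoldings of the
-- surrounding fixed points, to which occurrences of set variables lead back.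
open Fm in
theorem exists_finite_reducesTo {m : ℕ} {φ : Formula} (hφ : φ.Scoped m 0)
    {σ : ℕ → FixKind × Formula} (hσ : ∀ j, (σ j).2.Scoped 1 1) {A : Set Formula}
    (hA : ∀ j < m, ∃ y, ¬ (σ j).2.HasFV y ∧ unfold (σ j).1 none (σ j).2 (.fv y) ∈ A) :
    ∃ B : Set Formula, B.Finite ∧ instSets σ 0 φ ∈ B ∧
      ∀ ψ ∈ B, ψ.Scoped 0 0 ∧ ReducesTo (A ∪ B) ψ := by
  induction hn : φ.size using Nat.strong_induction_on generalizing φ m σ A with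
  | _ n ih =>
  subst hn
  have adjoin (B : Set Formula) (hB : B.Finite)
      (h : ∀ ψ ∈ B, ψ.Scoped 0 0 ∧ ReducesTo (A ∪ B) ψ)
      (h' : ReducesTo (A ∪ B) (instSets σ 0 φ)) :
      ∃ B : Set Formula, B.Finite ∧ instSets σ 0 φ ∈ B ∧
        ∀ ψ ∈ B, ψ.Scoped 0 0 ∧ ReducesTo (A ∪ B) ψ := by
    have sub : A ∪ B ⊆ A ∪ insert (instSets σ 0 φ) B :=
      Set.union_subset_union_right _ (Set.subset_insert _ _)
    refine ⟨insert (instSets σ 0 φ) B, hB.insert _, Set.mem_insert _ _, ?_⟩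
    rintro ψ (rfl | hψ)
    exacts [⟨hφ.instSets hσ, h'.mono sub⟩, ⟨(h ψ hψ).1, (h ψ hψ).2.mono sub⟩]
  cases φ with
  | lt s t | nlt s t | eq s t | neq s t =>
    exact adjoin ∅ Set.finite_empty (by simp) trivial
  | mem t X =>
    obtain ⟨y, hy, h⟩ := hA X hφ.2
    refine adjoin ∅ Set.finite_empty (by simp) ?_
    simpa [instSets, ReducesTo] using ⟨y, hy, h⟩
  | and φ ψ | or φ ψ =>
    obtain ⟨B₁, hf₁, hm₁, h₁⟩ := ih φ.size (by simp only [size]; omega) hφ.1 hσ hA rfl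
    obtain ⟨B₂, hf₂, hm₂, h₂⟩ := ih ψ.size (by simp only [size]; omega) hφ.2 hσ hA rfl
    refine adjoin (B₁ ∪ B₂) (hf₁.union hf₂) ?_ ⟨.inr (.inl hm₁), .inr (.inr hm₂)⟩
    rintro χ (hχ | hχ)
    · exact ⟨(h₁ χ hχ).1, (h₁ χ hχ).2.mono (by gcongr; exact Set.subset_union_left)⟩
    · exact ⟨(h₂ χ hχ).1, (h₂ χ hχ).2.mono (by gcongr; exact Set.subset_union_right)⟩
  | all φ | ex φ =>
    obtain ⟨y, hy⟩ := (instSets σ 0 φ).exists_not_hasFV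
    obtain ⟨B, hf, hm, h⟩ := ih φ.size (by simp only [size]; omega)
      (Scoped.inst_fv (φ := φ) (n := 0) hφ y) hσ hA (size_inst _ _ _)
    rw [instSets_inst hσ] at hm
    exact adjoin B hf h ⟨y, hy, .inr hm⟩
  | fix b a φ t =>
    have hc : (instSets σ 1 φ).Scoped 1 1 := hφ.1.instSets hσ
    obtain ⟨y, hy⟩ := (instSets σ 1 φ).exists_not_hasFV
    obtain ⟨B, hf, hm, h⟩ := ih φ.size (by simp only [size]; omega)
      (hφ.1.inst_fv y) (σ := fun j => Nat.casesOn j (b, instSets σ 1 φ) σ)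
      (A := insert (unfold b none (instSets σ 1 φ) (.fv y)) A)
      (by rintro (_ | j); exacts [hc, hσ j])
      (by
        rintro (_ | j) hj
        · exact ⟨y, hy, .inl rfl⟩
        · obtain ⟨z, hz, h⟩ := hA j (by omega)
          exact ⟨z, hz, .inr h⟩)
      (size_inst _ _ _)
    -- The unfolding added to `A` for the recursive call is itself in the set `B` obtained from it,
    -- so this assumption can be dropped: the loop closes.
    rw [← unfold_instSets hσ b φ _ hc] at hm
    rw [Set.insert_union, Set.insert_eq_of_mem (Set.mem_union_right _ hm)] at h
    exact adjoin B hf h ⟨y, hy, .inr hm⟩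

theorem atomicallyProves_neg_self {φ : Formula} (hφ : φ.Scoped 0 0) :
    AtomicallyProves [φ.neg, φ] := by
  -- The set terms are arbitrary, since `φ` has no free set variable that they could replace.
  obtain ⟨B, hf, hm, h⟩ := exists_finite_reducesTo hφ
    (σ := fun _ => (.mu, .eq .zero .zero)) (fun _ => ⟨trivial, trivial⟩) (A := ∅) (by simp)
  rw [hφ.setClosed.instSets_eq] at hm
  simp only [Set.empty_union] at h
  have := hf.to_subtype
  exact atomicallyProves_identity (fm := fun φ : B => φ.1) (fun φ => (h _ φ.2).1)
    (fun φ => (h _ φ.2).2.identityStep φ) ⟨φ, hm⟩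

end MuPA

theorem mainTheorem3 (φ : MuPA.Formula) :
    (MuPA.CyclicProves φ → MuPA.CyclicResetProves MuPA.Constraint.empty [φ.strip]) ∧
    (∀ D : MuPA.PlainCoderivation,
      D.Concludes [φ] → D.Cyclic → D.Progressing → D.AtomicIdent →
        ∃ E : MuPA.AnnCoderivation, MuPA.IsTranslation D E ∧
          E.Concludes (MuPA.Constraint.empty, [φ.strip]) ∧
          E.sequents.Finite ∧ E.IsResetProof ∧ E.Cyclic) := by
  refine ⟨?_, fun D hc hcyc hprog hid => MuPA.exists_translation hc hcyc hprog hid⟩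
  rintro ⟨D, hc, hcyc, hprog⟩
  obtain ⟨D', hc', hcyc', hprog', hid'⟩ :=
    MuPA.AtomicallyProves.of_ident (fun _ => MuPA.atomicallyProves_neg_self) hc hcyc hprog
  obtain ⟨E, -, hE, -, hE', hE''⟩ := MuPA.exists_translation hc' hcyc' hprog' hid'
  exact ⟨E, hE, hE'', hE'⟩
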